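/- Let $\mathbb K=\mathbb R$ or $\mathbb C$, let $G=\mathrm{SL}(2,\mathbb K)$, regarded as a real Lie group, and let $K=\mathrm{SO}(2)$ if $\mathbb K=\mathbb R$ and $K=\mathrm{SU}(2)$ if $\mathbb K=\mathbb C$. Let $B[1]$ be the set of non-negative real symmetric (if $\mathbb K=\mathbb R$) or Hermitian (if $\mathbb K=\mathbb C$) $2\times2$ matrices of trace $1$; in linear coordinates on the affine space of symmetric/Hermitian matrices of trace $1$ it is a closed ball (of dimension $2$, resp. $3$), and its boundary sphere $\partial B[1]$ consists of the matrices of rank $1$. Put $G[1]=K\times B[1]$, and let $$\iota:G\to G[1],\qquad \iota(g)=\bigl(k,\ (\operatorname{Tr}a)^{-1}a\bigr),$$ where $g=ka$ with $k\in K$ and $a=(g^*g)^{1/2}$ positive definite (the polar decomposition). For a smooth manifold with boundary $X$, let $\mathcal V_b(X)$ be the Lie algebra of all smooth vector fields on $X$ that are tangent to $\partial X$. If a fibration of the boundary is given, that is, a smooth fibre bundle $\pi:\partial X\to Y$ with compact fibres, let $\mathcal V_e(X)\subseteq\mathcal V_b(X)$ be the Lie algebra of edge vector fields: those that are, at the boundary,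 tangent to the fibres of $\pi$. Spans of vector fields on $X$ are taken over the ring $C^\infty(X)$ of functions smooth up to the boundary. **Proposition.** $\iota:G\to G[1]=K\times B[1]$ is an hd-compactification of $G$, with the fibration of the boundary $\partial G[1]=K\times\partial B[1]$ given by the projection $K\times\partial B[1]\to\partial B[1]$. This means the following. * $G[1]$ is a compact smooth manifold with boundary, with $\partial G[1]=K\times\partial B[1]$, and $\iota$ is a diffeomorphism of $G$ onto the interior of $G[1]$. * Inversion extends to a diffeomorphism of $G[1]$: there is a diffeomorphism $\Phi:G[1]\to G[1]$ with $\Phi(\iota(g))=\iota(g^{-1})$ for all $g\in G$. * The right-invariant vector fields on $G$ lift to smooth vector fields on $G[1]$, and their lifts span the Lie algebra $\mathcal V_e(G[1])$ of edge vector fields of the fibration $K\times\partial B[1]\to\partial B[1]$. * The left-invariant vector fields on $G$ lift to smooth vector fields on $G[1]$, and the lifts of the left- and right-invariant vector fields together span $\mathcal V_b(G[1])$. -/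

import Mathlib

open scoped Manifold ContDiff ComplexOrder

/-! ## Vector fields, invariant vector fields, spans -/

section General

variable {EG HG G EX HX X EN HN N EY HY Y EF HF F : Type*}
  [NormedAddCommGroup EG] [NormedSpace ℝ EG] [TopologicalSpace HG]
  (IG : ModelWithCorners ℝ EG HG)
  [TopologicalSpace G] [ChartedSpace HG G] [Group G]
  [NormedAddCommGroup EX] [NormedSpace ℝ EX] [TopologicalSpace HX]
  (IX : ModelWithCorners ℝ EX HX)
  [TopologicalSpace X] [ChartedSpace HX X]
  [NormedAddCommGroup EN] [NormedSpace ℝ EN] [TopologicalSpace HN]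
  (IN : ModelWithCorners ℝ EN HN)
  [TopologicalSpace N] [ChartedSpace HN N]
  [NormedAddCommGroup EY] [NormedSpace ℝ EY] [TopologicalSpace HY]
  (IY : ModelWithCorners ℝ EY HY)
  [TopologicalSpace Y] [ChartedSpace HY Y]
  [NormedAddCommGroup EF] [NormedSpace ℝ EF] [TopologicalSpace HF]
  (IF : ModelWithCorners ℝ EF HF)
  (F) [TopologicalSpace F] [ChartedSpace HF F]

/-- The right-invariant vector field on a Lie group with value `v` at the identity: its value at
`g` is the image of `v` under the differential at `1` of right multiplication by `g`
(for a matrix group, `g ↦ v g`, the generator of the flow `(s, g) ↦ exp (s v) g`).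
The left-invariant ones are Mathlib's `mulInvariantVectorField`. -/
noncomputable def rightInvariantVectorField (v : GroupLieAlgebra IG G) (g : G) :
    TangentSpace IG g :=
  mfderiv IG IG (fun x : G => x * g) 1 v

/-- Smooth vector fields on a manifold (up to the boundary, if there is one). -/
def IsSmoothVectorField [IsManifold IX ∞ X] (V : ∀ x : X, TangentSpace IX x) : Prop :=
  ContMDiff IX IX.tangent ∞ (fun x : X => (⟨x, V x⟩ : TangentBundle IX X))

/-- `W` is a smooth vector field on `X` that extends the vector field `w` on `G`, when `G` is
regarded as a part of `X` by means of `ι`. -/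
def IsLift [IsManifold IX ∞ X] (ι : G → X) (w : ∀ g : G, TangentSpace IG g)
    (W : ∀ x : X, TangentSpace IX x) : Prop :=
  IsSmoothVectorField IX W ∧ ∀ g : G, W (ι g) = mfderiv IG IX ι g (w g)

/-- The lifts to `X` of the right-invariant vector fields on `G`. -/
def rightInvariantLifts [IsManifold IX ∞ X] (ι : G → X) : Set (∀ x : X, TangentSpace IX x) :=
  {W | ∃ v : GroupLieAlgebra IG G, IsLift IG IX ι (rightInvariantVectorField IG v) W}

/-- The lifts to `X` of the left-invariant vector fields on `G`. -/
def leftInvariantLifts [IsManifold IX ∞ X] (ι : G → X) : Set (∀ x : X, TangentSpace IX x) :=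
  {W | ∃ v : GroupLieAlgebra IG G, IsLift IG IX ι (mulInvariantVectorField (I := IG) v) W}

/-- The span of a set of vector fields over the ring `C^∞(X)` of smooth functions on `X`. -/
def smoothSpan (S : Set (∀ x : X, TangentSpace IX x)) : Set (∀ x : X, TangentSpace IX x) :=
  {V | ∃ (n : ℕ) (f : Fin n → C^∞⟮IX, X; ℝ⟯) (W : Fin n → ∀ x : X, TangentSpace IX x),
    (∀ i, W i ∈ S) ∧ ∀ x, V x = ∑ i, f i x • W i x}

/-! ## Manifolds with boundary, fibrations of the boundary, b- and edge vector fields -/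

/-- `X` is a smooth manifold with boundary (as opposed to one with corners, say): every point has
an open neighbourhood that is diffeomorphic to an open subset of `ℝⁿ` or of a closed half-space of
`ℝⁿ⁺¹`. -/
def IsManifoldWithBoundary : Prop :=
  ∀ x : X,
    (∃ (n : ℕ) (e : OpenPartialHomeomorph X (EuclideanSpace ℝ (Fin n))), x ∈ e.source ∧
      ContMDiffOn IX (𝓡 n) ∞ e e.source ∧ ContMDiffOn (𝓡 n) IX ∞ e.symm e.target) ∨
    (∃ (n : ℕ) (e : OpenPartialHomeomorph X (EuclideanHalfSpace (n + 1))), x ∈ e.source ∧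
      ContMDiffOn IX (𝓡∂ (n + 1)) ∞ e e.source ∧ ContMDiffOn (𝓡∂ (n + 1)) IX ∞ e.symm e.target)

/-- `j : N → X` identifies the manifold without boundary `N` with the boundary of `X`, as a smooth
embedding with image `∂X`, and `π : N → Y` is a smooth fibre bundle with compact fibre `F` over
the manifold without boundary `Y`: a fibration of the boundary of `X`. -/
structure IsBoundaryFibration (j : N → X) (π : N → Y) : Prop where
  boundaryless_total : IN.Boundaryless
  boundaryless_base : IY.Boundaryless
  boundaryless_fibre : IF.Boundaryless
  contMDiff_incl : ContMDiff IN IX ∞ j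
  isEmbedding_incl : Topology.IsEmbedding j
  immersion_incl : ∀ n : N, Function.Injective (mfderiv IN IX j n)
  range_incl : Set.range j = IX.boundary X
  t2_base : T2Space Y
  t2_fibre : T2Space F
  compact_fibre : CompactSpace F
  locally_trivial : ∀ y : Y, ∃ e : Bundle.Trivialization F π, y ∈ e.baseSet ∧
    ContMDiffOn IN (IY.prod IF) ∞ e e.source ∧
    ContMDiffOn (IY.prod IF) IN ∞ e.toOpenPartialHomeomorph.symm e.target

/-- The Lie algebra `𝒱_b(X)` of b-vector fields: the smooth vector fields on `X` that are tangent
to the boundary, where the boundary is given by the embedding `j : N → X`. -/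
def bVectorFields [IsManifold IX ∞ X] (j : N → X) : Set (∀ x : X, TangentSpace IX x) :=
  {V | IsSmoothVectorField IX V ∧ ∀ n : N, ∃ w : TangentSpace IN n, mfderiv IN IX j n w = V (j n)}

/-- The Lie algebra `𝒱_e(X)` of edge vector fields: the smooth vector fields on `X` that are
tangent to the boundary and, there, to the fibres of the fibration `π` of the boundary. -/
def edgeVectorFields [IsManifold IX ∞ X] (j : N → X) (π : N → Y) :
    Set (∀ x : X, TangentSpace IX x) :=
  {V | IsSmoothVectorField IX V ∧ ∀ n : N, ∃ w : TangentSpace IN n,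
    mfderiv IN IX j n w = V (j n) ∧ mfderiv IN IY π n w = 0}

/-! ## hd-compactifications -/

/-- `ι : G → X` is a compactification of the manifold without boundary `G`: `X` is a compact
manifold with boundary, and `ι` is a diffeomorphism of `G` onto the interior of `X`. -/
structure IsCompactification (ι : G → X) : Prop where
  compactSpace : CompactSpace X
  t2Space : T2Space X
  isManifold : IsManifold IX ∞ X
  isManifoldWithBoundary : IsManifoldWithBoundary IX (X := X)
  boundaryless : IG.Boundaryless
  contMDiff : ContMDiff IG IX ∞ ι
  range_eq : Set.range ι = IX.interior X
  exists_inverse : ∃ r : X → G, (∀ g, r (ι g) = g) ∧ ContMDiffOn IX IG ∞ r (IX.interior X)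

/-- `ι : G → X` is an hd-compactification of the Lie group `G` as a manifold with boundary, with
the fibration of the boundary given by `j : N → X` and `π : N → Y`. -/
structure IsHDCompactification [LieGroup IG ∞ G] [IsManifold IX ∞ X] [IsManifold IN ∞ N]
    [IsManifold IY ∞ Y] [IsManifold IF ∞ F] (ι : G → X) (j : N → X) (π : N → Y) : Prop where
  isCompactification : IsCompactification IG IX ι
  isBoundaryFibration : IsBoundaryFibration IX IN IY IF F j π
  /-- inversion extends to a diffeomorphism -/
  inversion : ∃ Φ : X ≃ₘ^∞⟮IX, IX⟯ X, ∀ g : G, Φ (ι g) = ι g⁻¹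
  /-- the right-invariant vector fields lift to smooth vector fields on `X` -/
  right_lift : ∀ v : GroupLieAlgebra IG G, ∃ W : ∀ x : X, TangentSpace IX x,
    IsLift IG IX ι (rightInvariantVectorField IG v) W
  /-- the left-invariant vector fields lift to smooth vector fields on `X` -/
  left_lift : ∀ v : GroupLieAlgebra IG G, ∃ W : ∀ x : X, TangentSpace IX x,
    IsLift IG IX ι (mulInvariantVectorField (I := IG) v) W
  /-- the right-invariant vector fields span the edge vector fields of the fibration -/
  right_span : smoothSpan IX (rightInvariantLifts IG IX ι) = edgeVectorFields IX IN IY j π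
  /-- the left- and right-invariant vector fields together span the b-vector fields -/
  left_right_span :
    smoothSpan IX (leftInvariantLifts IG IX ι ∪ rightInvariantLifts IG IX ι) =
      bVectorFields IX IN j

end General

/-! ## `SL(2)` as a real Lie group -/

section SL2

variable {𝕜 : Type*} [RCLike 𝕜]

namespace SL2

open Matrix

/-- The matrix with prescribed entries `a ≠ 0`, `b`, `c` and determinant one. -/
noncomputable def ofTop (p : 𝕜 × 𝕜 × 𝕜) : SpecialLinearGroup (Fin 2) 𝕜 :=
  if h : p.1 ≠ 0 then
    ⟨!![p.1, p.2.1; p.2.2, (1 + p.2.1 * p.2.2) / p.1], by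
      rw [det_fin_two_of, mul_div_cancel₀ _ h]; ring⟩
  else 1

/-- The matrix with prescribed entries `a`, `c ≠ 0`, `d` and determinant one. -/
noncomputable def ofBot (p : 𝕜 × 𝕜 × 𝕜) : SpecialLinearGroup (Fin 2) 𝕜 :=
  if h : p.2.1 ≠ 0 then
    ⟨!![p.1, (p.1 * p.2.2 - 1) / p.2.1; p.2.1, p.2.2], by
      rw [det_fin_two_of, div_mul_cancel₀ _ h]; ring⟩
  else 1

theorem coe_ofTop {p : 𝕜 × 𝕜 × 𝕜} (h : p.1 ≠ 0) :
    (ofTop p : Matrix (Fin 2) (Fin 2) 𝕜) =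
      !![p.1, p.2.1; p.2.2, (1 + p.2.1 * p.2.2) / p.1] := by
  exact congrArg Subtype.val (dif_pos h)

theorem coe_ofBot {p : 𝕜 × 𝕜 × 𝕜} (h : p.2.1 ≠ 0) :
    (ofBot p : Matrix (Fin 2) (Fin 2) 𝕜) =
      !![p.1, (p.1 * p.2.2 - 1) / p.2.1; p.2.1, p.2.2] := by
  exact congrArg Subtype.val (dif_pos h)

theorem isInducing_coe : Topology.IsInducing
    (fun g : SpecialLinearGroup (Fin 2) 𝕜 => (g : Matrix (Fin 2) (Fin 2) 𝕜)) :=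
  Topology.IsInducing.subtypeVal

theorem continuous_entry (i j : Fin 2) :
    Continuous (fun g : SpecialLinearGroup (Fin 2) 𝕜 => g i j) :=
  isInducing_coe.continuous.matrix_elem i j

theorem continuousOn_of_entries {T : Type*} [TopologicalSpace T] {s : Set T}
    {f : T → SpecialLinearGroup (Fin 2) 𝕜}
    (h : ∀ i j, ContinuousOn (fun x => f x i j) s) : ContinuousOn f s := by
  rw [isInducing_coe.continuousOn_iff]
  exact continuousOn_pi.2 fun i => continuousOn_pi.2 fun j => h i j

theorem det_eq (g : SpecialLinearGroup (Fin 2) 𝕜) : g 0 0 * g 1 1 - g 0 1 * g 1 0 = 1 := by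
  rw [← det_fin_two]; exact g.2

/-- The coordinates `(a, b, c)` on the open set `a ≠ 0` of `SL(2)`. -/
noncomputable def chartTop :
    OpenPartialHomeomorph (SpecialLinearGroup (Fin 2) 𝕜) (𝕜 × 𝕜 × 𝕜) where
  toFun g := (g 0 0, g 0 1, g 1 0)
  invFun := ofTop
  source := {g | g 0 0 ≠ 0}
  target := {p | p.1 ≠ 0}
  map_source' _ h := h
  map_target' p h := by
    simpa [coe_ofTop (show p.1 ≠ 0 from h)] using h
  left_inv' g h := by
    apply Subtype.ext
    have h' : g 0 0 ≠ 0 := h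
    have hd := det_eq g
    have : (1 + g 0 1 * g 1 0) / g 0 0 = g 1 1 := by
      rw [div_eq_iff h']; linear_combination -hd
    rw [coe_ofTop h', this]
    exact (eta_fin_two _).symm
  right_inv' p h := by
    simp [coe_ofTop (show p.1 ≠ 0 from h)]
  open_source := isOpen_ne_fun (continuous_entry 0 0) continuous_const
  open_target := isOpen_ne_fun continuous_fst continuous_const
  continuousOn_toFun := by
    exact ((continuous_entry 0 0).prodMk
      ((continuous_entry 0 1).prodMk (continuous_entry 1 0))).continuousOn
  continuousOn_invFun := by
    have : ContinuousOn (fun p : 𝕜 × 𝕜 × 𝕜 => (1 + p.2.1 * p.2.2) / p.1) {p | p.1 ≠ 0} :=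
      ContinuousOn.div (by fun_prop) (by fun_prop) fun p hp => hp
    apply continuousOn_of_entries
    intro i j
    have key : ContinuousOn (fun p : 𝕜 × 𝕜 × 𝕜 =>
        !![p.1, p.2.1; p.2.2, (1 + p.2.1 * p.2.2) / p.1] i j) {p | p.1 ≠ 0} := by
      fin_cases i <;> fin_cases j <;> simp <;> first | exact this | fun_prop
    exact key.congr fun p hp => by rw [coe_ofTop hp]

/-- The coordinates `(a, c, d)` on the open set `c ≠ 0` of `SL(2)`. -/
noncomputable def chartBot :
    OpenPartialHomeomorph (SpecialLinearGroup (Fin 2) 𝕜) (𝕜 × 𝕜 × 𝕜) where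
  toFun g := (g 0 0, g 1 0, g 1 1)
  invFun := ofBot
  source := {g | g 1 0 ≠ 0}
  target := {p | p.2.1 ≠ 0}
  map_source' _ h := h
  map_target' p h := by
    simpa [coe_ofBot (show p.2.1 ≠ 0 from h)] using h
  left_inv' g h := by
    apply Subtype.ext
    have h' : g 1 0 ≠ 0 := h
    have hd := det_eq g
    have : (g 0 0 * g 1 1 - 1) / g 1 0 = g 0 1 := by
      rw [div_eq_iff h']; linear_combination hd
    rw [coe_ofBot h', this]
    exact (eta_fin_two _).symm
  right_inv' p h := by
    simp [coe_ofBot (show p.2.1 ≠ 0 from h)]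
  open_source := isOpen_ne_fun (continuous_entry 1 0) continuous_const
  open_target := isOpen_ne_fun (by fun_prop) continuous_const
  continuousOn_toFun := by
    exact ((continuous_entry 0 0).prodMk
      ((continuous_entry 1 0).prodMk (continuous_entry 1 1))).continuousOn
  continuousOn_invFun := by
    have : ContinuousOn (fun p : 𝕜 × 𝕜 × 𝕜 => (p.1 * p.2.2 - 1) / p.2.1) {p | p.2.1 ≠ 0} :=
      ContinuousOn.div (by fun_prop) (by fun_prop) fun p hp => hp
    apply continuousOn_of_entries
    intro i j
    have key : ContinuousOn (fun p : 𝕜 × 𝕜 × 𝕜 =>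
        !![p.1, (p.1 * p.2.2 - 1) / p.2.1; p.2.1, p.2.2] i j) {p | p.2.1 ≠ 0} := by
      fin_cases i <;> fin_cases j <;> simp <;> first | exact this | fun_prop
    exact key.congr fun p hp => by rw [coe_ofBot hp]

open Classical in
noncomputable instance : ChartedSpace (𝕜 × 𝕜 × 𝕜) (SpecialLinearGroup (Fin 2) 𝕜) where
  atlas := {chartTop, chartBot}
  chartAt g := if g 0 0 ≠ 0 then chartTop else chartBot
  mem_chart_source g := by
    by_cases h : g 0 0 ≠ 0
    · rw [if_pos h]; exact h
    · rw [if_neg h]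
      intro h1
      have := det_eq g
      rw [not_not.1 h, h1] at this
      simp at this
  chart_mem_atlas g := by
    by_cases h : g 0 0 ≠ 0
    · rw [if_pos h]; exact Or.inl rfl
    · rw [if_neg h]; exact Or.inr rfl

theorem contDiffOn_ofTop (i j : Fin 2) :
    ContDiffOn ℝ ∞ (fun p : 𝕜 × 𝕜 × 𝕜 => ofTop p i j) {p | p.1 ≠ 0} := by
  have : ContDiffOn ℝ ∞ (fun p : 𝕜 × 𝕜 × 𝕜 => (1 + p.2.1 * p.2.2) / p.1) {p | p.1 ≠ 0} := by
    simp only [div_eq_mul_inv]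
    have h1 : ContDiff ℝ ∞ (fun p : 𝕜 × 𝕜 × 𝕜 => 1 + p.2.1 * p.2.2) := by fun_prop
    have h2 : ContDiff ℝ ∞ (fun p : 𝕜 × 𝕜 × 𝕜 => p.1) := by fun_prop
    exact h1.contDiffOn.mul (h2.contDiffOn.inv fun _ hp => hp)
  have key : ContDiffOn ℝ ∞ (fun p : 𝕜 × 𝕜 × 𝕜 =>
      !![p.1, p.2.1; p.2.2, (1 + p.2.1 * p.2.2) / p.1] i j) {p | p.1 ≠ 0} := by
    fin_cases i <;> fin_cases j <;> simp <;> first | exact this | fun_prop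
  exact key.congr fun p hp => by rw [coe_ofTop hp]

theorem contDiffOn_ofBot (i j : Fin 2) :
    ContDiffOn ℝ ∞ (fun p : 𝕜 × 𝕜 × 𝕜 => ofBot p i j) {p | p.2.1 ≠ 0} := by
  have : ContDiffOn ℝ ∞ (fun p : 𝕜 × 𝕜 × 𝕜 => (p.1 * p.2.2 - 1) / p.2.1) {p | p.2.1 ≠ 0} := by
    simp only [div_eq_mul_inv]
    have h1 : ContDiff ℝ ∞ (fun p : 𝕜 × 𝕜 × 𝕜 => p.1 * p.2.2 - 1) := by fun_prop
    have h2 : ContDiff ℝ ∞ (fun p : 𝕜 × 𝕜 × 𝕜 => p.2.1) := by fun_prop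
    exact h1.contDiffOn.mul (h2.contDiffOn.inv fun _ hp => hp)
  have key : ContDiffOn ℝ ∞ (fun p : 𝕜 × 𝕜 × 𝕜 =>
      !![p.1, (p.1 * p.2.2 - 1) / p.2.1; p.2.1, p.2.2] i j) {p | p.2.1 ≠ 0} := by
    fin_cases i <;> fin_cases j <;> simp <;> first | exact this | fun_prop
  exact key.congr fun p hp => by rw [coe_ofBot hp]

theorem contDiffOn_atlas_symm {e : OpenPartialHomeomorph (SpecialLinearGroup (Fin 2) 𝕜) (𝕜 × 𝕜 × 𝕜)}
    (he : e ∈ atlas (𝕜 × 𝕜 × 𝕜) (SpecialLinearGroup (Fin 2) 𝕜)) (i j : Fin 2) :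
    ContDiffOn ℝ ∞ (fun p => e.symm p i j) e.target := by
  rcases he with rfl | rfl
  · exact contDiffOn_ofTop i j
  · exact contDiffOn_ofBot i j

instance : IsManifold 𝓘(ℝ, 𝕜 × 𝕜 × 𝕜) ∞ (SpecialLinearGroup (Fin 2) 𝕜) := by
  apply isManifold_of_contDiffOn
  intro e e' he he'
  have h := fun i j => (contDiffOn_atlas_symm he i j).mono
    (show (e.symm ≫ₕ e').source ⊆ e.target from fun p hp => hp.1)
  simp only [modelWithCornersSelf_coe, modelWithCornersSelf_coe_symm, Set.preimage_id,
    Function.id_comp, Function.comp_id, Set.range_id, Set.inter_univ]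
  rcases he' with rfl | rfl
  · exact (h 0 0).prodMk ((h 0 1).prodMk (h 1 0))
  · exact (h 0 0).prodMk ((h 1 0).prodMk (h 1 1))

theorem contMDiff_entry (i j : Fin 2) :
    ContMDiff 𝓘(ℝ, 𝕜 × 𝕜 × 𝕜) 𝓘(ℝ, 𝕜) ∞
      (fun g : SpecialLinearGroup (Fin 2) 𝕜 => g i j) := by
  rw [contMDiff_iff]
  refine ⟨continuous_entry i j, fun g _ => ?_⟩
  have h := contDiffOn_atlas_symm (chart_mem_atlas (𝕜 × 𝕜 × 𝕜) g) i j
  exact h.mono fun p hp => by simpa using hp.1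

theorem contMDiff_of_entries {E H M : Type*} [NormedAddCommGroup E] [NormedSpace ℝ E]
    [TopologicalSpace H] {I : ModelWithCorners ℝ E H} [TopologicalSpace M] [ChartedSpace H M]
    {f : M → SpecialLinearGroup (Fin 2) 𝕜}
    (h : ∀ i j, ContMDiff I 𝓘(ℝ, 𝕜) ∞ (fun x => f x i j)) :
    ContMDiff I 𝓘(ℝ, 𝕜 × 𝕜 × 𝕜) ∞ f := by
  intro x
  rw [contMDiffAt_iff_target]
  constructor
  · have : Continuous f := by
      rw [← continuousOn_univ]
      exact continuousOn_of_entries fun i j => (h i j).continuous.continuousOn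
    exact this.continuousAt
  · have hc : extChartAt 𝓘(ℝ, 𝕜 × 𝕜 × 𝕜) (f x) ∘ f = chartAt (𝕜 × 𝕜 × 𝕜) (f x) ∘ f := by
      ext y <;> simp
    rw [hc]
    rcases chart_mem_atlas (𝕜 × 𝕜 × 𝕜) (f x) with h1 | h1 <;> rw [h1]
    · exact ((h 0 0).prodMk_space ((h 0 1).prodMk_space (h 1 0))) x
    · exact ((h 0 0).prodMk_space ((h 1 0).prodMk_space (h 1 1))) x

instance : LieGroup 𝓘(ℝ, 𝕜 × 𝕜 × 𝕜) ∞ (SpecialLinearGroup (Fin 2) 𝕜) where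
  contMDiff_mul := by
    apply contMDiff_of_entries
    intro i j
    have h1 := fun i j => (contMDiff_entry (𝕜 := 𝕜) i j).comp
      (contMDiff_fst (I := 𝓘(ℝ, 𝕜 × 𝕜 × 𝕜)) (J := 𝓘(ℝ, 𝕜 × 𝕜 × 𝕜)) (n := ∞)
        (M := SpecialLinearGroup (Fin 2) 𝕜) (N := SpecialLinearGroup (Fin 2) 𝕜))
    have h2 := fun i j => (contMDiff_entry (𝕜 := 𝕜) i j).comp
      (contMDiff_snd (I := 𝓘(ℝ, 𝕜 × 𝕜 × 𝕜)) (J := 𝓘(ℝ, 𝕜 × 𝕜 × 𝕜)) (n := ∞)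
        (M := SpecialLinearGroup (Fin 2) 𝕜) (N := SpecialLinearGroup (Fin 2) 𝕜))
    have hm : ContDiff ℝ ∞ (fun p : (𝕜 × 𝕜) × (𝕜 × 𝕜) => p.1.1 * p.1.2 + p.2.1 * p.2.2) := by
      fun_prop
    have := hm.contMDiff.comp (((h1 i 0).prodMk_space (h2 0 j)).prodMk_space
      ((h1 i 1).prodMk_space (h2 1 j)))
    refine this.congr fun p => ?_
    simp [mul_apply, Fin.sum_univ_two]
  contMDiff_inv := by
    apply contMDiff_of_entries
    intro i j
    have hn : ∀ i j, ContMDiff 𝓘(ℝ, 𝕜 × 𝕜 × 𝕜) 𝓘(ℝ, 𝕜) ∞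
        (fun g : SpecialLinearGroup (Fin 2) 𝕜 => -g i j) := fun i j =>
      (contDiff_neg (𝕜 := ℝ) (F := 𝕜) (n := ∞)).contMDiff.comp (contMDiff_entry i j)
    fin_cases i <;> fin_cases j <;>
      simp only [SpecialLinearGroup.SL2_inv_expl, Fin.zero_eta, Fin.mk_one, cons_val',
        cons_val_zero, cons_val_one, cons_val_fin_one, Fin.isValue]
    · exact contMDiff_entry 1 1
    · exact hn 0 1
    · exact hn 1 0
    · exact contMDiff_entry 0 0

end SL2

end SL2

/-! ## Transport of a manifold structure along a homeomorphism -/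

section Transport

variable {H X S : Type*} [TopologicalSpace H] [TopologicalSpace X] [TopologicalSpace S]

/-- The charted space structure on `X` for which the homeomorphism `h : X ≃ₜ S` is a
diffeomorphism: its charts are the charts of `S` composed with `h`. -/
@[reducible]
def transportChartedSpace [ChartedSpace H S] (h : X ≃ₜ S) : ChartedSpace H X where
  atlas := {e | ∃ c ∈ atlas H S, e = h.toOpenPartialHomeomorph ≫ₕ c}
  chartAt x := h.toOpenPartialHomeomorph ≫ₕ chartAt H (h x)
  mem_chart_source x := by simp
  chart_mem_atlas x := ⟨_, chart_mem_atlas H (h x), rfl⟩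

theorem transport_isManifold {E : Type*} [NormedAddCommGroup E] [NormedSpace ℝ E]
    (I : ModelWithCorners ℝ E H) [ChartedSpace H S] [IsManifold I ∞ S] (h : X ≃ₜ S) :
    @IsManifold ℝ _ E _ _ H _ I ∞ X _ (transportChartedSpace h) := by
  let _ := transportChartedSpace (H := H) h
  have _ : HasGroupoid X (contDiffGroupoid ∞ I) := by
    constructor
    rintro _ _ ⟨c, hc, rfl⟩ ⟨c', hc', rfl⟩
    refine (contDiffGroupoid ∞ I).mem_of_eqOnSource
      ((contDiffGroupoid ∞ I).compatible hc hc') ⟨?_, fun p _ => ?_⟩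
    · ext p; simp
    · simp
  exact IsManifold.mk' I ∞ X

end Transport

/-! ## The closed ball of non-negative matrices of trace one -/

section Ball

open Matrix

variable (𝕜 : Type*) [RCLike 𝕜]

/-- The non-negative Hermitian (real symmetric, if `𝕜 = ℝ`) `2 × 2` matrices of trace one, with
the topology of the space of matrices. -/
abbrev TraceOneBall : Type _ :=
  {b : Matrix (Fin 2) (Fin 2) 𝕜 // b.PosSemidef ∧ b.trace = 1}

/-- The non-negative Hermitian (real symmetric, if `𝕜 = ℝ`) `2 × 2` matrices of trace one and
rank one. -/
abbrev TraceOneSphere : Type _ :=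
  {b : Matrix (Fin 2) (Fin 2) 𝕜 // b.PosSemidef ∧ b.trace = 1 ∧ b.det = 0}

variable {𝕜}

namespace TraceOneBall

/-- Linear coordinates on the Hermitian matrices of trace one: the matrix
`½ [[1 + r, z], [conj z, 1 - r]]` has the coordinates `(r, z)`. -/
noncomputable def coords (b : Matrix (Fin 2) (Fin 2) 𝕜) : WithLp 2 (ℝ × 𝕜) :=
  WithLp.toLp 2 (RCLike.re (b 0 0 - b 1 1), 2 * b 0 1)

/-- The Hermitian matrix of trace one with given coordinates. -/
noncomputable def ofCoords (x : WithLp 2 (ℝ × 𝕜)) : Matrix (Fin 2) (Fin 2) 𝕜 :=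
  !![((((1 + x.fst) / 2 : ℝ)) : 𝕜), x.snd / 2; star x.snd / 2, ((((1 - x.fst) / 2 : ℝ)) : 𝕜)]

theorem coords_ofCoords (x : WithLp 2 (ℝ × 𝕜)) : coords (ofCoords x) = x := by
  apply WithLp.ofLp_injective 2
  refine Prod.ext ?_ ?_
  · simp only [coords, ofCoords, of_apply, cons_val', cons_val_zero, cons_val_one,
      cons_val_fin_one, map_sub, RCLike.ofReal_re]
    change _ = x.fst
    ring
  · simp [coords, ofCoords, mul_div_cancel₀]

theorem ofCoords_coords {b : Matrix (Fin 2) (Fin 2) 𝕜} (hb : b.IsHermitian)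
    (ht : b.trace = 1) : ofCoords (coords b) = b := by
  have h0 : ((RCLike.re (b 0 0) : ℝ) : 𝕜) = b 0 0 := hb.coe_re_apply_self 0
  have h1 : ((RCLike.re (b 1 1) : ℝ) : 𝕜) = b 1 1 := hb.coe_re_apply_self 1
  have h2 : star (b 0 1) = b 1 0 := hb.apply 1 0
  have h3 : b 0 0 + b 1 1 = 1 := by rw [← trace_fin_two]; exact ht
  have h4 : (algebraMap ℝ 𝕜) 2 = 2 := map_ofNat _ 2
  ext i j
  fin_cases i <;> fin_cases j <;>
    simp [ofCoords, coords, h0, h1, h4, mul_div_cancel_left₀]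
  · linear_combination (-1 / 2 : 𝕜) * h3
  · exact h2
  · linear_combination (-1 / 2 : 𝕜) * h3

theorem isHermitian_ofCoords (x : WithLp 2 (ℝ × 𝕜)) : (ofCoords x).IsHermitian := by
  ext i j
  fin_cases i <;> fin_cases j <;> simp [ofCoords]

theorem trace_ofCoords (x : WithLp 2 (ℝ × 𝕜)) : (ofCoords x).trace = 1 := by
  simp only [ofCoords, trace_fin_two_of]
  rw [← RCLike.ofReal_add]
  norm_num [← add_div]

theorem det_ofCoords (x : WithLp 2 (ℝ × 𝕜)) :
    (ofCoords x).det = (((1 - ‖x‖ ^ 2) / 4 : ℝ) : 𝕜) := by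
  have h := RCLike.mul_conj x.snd
  rw [← RCLike.star_def] at h
  rw [ofCoords, det_fin_two_of, WithLp.prod_norm_sq_eq_of_L2, Real.norm_eq_abs, sq_abs]
  push_cast
  linear_combination (-1 / 4 : 𝕜) * h

theorem posSemidef_ofCoords_iff (x : WithLp 2 (ℝ × 𝕜)) : (ofCoords x).PosSemidef ↔ ‖x‖ ≤ 1 := by
  constructor
  · intro h
    have h1 := h.det_nonneg
    rw [det_ofCoords, RCLike.ofReal_nonneg] at h1
    nlinarith [norm_nonneg x]
  · intro h
    have h1 : (0 : 𝕜) ≤ (ofCoords x).det := by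
      rw [det_ofCoords, RCLike.ofReal_nonneg]
      nlinarith [norm_nonneg x]
    have h2 : ofCoords x = (ofCoords x)ᴴ * ofCoords x + (ofCoords x).det • 1 := by
      have ht := trace_ofCoords x
      rw [(isHermitian_ofCoords x).eq]
      generalize ofCoords x = b at ht
      rw [trace_fin_two] at ht
      ext i j
      fin_cases i <;> fin_cases j <;> simp [mul_apply, Fin.sum_univ_two, det_fin_two]
      · linear_combination (-b 0 0) * ht
      · linear_combination (-b 0 1) * ht
      · linear_combination (-b 1 0) * ht
      · linear_combination (-b 1 1) * ht
    rw [h2]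
    exact (posSemidef_conjTranspose_mul_self _).add (PosSemidef.one.smul h1)

theorem norm_coords_le (b : TraceOneBall 𝕜) : ‖coords b.1‖ ≤ 1 := by
  rw [← posSemidef_ofCoords_iff, ofCoords_coords b.2.1.1 b.2.2]
  exact b.2.1

theorem continuous_coords : Continuous (coords : Matrix (Fin 2) (Fin 2) 𝕜 → _) := by
  refine (WithLp.prod_continuous_toLp 2 ℝ 𝕜).comp ?_
  refine Continuous.prodMk (RCLike.continuous_re.comp ?_) ?_
  · exact (continuous_id.matrix_elem 0 0).sub (continuous_id.matrix_elem 1 1)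
  · exact continuous_const.mul (continuous_id.matrix_elem 0 1)

theorem continuous_ofCoords : Continuous (ofCoords : WithLp 2 (ℝ × 𝕜) → _) := by
  have h1 : Continuous (fun x : WithLp 2 (ℝ × 𝕜) => x.fst) := by fun_prop
  have h2 : Continuous (fun x : WithLp 2 (ℝ × 𝕜) => x.snd) := by fun_prop
  refine continuous_matrix fun i j => ?_
  fin_cases i <;> fin_cases j <;> simp [ofCoords]
  · fun_prop
  · fun_prop
  · exact (RCLike.continuous_conj.comp h2).div_const 2
  · fun_prop

/-- The radial retraction onto the closed unit ball. -/
noncomputable def retract (x : WithLp 2 (ℝ × 𝕜)) : WithLp 2 (ℝ × 𝕜) := (max 1 ‖x‖)⁻¹ • x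

theorem norm_retract_le (x : WithLp 2 (ℝ × 𝕜)) : ‖retract x‖ ≤ 1 := by
  have h : 0 < max 1 ‖x‖ := lt_max_of_lt_left one_pos
  rw [retract, norm_smul, norm_inv, Real.norm_of_nonneg h.le, inv_mul_le_iff₀ h, mul_one]
  exact le_max_right _ _

theorem retract_eq {x : WithLp 2 (ℝ × 𝕜)} (hx : ‖x‖ ≤ 1) : retract x = x := by
  rw [retract, max_eq_left hx, inv_one, one_smul]

theorem continuous_retract : Continuous (retract : WithLp 2 (ℝ × 𝕜) → _) :=
  Continuous.smul (Continuous.inv₀ (by fun_prop)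
    fun x => (lt_max_of_lt_left one_pos : 0 < max 1 ‖x‖).ne') continuous_id

variable (𝕜) in
/-- The smooth structure of the closed ball of non-negative matrices of trace one: in the linear
coordinates of the affine space of Hermitian matrices of trace one it is the closed unit ball, a
closed convex set with interior points, and as such it is a model with corners. So smoothness is
smoothness up to the boundary in these coordinates. -/
noncomputable def model : ModelWithCorners ℝ (WithLp 2 (ℝ × 𝕜)) (TraceOneBall 𝕜) :=
  ModelWithCorners.ofConvexRange
    { toFun := fun b => coords b.1
      invFun := fun x => ⟨ofCoords (retract x),
        (posSemidef_ofCoords_iff _).2 (norm_retract_le x), trace_ofCoords _⟩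
      source := Set.univ
      target := Metric.closedBall 0 1
      map_source' := fun b _ => by simpa using norm_coords_le b
      map_target' := fun _ _ => Set.mem_univ _
      left_inv' := fun b _ => Subtype.ext (by
        change ofCoords (retract (coords b.1)) = b.1
        rw [retract_eq (norm_coords_le b), ofCoords_coords b.2.1.1 b.2.2])
      right_inv' := fun x hx => by
        change coords (ofCoords (retract x)) = x
        rw [coords_ofCoords, retract_eq (by simpa using hx)] }
    rfl (convex_closedBall 0 1) (continuous_coords.comp continuous_subtype_val)
    ((continuous_ofCoords.comp continuous_retract).subtype_mk _)
    (by
      change (interior (Metric.closedBall (0 : WithLp 2 (ℝ × 𝕜)) 1)).Nonempty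
      exact ⟨0, Metric.ball_subset_interior_closedBall (Metric.mem_ball_self one_pos)⟩)

end TraceOneBall

namespace TraceOneSphere

open TraceOneBall

theorem norm_coords (b : TraceOneSphere 𝕜) : ‖coords b.1‖ = 1 := by
  have h := det_ofCoords (coords b.1)
  rw [ofCoords_coords b.2.1.1 b.2.2.1, b.2.2.2, eq_comm, RCLike.ofReal_eq_zero] at h
  nlinarith [norm_nonneg (coords b.1)]

variable (𝕜) in
/-- In the linear coordinates of the affine space of Hermitian matrices of trace one, the
non-negative matrices of trace one and rank one form the unit sphere. -/
noncomputable def homeomorphSphere :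
    TraceOneSphere 𝕜 ≃ₜ Metric.sphere (0 : WithLp 2 (ℝ × 𝕜)) 1 where
  toFun b := ⟨coords b.1, mem_sphere_zero_iff_norm.2 (norm_coords b)⟩
  invFun x := ⟨ofCoords x.1, (posSemidef_ofCoords_iff _).2 (mem_sphere_zero_iff_norm.1 x.2).le,
    trace_ofCoords _, by rw [det_ofCoords, mem_sphere_zero_iff_norm.1 x.2]; simp⟩
  left_inv b := Subtype.ext (ofCoords_coords b.2.1.1 b.2.2.1)
  right_inv x := Subtype.ext (coords_ofCoords x.1)
  continuous_toFun := (continuous_coords.comp continuous_subtype_val).subtype_mk _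
  continuous_invFun := (continuous_ofCoords.comp continuous_subtype_val).subtype_mk _

instance : Fact (Module.finrank ℝ (WithLp 2 (ℝ × 𝕜)) = Module.finrank ℝ 𝕜 + 1) :=
  ⟨by rw [(WithLp.linearEquiv 2 ℝ (ℝ × 𝕜)).finrank_eq, Module.finrank_prod,
    Module.finrank_self, add_comm]⟩

/-- The smooth structure of the unit sphere. -/
noncomputable instance :
    ChartedSpace (EuclideanSpace ℝ (Fin (Module.finrank ℝ 𝕜))) (TraceOneSphere 𝕜) :=
  transportChartedSpace (homeomorphSphere 𝕜)

instance : IsManifold (𝓡 (Module.finrank ℝ 𝕜)) ∞ (TraceOneSphere 𝕜) :=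
  transport_isManifold _ (homeomorphSphere 𝕜)

/-- The inclusion of the boundary sphere into the closed ball. -/
def incl (b : TraceOneSphere 𝕜) : TraceOneBall 𝕜 := ⟨b.1, b.2.1, b.2.2.1⟩

end TraceOneSphere

end Ball

/-! ## The maximal compact subgroup `SO(2)` or `SU(2)` -/

section Compact

open Matrix

namespace SpecialUnitary

variable (𝕜 : Type*) [RCLike 𝕜]

theorem entries {k : Matrix (Fin 2) (Fin 2) 𝕜} (hk : k ∈ specialUnitaryGroup (Fin 2) 𝕜) :
    k 0 1 = -star (k 1 0) ∧ k 1 1 = star (k 0 0) := by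
  obtain ⟨h1, h2⟩ := mem_specialUnitaryGroup_iff.1 hk
  have h3 : star k * k = 1 := (mem_unitaryGroup_iff').1 h1
  have h4 : k * k.adjugate = 1 := by rw [mul_adjugate, h2, one_smul]
  have h5 : star k = k.adjugate := left_inv_eq_right_inv h3 h4
  rw [adjugate_fin_two] at h5
  have h6 := congrFun (congrFun h5 0) 0
  have h7 := congrFun (congrFun h5 0) 1
  simp [star_apply] at h6 h7
  exact ⟨by simp [h7], by simp [h6]⟩

/-- `SU(2)` (resp. `SO(2)`, if `𝕜 = ℝ`) as the unit sphere of `𝕜²`: the first column of a matrix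
in the group is a unit vector `(α, β)`, and the matrix is `[[α, -conj β], [β, conj α]]`. -/
noncomputable def homeomorphSphere :
    specialUnitaryGroup (Fin 2) 𝕜 ≃ₜ Metric.sphere (0 : WithLp 2 (𝕜 × 𝕜)) 1 where
  toFun k := ⟨WithLp.toLp 2 (k.1 0 0, k.1 1 0), by
    have h1 := (mem_specialUnitaryGroup_iff.1 k.2).2
    obtain ⟨h2, h3⟩ := entries 𝕜 k.2
    rw [det_fin_two, h2, h3, RCLike.star_def, RCLike.mul_conj, neg_mul,
      RCLike.conj_mul] at h1
    have h4 : ‖k.1 0 0‖ ^ 2 + ‖k.1 1 0‖ ^ 2 = 1 := by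
      have : ((‖k.1 0 0‖ ^ 2 + ‖k.1 1 0‖ ^ 2 : ℝ) : 𝕜) = ((1 : ℝ) : 𝕜) := by
        push_cast; rw [← h1]; ring
      exact_mod_cast this
    have h5 := WithLp.prod_norm_sq_eq_of_L2 (WithLp.toLp 2 (k.1 0 0, k.1 1 0))
    rw [mem_sphere_zero_iff_norm]
    have h6 : ‖WithLp.toLp 2 (k.1 0 0, k.1 1 0)‖ ^ 2 = 1 := by rw [h5]; exact h4
    nlinarith [norm_nonneg (WithLp.toLp 2 (k.1 0 0, k.1 1 0))]⟩
  invFun x := ⟨!![x.1.fst, -star x.1.snd; x.1.snd, star x.1.fst], by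
    have h1 := WithLp.prod_norm_sq_eq_of_L2 x.1
    rw [mem_sphere_zero_iff_norm.1 x.2] at h1
    have h2 : x.1.fst * star x.1.fst + x.1.snd * star x.1.snd = 1 := by
      rw [RCLike.star_def, RCLike.mul_conj, RCLike.mul_conj]
      have : ((1 ^ 2 : ℝ) : 𝕜) = ((‖x.1.fst‖ ^ 2 + ‖x.1.snd‖ ^ 2 : ℝ) : 𝕜) := by rw [h1]
      push_cast at this
      rw [← this]; ring
    rw [mem_specialUnitaryGroup_iff, mem_unitaryGroup_iff]
    constructor
    · ext i j
      fin_cases i <;> fin_cases j <;>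
        simp [mul_apply, Fin.sum_univ_two, star_apply, -RCLike.star_def]
      · linear_combination h2
      · ring
      · ring
      · linear_combination h2
    · rw [det_fin_two_of]
      linear_combination h2⟩
  left_inv k := by
    obtain ⟨h2, h3⟩ := entries 𝕜 k.2
    apply Subtype.ext
    ext i j
    fin_cases i <;> fin_cases j <;> simp [h2, h3]
  right_inv x := by
    apply Subtype.ext
    apply WithLp.ofLp_injective 2
    refine Prod.ext ?_ ?_ <;> simp
  continuous_toFun := by
    refine Continuous.subtype_mk ((WithLp.prod_continuous_toLp 2 𝕜 𝕜).comp ?_) _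
    exact (continuous_subtype_val.matrix_elem 0 0).prodMk
      (continuous_subtype_val.matrix_elem 1 0)
  continuous_invFun := by
    refine Continuous.subtype_mk (continuous_matrix fun i j => ?_) _
    have h1 : Continuous fun x : Metric.sphere (0 : WithLp 2 (𝕜 × 𝕜)) 1 => x.1.fst := by
      fun_prop
    have h2 : Continuous fun x : Metric.sphere (0 : WithLp 2 (𝕜 × 𝕜)) 1 => x.1.snd := by
      fun_prop
    fin_cases i <;> fin_cases j <;> simp
    · exact h1
    · exact (RCLike.continuous_conj.comp h2).neg
    · exact h2
    · exact RCLike.continuous_conj.comp h1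

instance : Fact (Module.finrank ℝ (WithLp 2 (𝕜 × 𝕜)) = (2 * Module.finrank ℝ 𝕜 - 1) + 1) :=
  ⟨by
    have h : 0 < Module.finrank ℝ 𝕜 := Module.finrank_pos
    rw [(WithLp.linearEquiv 2 ℝ (𝕜 × 𝕜)).finrank_eq, Module.finrank_prod]
    omega⟩

/-- The smooth structure of the unit sphere of `𝕜²`. -/
noncomputable instance :
    ChartedSpace (EuclideanSpace ℝ (Fin (2 * Module.finrank ℝ 𝕜 - 1)))
      (specialUnitaryGroup (Fin 2) 𝕜) :=
  transportChartedSpace (homeomorphSphere 𝕜)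

instance : IsManifold (𝓡 (2 * Module.finrank ℝ 𝕜 - 1)) ∞ (specialUnitaryGroup (Fin 2) 𝕜) :=
  transport_isManifold _ (homeomorphSphere 𝕜)

end SpecialUnitary

end Compact

/-!
The polar factors of `g` in `SL(2)` are explicit: with `N = Tr g* g` and `t = √(N + 2)`, the
Cayley–Hamilton theorem gives `(g* g)^(1/2) = t b` and `g = k (t b)`, where
`b = (g* g + 1) / (N + 2)` has trace one and `k = (g + (g⁻¹)*) / t`. So `ι(g) = (k, b)` is smooth,
`1 - ‖p‖² = 4 det b = 4 / t²` in the linear coordinates `p` of `b`, the inverse of `ι` is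
`(k, b) ↦ k b / √(det b)`, and inversion extends as `(k, b) ↦ (k⁻¹, k (1 - b) k*)`.

Differentiating these formulas along `g ↦ V g` and `g ↦ g V`, and using `b² = b - det b` and the
anticommutator `h P + P h = 2 Tr(h b)` of a trace-free `h` with `P = 2 b - 1`, one finds vector
fields that make sense and are smooth up to the boundary. With `w = k* V k = w_k + w_p` split into
its anti-Hermitian and Hermitian parts, the lift of the right-invariant field is

  `k' = k (w_k + ½ [w_p, P])`,  `b' = ½ (1 - ‖p‖²) w_p`,

and with `V = V_k + V_p` the lift of the left-invariant field is

  `k' = k (V_k + ½ [P, V_p])`,  `b' = b V + V* b - (det b) (V + V*) - 2 Re Tr(b V) b`.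

A lift is determined by the field on the group, since the interior is dense
(`IsLift.components`).

The right lifts have `b' = 0` on the boundary, so they are edge fields. Conversely let a vector
field with components `(k', p')` have `p' = 0` on the boundary. By Hadamard's lemma up to the
boundary (`contDiffOn_ballQuotient`, a parametric integral of the radial derivative)
`p' = (1 - ‖p‖²) y` with `y` smooth, and the formula above can be solved for `w`, hence for `V`, as
a smooth function on `K × B` (`mem_smoothSpan_right`); the expansion of `V` in a basis of the Lie
algebra gives the coefficients. For a vector field that is only tangent to the boundary,
`⟨p, p'⟩ = 0` there; the left lift of the trace-free Hermitian matrix with coordinates `p'` then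
has the same ball component on the boundary, so subtracting it leaves an edge field
(`mem_smoothSpan_left_right`).

Smooth structures are handled through the embeddings of `K` and of `∂B` as unit spheres and of `B`
as the closed unit ball: a tangent vector of `K × B` is determined by the derivatives of the first
column of `k` and of the coordinates of `b`, the first of which has to be orthogonal to the first
column itself (`tangent_ext`, `exists_isSmoothVectorField`). Near the boundary,
`(k, (1 - u) s) ↦ (u, (k, s))` provides the charts with values in a half-space.
-/

/-! ### Hadamard's lemma up to the boundary of a ball -/

section Division

open Set Metric

universe u

/-- Differentiation under the integral sign on a convex set, up to its boundary. -/
theorem hasFDerivWithinAt_intervalIntegral_of_continuousOn {E G : Type*} [NormedAddCommGroup E]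
    [NormedSpace ℝ E] [NormedAddCommGroup G] [NormedSpace ℝ G] [CompleteSpace G]
    {s : Set E} (hs : Convex ℝ s) {F : E → ℝ → G} {F' : E → ℝ → E →L[ℝ] G}
    (hF : ContinuousOn F.uncurry (s ×ˢ Icc 0 1)) (hF' : ContinuousOn F'.uncurry (s ×ˢ Icc 0 1))
    (hd : ∀ x ∈ s, ∀ t ∈ Icc (0 : ℝ) 1, HasFDerivWithinAt (fun y => F y t) (F' x t) s x)
    {x : E} (hx : x ∈ s) :
    HasFDerivWithinAt (fun y => ∫ t in (0 : ℝ)..1, F y t) (∫ t in (0 : ℝ)..1, F' x t) s x := by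
  have hc : ∀ y ∈ s, ContinuousOn (fun t => F y t) (Icc 0 1) := fun y hy =>
    hF.comp (f := fun t : ℝ => (y, t)) (by fun_prop) fun t ht => ⟨hy, ht⟩
  have hc' : ∀ y ∈ s, ContinuousOn (fun t => F' y t) (Icc 0 1) := fun y hy =>
    hF'.comp (f := fun t : ℝ => (y, t)) (by fun_prop) fun t ht => ⟨hy, ht⟩
  have h01 : uIcc (0 : ℝ) 1 = Icc 0 1 := uIcc_of_le zero_le_one
  have hi : ∀ y ∈ s, IntervalIntegrable (fun t => F y t) MeasureTheory.volume 0 1 := fun y hy =>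
    ContinuousOn.intervalIntegrable (h01 ▸ hc y hy)
  have hi' : ∀ y ∈ s, IntervalIntegrable (fun t => F' y t) MeasureTheory.volume 0 1 := fun y hy =>
    ContinuousOn.intervalIntegrable (h01 ▸ hc' y hy)
  rw [hasFDerivWithinAt_iff_isLittleO, Asymptotics.isLittleO_iff]
  intro ε hε
  obtain ⟨v, hv, hvu⟩ := isCompact_Icc.mem_uniformity_of_prod hF' hx (dist_mem_uniformity hε)
  obtain ⟨δ, hδ, hball⟩ := Metric.mem_nhdsWithin_iff.1 hv
  have hnear : ∀ᶠ y in nhdsWithin x s, y ∈ ball x δ ∩ s :=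
    Filter.inter_mem (mem_nhdsWithin_of_mem_nhds (ball_mem_nhds x hδ)) self_mem_nhdsWithin
  filter_upwards [hnear] with y hy
  -- the mean value inequality on a small convex neighbourhood in `s`, uniformly in `t`
  have key : ∀ t ∈ Icc (0 : ℝ) 1, ‖F y t - F x t - F' x t (y - x)‖ ≤ ε * ‖y - x‖ := by
    intro t ht
    have hcv : Convex ℝ (ball x δ ∩ s) := (convex_ball x δ).inter hs
    refine hcv.norm_image_sub_le_of_norm_hasFDerivWithin_le' (f := fun y => F y t)
      (f' := fun y => F' y t) (fun z hz => (hd z hz.2 t ht).mono inter_subset_right)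
      (fun z hz => ?_) ⟨mem_ball_self hδ, hx⟩ hy
    have := hvu z (hball hz) t ht
    rw [← dist_eq_norm]
    exact le_of_lt this
  have e1 : (∫ t in (0 : ℝ)..1, F y t) - (∫ t in (0 : ℝ)..1, F x t)
      - (∫ t in (0 : ℝ)..1, F' x t) (y - x)
      = ∫ t in (0 : ℝ)..1, (F y t - F x t - F' x t (y - x)) := by
    rw [ContinuousLinearMap.intervalIntegral_apply (hi' x hx),
      intervalIntegral.integral_sub ((hi y hy.2).sub (hi x hx)),
      intervalIntegral.integral_sub (hi y hy.2) (hi x hx)]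
    refine ContinuousOn.intervalIntegrable ?_
    rw [h01]
    exact (hc' x hx).clm_apply continuousOn_const
  rw [e1]
  refine (intervalIntegral.norm_integral_le_of_norm_le_const (C := ε * ‖y - x‖) ?_).trans_eq
    (by simp)
  intro t ht
  rw [uIoc_of_le zero_le_one] at ht
  exact key t ⟨ht.1.le, ht.2⟩

/-- A parametric integral of a function that is smooth up to the boundary of a convex set is
smooth up to the boundary. -/
theorem contDiffOn_intervalIntegral {E : Type u} [NormedAddCommGroup E] [NormedSpace ℝ E]
    {s : Set E} (hs : Convex ℝ s) (hu : UniqueDiffOn ℝ s) {G : Type u} [NormedAddCommGroup G]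
    [NormedSpace ℝ G] [CompleteSpace G] {F : E × ℝ → G}
    (hF : ContDiffOn ℝ ∞ F (s ×ˢ Icc (0 : ℝ) 1)) :
    ContDiffOn ℝ ∞ (fun x => ∫ t in (0 : ℝ)..1, F (x, t)) s := by
  rw [contDiffOn_infty]
  intro n
  have hU : UniqueDiffOn ℝ (s ×ˢ Icc (0 : ℝ) 1) := hu.prod (uniqueDiffOn_Icc_zero_one)
  induction n generalizing G with
  | zero =>
    have hc := hF.continuousOn
    rw [CharP.cast_eq_zero, contDiffOn_zero, continuousOn_iff_continuous_domRestrict]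
    have h1 : Continuous (fun q : s × ℝ => F (q.1, (projIcc (0 : ℝ) 1 zero_le_one q.2 : ℝ))) := by
      refine hc.comp_continuous (f := fun q : s × ℝ =>
        ((q.1 : E), (projIcc (0 : ℝ) 1 zero_le_one q.2 : ℝ))) ?_ fun q => ⟨q.1.2, Subtype.prop _⟩
      have := continuous_projIcc (a := (0 : ℝ)) (b := 1) (h := zero_le_one)
      fun_prop
    refine (intervalIntegral.continuous_parametric_intervalIntegral_of_continuous'
      (μ := MeasureTheory.volume)
      (f := fun (x : s) (t : ℝ) => F (x, (projIcc (0 : ℝ) 1 zero_le_one t : ℝ)))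
      h1 0 1).congr fun x => ?_
    refine intervalIntegral.integral_congr fun t ht => ?_
    rw [uIcc_of_le zero_le_one] at ht
    simp only [projIcc_of_mem zero_le_one ht]
  | succ n ih =>
    let F' : E × ℝ → E →L[ℝ] G := fun q =>
      (fderivWithin ℝ F (s ×ˢ Icc (0 : ℝ) 1) q).comp (ContinuousLinearMap.inl ℝ E ℝ)
    have hF' : ContDiffOn ℝ ∞ F' (s ×ˢ Icc (0 : ℝ) 1) :=
      (hF.fderivWithin hU (by simp)).clm_comp contDiffOn_const
    have hd : ∀ x ∈ s, HasFDerivWithinAt (fun x => ∫ t in (0 : ℝ)..1, F (x, t))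
        (∫ t in (0 : ℝ)..1, F' (x, t)) s x := by
      intro x hx
      refine hasFDerivWithinAt_intervalIntegral_of_continuousOn hs (F := fun y t => F (y, t))
        (F' := fun y t => F' (y, t)) hF.continuousOn hF'.continuousOn (fun y hy t ht => ?_) hx
      have h1 : HasFDerivWithinAt F (fderivWithin ℝ F (s ×ˢ Icc (0 : ℝ) 1) (y, t))
          (s ×ˢ Icc (0 : ℝ) 1) (y, t) :=
        (hF.differentiableOn (by simp) (y, t) ⟨hy, ht⟩).hasFDerivWithinAt
      exact h1.comp (f := fun y : E => (y, t)) y (hasFDerivAt_prodMk_left y t).hasFDerivWithinAt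
        fun z hz => ⟨hz, ht⟩
    push_cast
    rw [contDiffOn_succ_iff_fderivWithin hu]
    refine ⟨fun x hx => (hd x hx).differentiableWithinAt, by simp, ?_⟩
    exact (ih hF').congr fun x hx => (hd x hx).fderivWithin (hu x hx)

/-- The quotient of a function `φ` on the closed unit ball that vanishes on the unit sphere by the
defining function `1 - ‖p‖²` of the sphere; on the sphere it is given by the radial derivative. -/
noncomputable def ballQuotient {E G : Type*} [NormedAddCommGroup E] [NormedSpace ℝ E]
    [NormedAddCommGroup G] [NormedSpace ℝ G] (φ : E → G) (p : E) : G :=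
  open Classical in
  if ‖p‖ < 1 then (1 - ‖p‖ ^ 2)⁻¹ • φ p
  else -(2⁻¹ : ℝ) • fderivWithin ℝ φ (closedBall 0 1) p p

theorem smul_ballQuotient {E G : Type*} [NormedAddCommGroup E] [NormedSpace ℝ E]
    [NormedAddCommGroup G] [NormedSpace ℝ G] {φ : E → G} {p : E} (hp : ‖p‖ ≤ 1)
    (h : ‖p‖ = 1 → φ p = 0) : (1 - ‖p‖ ^ 2) • ballQuotient φ p = φ p := by
  rcases hp.lt_or_eq with h1 | h1
  · rw [ballQuotient, if_pos h1, smul_smul, mul_inv_cancel₀, one_smul]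
    nlinarith [norm_nonneg p]
  · rw [h h1, h1]; simp

theorem uniqueDiffOn_closedBall {E : Type*} [NormedAddCommGroup E] [NormedSpace ℝ E] :
    UniqueDiffOn ℝ (closedBall (0 : E) 1) :=
  uniqueDiffOn_convex (convex_closedBall 0 1)
    ⟨0, ball_subset_interior_closedBall (mem_ball_self one_pos)⟩

/-- Near a point of the sphere, the quotient by the defining function of the sphere is the
integral of the radial derivative over the radial segment that ends on the sphere. -/
theorem ballQuotient_eq_integral {E P G : Type*} [NormedAddCommGroup E] [InnerProductSpace ℝ E]
    [NormedAddCommGroup P] [NormedSpace ℝ P] [NormedAddCommGroup G] [NormedSpace ℝ G]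
    [CompleteSpace G] {T : Set P} (hT : IsOpen T) {f : P × E → G}
    (hf : ContDiffOn ℝ ∞ f (T ×ˢ closedBall 0 1))
    (h0 : ∀ y ∈ T, ∀ p, ‖p‖ = 1 → f (y, p) = 0) {y : P} (hy : y ∈ T) {p : E} (hp : ‖p‖ ≤ 1)
    (hp0 : p ≠ 0) :
    ballQuotient (fun q => f (y, q)) p = -(‖p‖ * (1 + ‖p‖))⁻¹ • ∫ t in (0 : ℝ)..1,
      fderivWithin ℝ f (T ×ˢ closedBall 0 1) (y, (1 - t + t * ‖p‖⁻¹) • p) (0, p) := by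
  have hn : 0 < ‖p‖ := norm_pos_iff.2 hp0
  have hU : UniqueDiffOn ℝ (T ×ˢ closedBall (0 : E) 1) :=
    hT.uniqueDiffOn.prod uniqueDiffOn_closedBall
  have hfd : ∀ q : P × E, q ∈ T ×ˢ closedBall (0 : E) 1 →
      HasFDerivWithinAt f (fderivWithin ℝ f (T ×ˢ closedBall 0 1) q) (T ×ˢ closedBall 0 1) q :=
    fun q hq => (hf.differentiableOn (by simp) q hq).hasFDerivWithinAt
  rcases hp.lt_or_eq with h1 | h1
  · rw [ballQuotient, if_pos h1]
    have hmem : ∀ t ∈ Icc (0 : ℝ) 1, (y, (1 - t + t * ‖p‖⁻¹) • p) ∈ T ×ˢ closedBall (0 : E) 1 := by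
      intro t ht
      refine ⟨hy, ?_⟩
      have h2 : 0 ≤ 1 - t + t * ‖p‖⁻¹ :=
        add_nonneg (sub_nonneg.2 ht.2) (mul_nonneg ht.1 (inv_nonneg.2 hn.le))
      rw [mem_closedBall_zero_iff, norm_smul, Real.norm_of_nonneg h2, add_mul, mul_assoc,
        inv_mul_cancel₀ hn.ne']
      nlinarith [ht.1, ht.2]
    have hγ : ∀ t : ℝ, HasDerivAt (fun t : ℝ => (y, (1 - t + t * ‖p‖⁻¹) • p))
        ((0 : P), (-1 + ‖p‖⁻¹) • p) t := by
      intro t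
      refine (hasDerivAt_const t y).prodMk ?_
      have : HasDerivAt (fun t : ℝ => 1 - t + t * ‖p‖⁻¹) (-1 + ‖p‖⁻¹) t := by
        simpa using! ((hasDerivAt_id t).const_sub 1).add ((hasDerivAt_id t).mul_const ‖p‖⁻¹)
      exact this.smul_const p
    have hγc : Continuous (fun t : ℝ => (y, (1 - t + t * ‖p‖⁻¹) • p)) := by fun_prop
    have hint : ContinuousOn (fun t : ℝ => fderivWithin ℝ f (T ×ˢ closedBall 0 1)
        (y, (1 - t + t * ‖p‖⁻¹) • p) (0, p)) (Icc 0 1) :=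
      ((hf.continuousOn_fderivWithin hU (by simp)).comp hγc.continuousOn hmem).clm_apply
        continuousOn_const
    have hFTC := intervalIntegral.integral_eq_sub_of_hasDeriv_right_of_le zero_le_one
      (f := fun t : ℝ => f (y, (1 - t + t * ‖p‖⁻¹) • p))
      (f' := fun t : ℝ => (-1 + ‖p‖⁻¹) • fderivWithin ℝ f (T ×ˢ closedBall 0 1)
        (y, (1 - t + t * ‖p‖⁻¹) • p) (0, p))
      (hf.continuousOn.comp hγc.continuousOn hmem)
      (fun t ht => by
        have h3 := (hfd _ (hmem t (Ioo_subset_Icc_self ht))).comp_hasDerivWithinAt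
          (s := Icc 0 1) t (hγ t).hasDerivWithinAt hmem
        have h4 : ((0 : P), (-1 + ‖p‖⁻¹) • p) = (-1 + ‖p‖⁻¹) • ((0 : P), p) := by simp
        rw [h4, map_smul] at h3
        exact (h3.hasDerivAt (Icc_mem_nhds ht.1 ht.2)).hasDerivWithinAt)
      (by
        refine ContinuousOn.intervalIntegrable ?_
        rw [uIcc_of_le zero_le_one]
        exact hint.const_smul _)
    have h5 : f (y, ‖p‖⁻¹ • p) = 0 := h0 y hy _ (by
      rw [norm_smul, norm_inv, norm_norm, inv_mul_cancel₀ hn.ne'])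
    simp only [sub_self, one_mul, zero_add, sub_zero, zero_mul, add_zero, one_smul, h5,
      zero_sub, intervalIntegral.integral_smul] at hFTC
    have h6 : f (y, p) = -((-1 + ‖p‖⁻¹) • ∫ t in (0 : ℝ)..1,
        fderivWithin ℝ f (T ×ˢ closedBall 0 1) (y, (1 - t + t * ‖p‖⁻¹) • p) (0, p)) := by
      rw [hFTC, neg_neg]
    rw [h6, ← neg_smul, smul_smul]
    congr 1
    have h7 : 1 - ‖p‖ ^ 2 ≠ 0 := by nlinarith
    field_simp
    ring
  · have h2 : ∀ t : ℝ, (1 - t + t * ‖p‖⁻¹) • p = p := fun t => by rw [h1]; simp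
    have hin : ∀ q ∈ closedBall (0 : E) 1, (y, q) ∈ T ×ˢ closedBall (0 : E) 1 :=
      fun q hq => ⟨hy, hq⟩
    have hpm : p ∈ closedBall (0 : E) 1 := by simpa using hp
    have h3 := (hfd (y, p) (hin p hpm)).comp (f := fun q : E => (y, q)) p
      (hasFDerivAt_prodMk_right y p).hasFDerivWithinAt hin
    have h4 := h3.fderivWithin (uniqueDiffOn_closedBall p hpm)
    rw [ballQuotient, if_neg (by simp [h1])]
    simp only [h2, intervalIntegral.integral_const, sub_zero, one_smul]
    have h5 : (fun q => f (y, q)) = f ∘ fun q => (y, q) := rfl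
    rw [h5, h4, h1]
    norm_num

/-- Hadamard's lemma up to the boundary: a smooth function on the closed ball, depending smoothly
on parameters, that vanishes on the sphere is a smooth multiple of `1 - ‖p‖²`. -/
theorem contDiffOn_ballQuotient {E P G : Type u} [NormedAddCommGroup E] [InnerProductSpace ℝ E]
    [NormedAddCommGroup P] [NormedSpace ℝ P] [NormedAddCommGroup G] [NormedSpace ℝ G]
    [CompleteSpace G] {T : Set P} (hT : IsOpen T) {f : P × E → G}
    (hf : ContDiffOn ℝ ∞ f (T ×ˢ closedBall 0 1))
    (h0 : ∀ y ∈ T, ∀ p, ‖p‖ = 1 → f (y, p) = 0) :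
    ContDiffOn ℝ ∞ (fun q : P × E => ballQuotient (fun p => f (q.1, p)) q.2)
      (T ×ˢ closedBall 0 1) := by
  have hU : UniqueDiffOn ℝ (T ×ˢ closedBall (0 : E) 1) :=
    hT.uniqueDiffOn.prod uniqueDiffOn_closedBall
  rintro ⟨y₀, p₀⟩ ⟨hy₀, hp₀⟩
  have hp₀' : ‖p₀‖ ≤ 1 := by simpa using hp₀
  rcases hp₀'.lt_or_eq with h1 | h1
  · have hopen : IsOpen {q : P × E | ‖q.2‖ < 1} := isOpen_lt (by fun_prop) continuous_const
    have hne : ∀ q ∈ {q : P × E | ‖q.2‖ < 1}, 1 - ‖q.2‖ ^ 2 ≠ 0 := fun q hq => by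
      have : ‖q.2‖ < 1 := hq
      nlinarith [norm_nonneg q.2]
    have hsm : ContDiffWithinAt ℝ ∞ (fun q : P × E => (1 - ‖q.2‖ ^ 2)⁻¹ • f q)
        (T ×ˢ closedBall 0 1) (y₀, p₀) := by
      refine ContDiffWithinAt.smul ?_ (hf _ ⟨hy₀, hp₀⟩)
      refine ContDiffWithinAt.inv ?_ (hne _ h1)
      exact (contDiff_const.sub (contDiff_snd.norm_sq ℝ)).contDiffWithinAt
    refine hsm.congr_of_eventuallyEq ?_ ?_
    · filter_upwards [mem_nhdsWithin_of_mem_nhds (hopen.mem_nhds h1)] with q hq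
      rw [ballQuotient, if_pos hq]
    · rw [ballQuotient, if_pos h1]
  · -- near the sphere, on a convex neighbourhood `D` away from the origin, the integral formula
    -- for the quotient applies
    obtain ⟨ε, hε, hball⟩ := Metric.isOpen_iff.1 hT y₀ hy₀
    let D : Set (P × E) := ball y₀ ε ×ˢ (closedBall 0 1 ∩ ball p₀ 2⁻¹)
    have hpne : ∀ p ∈ ball p₀ (2⁻¹ : ℝ), p ≠ 0 := by
      rintro p hp rfl
      rw [mem_ball, dist_comm, dist_zero_right, h1] at hp
      norm_num at hp
    have hDc : Convex ℝ D :=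
      (convex_ball y₀ ε).prod ((convex_closedBall 0 1).inter (convex_ball p₀ _))
    have hDi : (interior D).Nonempty := by
      refine ⟨(y₀, (3 / 4 : ℝ) • p₀), ?_⟩
      rw [interior_prod_eq, interior_inter]
      refine ⟨?_, ball_subset_interior_closedBall ?_, ?_⟩
      · rw [isOpen_ball.interior_eq]; exact mem_ball_self hε
      · rw [mem_ball_zero_iff, norm_smul, h1]; norm_num
      · rw [isOpen_ball.interior_eq, mem_ball, dist_eq_norm]
        have : (3 / 4 : ℝ) • p₀ - p₀ = (-(1 / 4) : ℝ) • p₀ := by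
          rw [show (-(1 / 4) : ℝ) = 3 / 4 - 1 by norm_num, sub_smul, one_smul]
        rw [this, norm_smul, h1]; norm_num
    have hDu : UniqueDiffOn ℝ D := uniqueDiffOn_convex hDc hDi
    have hDT : ∀ q ∈ D, q.1 ∈ T ∧ ‖q.2‖ ≤ 1 ∧ q.2 ≠ 0 := fun q hq =>
      ⟨hball hq.1, by simpa using hq.2.1, hpne _ hq.2.2⟩
    let γ : (P × E) × ℝ → P × E := fun q => (q.1.1, (1 - q.2 + q.2 * ‖q.1.2‖⁻¹) • q.1.2)
    have hγ : ContDiffOn ℝ ∞ γ (D ×ˢ Icc 0 1) := by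
      have hN : ContDiffOn ℝ ∞ (fun q : (P × E) × ℝ => ‖q.1.2‖⁻¹) (D ×ˢ Icc 0 1) := by
        refine ContDiffOn.inv ?_ fun q hq => norm_ne_zero_iff.2 (hDT _ hq.1).2.2
        intro q hq
        have h2 : ContDiff ℝ ∞ (fun q : (P × E) × ℝ => q.1.2) := by fun_prop
        exact (h2.contDiffAt.norm ℝ (hDT _ hq.1).2.2).contDiffWithinAt
      fun_prop
    have hγm : MapsTo γ (D ×ˢ Icc 0 1) (T ×ˢ closedBall 0 1) := by
      rintro ⟨⟨y, p⟩, t⟩ ⟨hq, ht⟩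
      obtain ⟨hy, hp, hp0⟩ := hDT _ hq
      have hn : 0 < ‖p‖ := norm_pos_iff.2 hp0
      refine ⟨hy, ?_⟩
      have h2 : 0 ≤ 1 - t + t * ‖p‖⁻¹ :=
        add_nonneg (sub_nonneg.2 ht.2) (mul_nonneg ht.1 (inv_nonneg.2 hn.le))
      change (1 - t + t * ‖p‖⁻¹) • p ∈ _
      rw [mem_closedBall_zero_iff, norm_smul, Real.norm_of_nonneg h2, add_mul, mul_assoc,
        inv_mul_cancel₀ hn.ne']
      have : ‖p‖ ≤ 1 := hp
      nlinarith [ht.1, ht.2]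
    have hF : ContDiffOn ℝ ∞ (fun q : (P × E) × ℝ =>
        fderivWithin ℝ f (T ×ˢ closedBall 0 1) (γ q) ((0 : P), q.1.2)) (D ×ˢ Icc 0 1) := by
      refine ContDiffOn.clm_apply ?_ ?_
      · exact (hf.fderivWithin hU (m := ∞) (by simp)).comp hγ hγm
      · fun_prop
    have hI := contDiffOn_intervalIntegral hDc hDu hF
    have hS : ContDiffOn ℝ ∞ (fun q : P × E => -(‖q.2‖ * (1 + ‖q.2‖))⁻¹ • ∫ t in (0 : ℝ)..1,
        fderivWithin ℝ f (T ×ˢ closedBall 0 1) (γ (q, t)) ((0 : P), q.2)) D := by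
      refine ContDiffOn.smul (ContDiffOn.neg (ContDiffOn.inv ?_ ?_)) hI
      · have hN : ContDiffOn ℝ ∞ (fun q : P × E => ‖q.2‖) D := fun q hq =>
          (contDiff_snd.contDiffAt.norm ℝ (hDT _ hq).2.2).contDiffWithinAt
        fun_prop
      · intro q hq
        have : 0 < ‖q.2‖ := norm_pos_iff.2 (hDT _ hq).2.2
        positivity
    have hD0 : (y₀, p₀) ∈ D :=
      ⟨mem_ball_self hε, hp₀, mem_ball_self (by norm_num)⟩
    have hS' := (hS.congr (f₁ := fun q : P × E => ballQuotient (fun p => f (q.1, p)) q.2)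
      fun q hq => ballQuotient_eq_integral hT hf h0 (hDT q hq).1 (hDT q hq).2.1 (hDT q hq).2.2)
      (y₀, p₀) hD0
    refine hS'.mono_of_mem_nhdsWithin ?_
    have hn1 : ball y₀ ε ×ˢ ball p₀ (2⁻¹ : ℝ) ∈ nhds (y₀, p₀) :=
      prod_mem_nhds (ball_mem_nhds _ hε) (ball_mem_nhds _ (by norm_num))
    filter_upwards [mem_nhdsWithin_of_mem_nhds hn1, self_mem_nhdsWithin] with q hq hq'
    exact ⟨hq.1, hq'.2, hq.2⟩

end Division

/-! ### Transport of structure -/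

section TransportDiffeomorph

variable {H X S E : Type*} [TopologicalSpace H] [TopologicalSpace X] [TopologicalSpace S]
  [NormedAddCommGroup E] [NormedSpace ℝ E]

/-- For the transported manifold structure, the homeomorphism is a diffeomorphism. -/
@[reducible]
def transportDiffeomorph (I : ModelWithCorners ℝ E H) [ChartedSpace H S] (h : X ≃ₜ S) :
    letI := transportChartedSpace (H := H) h
    X ≃ₘ^∞⟮I, I⟯ S :=
  letI := transportChartedSpace (H := H) h
  { h.toEquiv with
    contMDiff_toFun := fun x => by
      rw [contMDiffAt_iff_target]
      exact ⟨h.continuous.continuousAt, contMDiffAt_extChartAt (I := I) (x := x)⟩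
    contMDiff_invFun := fun s => by
      rw [contMDiffAt_iff_target]
      refine ⟨h.symm.continuous.continuousAt, ?_⟩
      have h1 : extChartAt I (h.symm s) ∘ h.symm = extChartAt I s := by
        ext y
        change extChartAt I (h (h.symm s)) (h (h.symm y)) = _
        simp
      change ContMDiffAt I 𝓘(ℝ, E) ∞ (extChartAt I (h.symm s) ∘ h.symm) s
      rw [h1]
      exact contMDiffAt_extChartAt (I := I) (x := s) }

end TransportDiffeomorph

/-! ### Derivatives of vector-valued functions on manifolds -/

section DerivativeLemmas

variable {E H M F E' H' M' : Type*} [NormedAddCommGroup E] [NormedSpace ℝ E]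
  [TopologicalSpace H] {I : ModelWithCorners ℝ E H} [TopologicalSpace M] [ChartedSpace H M]
  [NormedAddCommGroup F] [NormedSpace ℝ F]
  [NormedAddCommGroup E'] [NormedSpace ℝ E'] [TopologicalSpace H']
  {I' : ModelWithCorners ℝ E' H'} [TopologicalSpace M'] [ChartedSpace H' M']

theorem mvfderiv_comp_mfderiv {g : M' → F} {f : M → M'} {x : M}
    (hg : MDifferentiableAt I' 𝓘(ℝ, F) g (f x)) (hf : MDifferentiableAt I I' f x)
    (v : TangentSpace I x) :
    mvfderiv I (g ∘ f) x v = mvfderiv I' g (f x) (mfderiv I I' f x v) := by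
  have := mfderiv_comp_apply (I' := I') (I'' := 𝓘(ℝ, F)) x hg hf v
  exact this

theorem mvfderiv_fderiv_comp {F' : Type*} [NormedAddCommGroup F'] [NormedSpace ℝ F']
    {g : F → F'} {f : M → F} {x : M}
    (hg : DifferentiableAt ℝ g (f x)) (hf : MDifferentiableAt I 𝓘(ℝ, F) f x)
    (v : TangentSpace I x) :
    mvfderiv I (g ∘ f) x v = fderiv ℝ g (f x) (mvfderiv I f x v) := by
  rw [mvfderiv_comp_mfderiv hg.mdifferentiableAt hf]
  change mfderiv 𝓘(ℝ, F) 𝓘(ℝ, F') g (f x) _ = _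
  rw [mfderiv_eq_fderiv]
  rfl

theorem contMDiff_mvfderiv_apply [IsManifold I ∞ M] [IsManifold I' ∞ M'] {f : M → F}
    (hf : ContMDiff I 𝓘(ℝ, F) ∞ f) {a : M' → M} {ξ : ∀ x : M', TangentSpace I (a x)}
    (hξ : ContMDiff I' I.tangent ∞ (fun x => (⟨a x, ξ x⟩ : TangentBundle I M))) :
    ContMDiff I' 𝓘(ℝ, F) ∞ (fun x => mvfderiv I f (a x) (ξ x)) := by
  have _ : IsManifold I 1 M := .of_le (n := ∞) (by simp)
  have h1 := (hf.contMDiff_tangentMap (m := ∞) (by simp)).comp hξ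
  exact (contMDiff_snd_tangentBundle_modelSpace F 𝓘(ℝ, F)).comp h1

end DerivativeLemmas

section ModelSpace

variable {E H EX HX X : Type*} [NormedAddCommGroup E] [NormedSpace ℝ E]
  [TopologicalSpace H] {I : ModelWithCorners ℝ E H}
  [NormedAddCommGroup EX] [NormedSpace ℝ EX]
  [TopologicalSpace HX] {IX : ModelWithCorners ℝ EX HX} [TopologicalSpace X] [ChartedSpace HX X]

/-- The tangent bundle of a model space is trivial in its global chart, so that a vector field
along a map into the model space may be given by a vector-valued function. -/
theorem contMDiff_tangentBundle_modelSpace {b : X → H} {q : X → E}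
    (hb : ContMDiff IX I ∞ b) (hq : ContMDiff IX 𝓘(ℝ, E) ∞ q) :
    ContMDiff IX I.tangent ∞ (fun x => (⟨b x, q x⟩ : TangentBundle I H)) := by
  intro x
  rw [Bundle.contMDiffAt_totalSpace]
  refine ⟨hb x, (hq x).congr_of_eventuallyEq (Filter.Eventually.of_forall fun y => ?_)⟩
  simp

end ModelSpace

/-! ### Manifolds diffeomorphic to a sphere -/

section Sphere

open Metric Module
open scoped RealInnerProductSpace

variable {E M EX HX X : Type*} [NormedAddCommGroup E] [InnerProductSpace ℝ E]
  {n : ℕ} [Fact (finrank ℝ E = n + 1)]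
  [TopologicalSpace M] [ChartedSpace (EuclideanSpace ℝ (Fin n)) M]
  [NormedAddCommGroup EX] [NormedSpace ℝ EX]
  [TopologicalSpace HX] {IX : ModelWithCorners ℝ EX HX} [TopologicalSpace X] [ChartedSpace HX X]

theorem contMDiff_sphere_coe_comp (Φ : M ≃ₘ^∞⟮𝓡 n, 𝓡 n⟯ sphere (0 : E) 1) :
    ContMDiff (𝓡 n) 𝓘(ℝ, E) ∞ (fun m => (Φ m : E)) :=
  contMDiff_coe_sphere.comp Φ.contMDiff

/-- The derivative of an identification with the unit sphere, as a vector of the ambient space,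
factors through the derivative of the inclusion of the sphere. -/
theorem mvfderiv_sphere_coe_comp (Φ : M ≃ₘ^∞⟮𝓡 n, 𝓡 n⟯ sphere (0 : E) 1) (m : M)
    (v : TangentSpace (𝓡 n) m) :
    mvfderiv (𝓡 n) (fun m => (Φ m : E)) m v =
      mvfderiv (𝓡 n) ((↑) : sphere (0 : E) 1 → E) (Φ m)
        (Φ.mfderivToContinuousLinearEquiv (by simp) m v) :=
  mvfderiv_comp_mfderiv (f := Φ) (g := ((↑) : sphere (0 : E) 1 → E))
    ((contMDiff_coe_sphere (m := ∞) _).mdifferentiableAt (by simp))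
    ((Φ.contMDiff m).mdifferentiableAt (by simp)) v

theorem injective_mvfderiv_sphere_coe_comp (Φ : M ≃ₘ^∞⟮𝓡 n, 𝓡 n⟯ sphere (0 : E) 1) (m : M) :
    Function.Injective (mvfderiv (𝓡 n) (fun m => (Φ m : E)) m) := by
  intro v w h
  rw [mvfderiv_sphere_coe_comp, mvfderiv_sphere_coe_comp] at h
  exact (Φ.mfderivToContinuousLinearEquiv (by simp) m).injective
    (injective_mvfderiv_subtypeVal_sphere _ h)

/-- The derivatives of an identification with the unit sphere are the vectors orthogonal to the
position vector. -/
theorem exists_mvfderiv_sphere_coe_comp_iff (Φ : M ≃ₘ^∞⟮𝓡 n, 𝓡 n⟯ sphere (0 : E) 1) (m : M)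
    (z : E) : (∃ v : TangentSpace (𝓡 n) m, mvfderiv (𝓡 n) (fun m => (Φ m : E)) m v = z) ↔
      ⟪(Φ m : E), z⟫ = 0 := by
  rw [← Submodule.mem_orthogonal_singleton_iff_inner_right,
    ← range_mvfderiv_subtypeVal (n := n) (Φ m)]
  constructor
  · rintro ⟨v, rfl⟩
    exact ⟨_, (mvfderiv_sphere_coe_comp Φ m v).symm⟩
  · rintro ⟨w, rfl⟩
    obtain ⟨v, rfl⟩ := (Φ.mfderivToContinuousLinearEquiv (by simp) m).surjective w
    exact ⟨v, mvfderiv_sphere_coe_comp Φ m v⟩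

theorem contMDiff_of_sphere_coe_comp [IsManifold IX ∞ X]
    (Φ : M ≃ₘ^∞⟮𝓡 n, 𝓡 n⟯ sphere (0 : E) 1) {f : X → M}
    (hf : ContMDiff IX 𝓘(ℝ, E) ∞ (fun x => (Φ (f x) : E))) : ContMDiff IX (𝓡 n) ∞ f := by
  have h1 := hf.codRestrict_sphere (n := n) fun x => (Φ (f x)).2
  refine (Φ.symm.contMDiff.comp h1).congr fun x => ?_
  change f x = Φ.symm (Φ (f x))
  simp

theorem sphere_add_tangential_ne_zero (a : sphere (0 : E) 1) (z : E) :
    (a : E) + (z - ⟪(a : E), z⟫ • (a : E)) ≠ 0 := by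
  intro h
  have h1 : ⟪(a : E), (a : E)⟫ = 1 := by simp
  have h2 := congrArg (fun w => ⟪(a : E), w⟫) h
  simp only [inner_add_right, inner_sub_right, inner_smul_right, h1, inner_zero_right] at h2
  linarith

/-- The point of the sphere on the ray through `a + z'`, where `z'` is the component of `z`
tangent to the sphere at `a`. -/
noncomputable def sphereShift (a : sphere (0 : E) 1) (z : E) : sphere (0 : E) 1 :=
  ⟨‖(a : E) + (z - ⟪(a : E), z⟫ • (a : E))‖⁻¹ • ((a : E) + (z - ⟪(a : E), z⟫ • (a : E))), by
    rw [mem_sphere_zero_iff_norm, norm_smul, norm_inv, norm_norm,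
      inv_mul_cancel₀ (norm_ne_zero_iff.2 (sphere_add_tangential_ne_zero a z))]⟩

theorem sphereShift_zero (a : sphere (0 : E) 1) : sphereShift a 0 = a := by
  apply Subtype.ext
  simp [sphereShift]

theorem contMDiff_sphereShift :
    ContMDiff ((𝓡 n).prod 𝓘(ℝ, E)) (𝓡 n) ∞ (fun q : sphere (0 : E) 1 × E =>
      sphereShift q.1 q.2) := by
  have h1 : ContMDiff ((𝓡 n).prod 𝓘(ℝ, E)) 𝓘(ℝ, E × E) ∞
      (fun q : sphere (0 : E) 1 × E => ((q.1 : E), q.2)) :=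
    (contMDiff_coe_sphere.comp contMDiff_fst).prodMk_space contMDiff_snd
  refine ContMDiff.codRestrict_sphere (f := fun q : sphere (0 : E) 1 × E =>
    (sphereShift q.1 q.2 : E)) (fun q => ?_) fun q => (sphereShift q.1 q.2).2
  have hne := sphere_add_tangential_ne_zero q.1 q.2
  have h3 : ContDiff ℝ ∞ (fun w : E × E => w.1 + (w.2 - ⟪w.1, w.2⟫ • w.1)) := by
    have : ContDiff ℝ ∞ (fun w : E × E => ⟪w.1, w.2⟫) := contDiff_fst.inner ℝ contDiff_snd
    fun_prop
  have h2 : ContDiffAt ℝ ∞ (fun w : E × E => ‖w.1 + (w.2 - ⟪w.1, w.2⟫ • w.1)‖⁻¹ •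
      (w.1 + (w.2 - ⟪w.1, w.2⟫ • w.1))) ((q.1 : E), q.2) :=
    ((h3.contDiffAt.norm ℝ hne).inv (norm_ne_zero_iff.2 hne)).smul h3.contDiffAt
  exact ContMDiffAt.comp (g := fun w : E × E => ‖w.1 + (w.2 - ⟪w.1, w.2⟫ • w.1)‖⁻¹ •
    (w.1 + (w.2 - ⟪w.1, w.2⟫ • w.1))) q h2.contMDiffAt (h1 q)

theorem fderiv_sphereShift (a : sphere (0 : E) 1) {z : E} (hz : ⟪(a : E), z⟫ = 0) :
    fderiv ℝ (fun w => (sphereShift a w : E)) 0 z = z := by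
  have hd : DifferentiableAt ℝ (fun w => (sphereShift a w : E)) 0 := by
    have hne := sphere_add_tangential_ne_zero a 0
    have h3 : ContDiff ℝ ∞ (fun w : E => (a : E) + (w - ⟪(a : E), w⟫ • (a : E))) := by
      have : ContDiff ℝ ∞ (fun w : E => ⟪(a : E), w⟫) := contDiff_const.inner ℝ contDiff_id
      fun_prop
    have h2 : ContDiffAt ℝ ∞ (fun w => (sphereShift a w : E)) 0 :=
      ((h3.contDiffAt.norm ℝ hne).inv (norm_ne_zero_iff.2 hne)).smul h3.contDiffAt
    exact h2.differentiableAt (by simp)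
  have hline : HasDerivAt (fun s : ℝ => s • z) z 0 := by
    simpa using (hasDerivAt_id (0 : ℝ)).smul_const z
  have hd' : HasFDerivAt (fun w => (sphereShift a w : E))
      (fderiv ℝ (fun w => (sphereShift a w : E)) 0) ((fun s : ℝ => s • z) 0) := by
    simpa using hd.hasFDerivAt
  have h1 := hd'.comp_hasDerivAt 0 hline
  have hn : ∀ s : ℝ, ‖(a : E) + s • z‖ ^ 2 = 1 + s ^ 2 * ‖z‖ ^ 2 := by
    intro s
    rw [norm_add_sq_real, inner_smul_right, hz, norm_smul, mul_pow, Real.norm_eq_abs, sq_abs]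
    simp
  have heq : (fun w => (sphereShift a w : E)) ∘ (fun s : ℝ => s • z) =
      fun s : ℝ => (√(1 + s ^ 2 * ‖z‖ ^ 2))⁻¹ • ((a : E) + s • z) := by
    funext s
    simp only [Function.comp_apply, sphereShift, inner_smul_right, hz, mul_zero, zero_smul,
      sub_zero]
    rw [← hn s, Real.sqrt_sq (norm_nonneg _)]
  rw [heq] at h1
  have h2 : HasDerivAt (fun s : ℝ => (√(1 + s ^ 2 * ‖z‖ ^ 2))⁻¹) 0 0 := by
    have h3 : HasDerivAt (fun s : ℝ => 1 + s ^ 2 * ‖z‖ ^ 2) 0 0 := by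
      simpa using ((hasDerivAt_pow 2 (0 : ℝ)).mul_const (‖z‖ ^ 2)).const_add 1
    have h4 := (h3.sqrt (by simp)).fun_inv (by simp)
    simpa using! h4
  have h5 := h2.smul (hline.const_add (a : E))
  have h6 := h1.unique h5
  simpa using h6

/-- A smooth vector field along a map into (a manifold diffeomorphic to) the sphere can be
prescribed by its values in the ambient space, provided that they are tangent to the sphere. -/
theorem exists_contMDiff_tangent_sphere [IsManifold (𝓡 n) ∞ M] [IsManifold IX ∞ X]
    (Φ : M ≃ₘ^∞⟮𝓡 n, 𝓡 n⟯ sphere (0 : E) 1) {a : X → M} (ha : ContMDiff IX (𝓡 n) ∞ a)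
    {Z : X → E} (hZ : ContMDiff IX 𝓘(ℝ, E) ∞ Z) (h0 : ∀ x, ⟪(Φ (a x) : E), Z x⟫ = 0) :
    ∃ ξ : ∀ x, TangentSpace (𝓡 n) (a x),
      ContMDiff IX (𝓡 n).tangent ∞ (fun x => (⟨a x, ξ x⟩ : TangentBundle (𝓡 n) M)) ∧
      ∀ x, mvfderiv (𝓡 n) (fun m => (Φ m : E)) (a x) (ξ x) = Z x := by
  have _ : IsManifold (𝓡 n) 1 M := .of_le (n := ∞) (by simp)
  -- the vector field is the derivative at `0` of `z ↦ f (a x, z)` in the direction `Z x`, hence the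
  -- image of a smooth section under the tangent map of `f`
  let f : M × E → M := fun q => Φ.symm (sphereShift (Φ q.1) q.2)
  have hf : ContMDiff ((𝓡 n).prod 𝓘(ℝ, E)) (𝓡 n) ∞ f := by
    refine Φ.symm.contMDiff.comp (contMDiff_sphereShift.comp
      (f := fun q : M × E => (Φ q.1, q.2)) ?_)
    exact (Φ.contMDiff.comp contMDiff_fst).prodMk contMDiff_snd
  have hf0 : ∀ m, f (m, 0) = m := fun m => by simp [f, sphereShift_zero]
  let g : M → E → M := fun m z => f (m, z)
  have hg : ∀ m, ContMDiff 𝓘(ℝ, E) (𝓡 n) ∞ (g m) := fun m =>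
    hf.comp (contMDiff_const.prodMk contMDiff_id)
  let D : X → E →L[ℝ] EuclideanSpace ℝ (Fin n) := fun x => mfderiv 𝓘(ℝ, E) (𝓡 n) (g (a x)) 0
  refine ⟨fun x => D x (Z x), ?_, fun x => ?_⟩
  · have h1 : ContMDiff IX ((𝓡 n).tangent.prod 𝓘(ℝ, E).tangent) ∞
        (fun x => ((⟨a x, (0 : EuclideanSpace ℝ (Fin n))⟩ : TangentBundle (𝓡 n) M),
          (⟨(0 : E), Z x⟩ : TangentBundle 𝓘(ℝ, E) E))) := by
      refine ContMDiff.prodMk ?_ (contMDiff_tangentBundle_modelSpace contMDiff_const hZ)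
      exact (Bundle.contMDiff_zeroSection ℝ (TangentSpace (𝓡 n) (M := M))).comp ha
    have h2 := ((hf.contMDiff_tangentMap (m := ∞) (by simp)).comp
      (contMDiff_equivTangentBundleProd_symm (n := ∞) (I := 𝓡 n) (I' := 𝓘(ℝ, E))
        (M := M) (M' := E))).comp h1
    refine h2.congr fun x => ?_
    have h3 : ∀ v : TangentSpace ((𝓡 n).prod 𝓘(ℝ, E)) (a x, (0 : E)),
        v.1 = 0 → mfderiv ((𝓡 n).prod 𝓘(ℝ, E)) (𝓡 n) f (a x, 0) v = D x v.2 := by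
      intro v hv
      refine (mfderiv_prod_eq_add_apply ((hf _).mdifferentiableAt (by simp))).trans ?_
      let D' : EuclideanSpace ℝ (Fin n) →L[ℝ] EuclideanSpace ℝ (Fin n) :=
        mfderiv (𝓡 n) (𝓡 n) (fun z => f (z, (0 : E))) (a x)
      have h4 : D' v.1 + D x v.2 = D x v.2 := by
        have h5 : D' v.1 = 0 := (congrArg D' hv).trans (map_zero D')
        rw [h5, zero_add]
      exact h4
    have hcast : ∀ (p q : M) (_ : p = q) (v w : EuclideanSpace ℝ (Fin n)), v = w → 
        (⟨p, v⟩ : TangentBundle (𝓡 n) M) = ⟨q, w⟩ := by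
      rintro p _ rfl v _ rfl; rfl
    exact hcast _ (f (a x, 0)) (hf0 (a x)).symm _ _
      (h3 ((0 : EuclideanSpace ℝ (Fin n)), Z x) rfl).symm
  · have h1 := mvfderiv_comp_mfderiv (f := g (a x)) (g := fun m => (Φ m : E))
      (((contMDiff_sphere_coe_comp Φ) _).mdifferentiableAt (by simp))
      ((hg (a x) 0).mdifferentiableAt (by simp)) (Z x)
    have h2 : ((fun m => (Φ m : E)) ∘ g (a x)) = fun w => (sphereShift (Φ (a x)) w : E) := by
      funext w; simp [g, f]
    have h3 : mvfderiv 𝓘(ℝ, E) (fun w => (sphereShift (Φ (a x)) w : E)) 0 (Z x) =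
        fderiv ℝ (fun w => (sphereShift (Φ (a x)) w : E)) 0 (Z x) := by
      change mfderiv 𝓘(ℝ, E) 𝓘(ℝ, E) (fun w => (sphereShift (Φ (a x)) w : E)) 0 _ = _
      rw [mfderiv_eq_fderiv]; rfl
    rw [h2, h3, fderiv_sphereShift _ (h0 x)] at h1
    have hpt : ∀ (p q : M) (_ : p = q) (v : EuclideanSpace ℝ (Fin n)),
        mvfderiv (𝓡 n) (fun m => (Φ m : E)) p v = mvfderiv (𝓡 n) (fun m => (Φ m : E)) q v := by
      rintro p _ rfl v; rfl
    exact (hpt (a x) (g (a x) 0) (hf0 (a x)).symm _).trans h1.symm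

end Sphere

/-! ### The closed ball as a manifold with corners -/

section BallSmooth

open Metric

namespace TraceOneBall

variable {𝕜 : Type*} [RCLike 𝕜]

theorem range_model : Set.range (model 𝕜) = closedBall 0 1 := (model 𝕜).range_eq_target

theorem coords_model_symm {x : WithLp 2 (ℝ × 𝕜)} (hx : ‖x‖ ≤ 1) :
    coords ((model 𝕜).symm x).1 = x :=
  (model 𝕜).right_inv (by rw [range_model]; simpa using hx)

theorem model_symm_coords (b : TraceOneBall 𝕜) : (model 𝕜).symm (coords b.1) = b :=
  (model 𝕜).left_inv b

theorem contMDiff_coords :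
    ContMDiff (model 𝕜) 𝓘(ℝ, WithLp 2 (ℝ × 𝕜)) ∞ (fun b : TraceOneBall 𝕜 => coords b.1) :=
  (model 𝕜).contMDiff

/-- The ball is its own model space, so tangent vectors are derivatives of the coordinates. -/
theorem mvfderiv_coords (b : TraceOneBall 𝕜) (v : TangentSpace (model 𝕜) b) :
    mvfderiv (model 𝕜) (fun b : TraceOneBall 𝕜 => coords b.1) b v = v := by
  have h := ((model 𝕜).hasMFDerivAt (x := b)).mfderiv
  exact congrArg (fun L : WithLp 2 (ℝ × 𝕜) →L[ℝ] WithLp 2 (ℝ × 𝕜) => L v) h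

theorem isInteriorPoint_iff (b : TraceOneBall 𝕜) :
    (model 𝕜).IsInteriorPoint b ↔ ‖coords b.1‖ < 1 := by
  change extChartAt (model 𝕜) b b ∈ interior (Set.range (model 𝕜)) ↔ _
  rw [range_model, interior_closedBall _ one_ne_zero]
  exact mem_ball_zero_iff

theorem isBoundaryPoint_iff (b : TraceOneBall 𝕜) :
    (model 𝕜).IsBoundaryPoint b ↔ ‖coords b.1‖ = 1 := by
  rw [ModelWithCorners.isBoundaryPoint_iff_not_isInteriorPoint, isInteriorPoint_iff, not_lt]
  exact ⟨fun h => (norm_coords_le b).antisymm h, fun h => h.ge⟩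

/-- A map into the closed ball is smooth if its coordinates are. -/
theorem contMDiff_of_coords {E H M : Type*} [NormedAddCommGroup E] [NormedSpace ℝ E]
    [TopologicalSpace H] {I : ModelWithCorners ℝ E H} [TopologicalSpace M] [ChartedSpace H M]
    {f : M → TraceOneBall 𝕜}
    (h : ContMDiff I 𝓘(ℝ, WithLp 2 (ℝ × 𝕜)) ∞ (fun x => coords (f x).1)) :
    ContMDiff I (model 𝕜) ∞ f := by
  intro x
  rw [contMDiffAt_iff_target]
  refine ⟨?_, ?_⟩
  · have h1 : Continuous ((model 𝕜).symm ∘ fun x => coords (f x).1) :=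
      (model 𝕜).continuous_symm.comp h.continuous
    have h2 : (model 𝕜).symm ∘ (fun x => coords (f x).1) = f :=
      funext fun x => model_symm_coords (f x)
    rw [h2] at h1
    exact h1.continuousAt
  · have h1 : (extChartAt (model 𝕜) (f x)) ∘ f = fun x => coords (f x).1 := rfl
    rw [h1]
    exact h x

instance : CompactSpace (TraceOneBall 𝕜) := by
  have h : Set.range (fun x : closedBall (0 : WithLp 2 (ℝ × 𝕜)) 1 => (model 𝕜).symm x.1) =
      Set.univ := by
    refine Set.eq_univ_of_forall fun b => ⟨⟨coords b.1, ?_⟩, model_symm_coords b⟩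
    simpa using norm_coords_le b
  have : ProperSpace (WithLp 2 (ℝ × 𝕜)) := FiniteDimensional.proper_real _
  have hc : CompactSpace (closedBall (0 : WithLp 2 (ℝ × 𝕜)) 1) :=
    isCompact_iff_compactSpace.1 (isCompact_closedBall 0 1)
  refine ⟨h ▸ isCompact_range ?_⟩
  exact (model 𝕜).continuous_symm.comp continuous_subtype_val

end TraceOneBall

end BallSmooth

/-! ### Vector fields on the product of the compact group and the ball -/

section ProductSmooth

open Metric Matrix Module
open scoped RealInnerProductSpace

variable (𝕜 : Type*) [RCLike 𝕜]

namespace SpecialUnitary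

/-- `SU(2)` (resp. `SO(2)`) is diffeomorphic to the unit sphere of `𝕜²`. -/
noncomputable def diffeomorphSphere :
    specialUnitaryGroup (Fin 2) 𝕜 ≃ₘ^∞⟮𝓡 (2 * finrank ℝ 𝕜 - 1), 𝓡 (2 * finrank ℝ 𝕜 - 1)⟯
      sphere (0 : WithLp 2 (𝕜 × 𝕜)) 1 :=
  transportDiffeomorph (𝓡 (2 * finrank ℝ 𝕜 - 1)) (homeomorphSphere 𝕜)

variable {𝕜}

/-- The first column of a matrix. -/
def firstColumn (m : Matrix (Fin 2) (Fin 2) 𝕜) : WithLp 2 (𝕜 × 𝕜) :=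
  WithLp.toLp 2 (m 0 0, m 1 0)

instance : CompactSpace (specialUnitaryGroup (Fin 2) 𝕜) := by
  have : ProperSpace (WithLp 2 (𝕜 × 𝕜)) := FiniteDimensional.proper_real _
  have hc : CompactSpace (sphere (0 : WithLp 2 (𝕜 × 𝕜)) 1) :=
    isCompact_iff_compactSpace.1 (isCompact_sphere 0 1)
  exact (homeomorphSphere 𝕜).symm.compactSpace

end SpecialUnitary

variable {𝕜}

open SpecialUnitary TraceOneBall

variable (𝕜) in
/-- The model with corners of the product of the maximal compact subgroup and the closed ball. -/
noncomputable abbrev productModel :=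
  (𝓡 (2 * finrank ℝ 𝕜 - 1)).prod (TraceOneBall.model 𝕜)

/-- The derivative of the first column of the `SU(2)`-component of a point along a tangent vector
of the product `K × B`. -/
noncomputable def columnDeriv (x : specialUnitaryGroup (Fin 2) 𝕜 × TraceOneBall 𝕜)
    (v : TangentSpace (productModel 𝕜) x) : WithLp 2 (𝕜 × 𝕜) :=
  mvfderiv (𝓡 (2 * finrank ℝ 𝕜 - 1))
    (fun k : specialUnitaryGroup (Fin 2) 𝕜 => (diffeomorphSphere 𝕜 k : WithLp 2 (𝕜 × 𝕜))) x.1 v.1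

/-- The derivative of the coordinates of the ball component of a point along a tangent vector
of the product `K × B`. -/
noncomputable def ballDeriv (x : specialUnitaryGroup (Fin 2) 𝕜 × TraceOneBall 𝕜)
    (v : TangentSpace (productModel 𝕜) x) : WithLp 2 (ℝ × 𝕜) :=
  v.2

variable {x : specialUnitaryGroup (Fin 2) 𝕜 × TraceOneBall 𝕜}

/-- A tangent vector of `K × B` is determined by its two components. -/
theorem tangent_ext {v w : TangentSpace (productModel 𝕜) x}
    (h1 : columnDeriv x v = columnDeriv x w) (h2 : ballDeriv x v = ballDeriv x w) : v = w :=
  Prod.ext (injective_mvfderiv_sphere_coe_comp _ _ h1) h2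

theorem columnDeriv_sum {n : ℕ} (f : Fin n → ℝ) (v : Fin n → TangentSpace (productModel 𝕜) x) :
    columnDeriv x (∑ i, f i • v i) = ∑ i, f i • columnDeriv x (v i) := by
  let L : TangentSpace (productModel 𝕜) x →ₗ[ℝ] WithLp 2 (𝕜 × 𝕜) :=
    (mvfderiv (𝓡 (2 * finrank ℝ 𝕜 - 1))
      (fun k : specialUnitaryGroup (Fin 2) 𝕜 => (diffeomorphSphere 𝕜 k : WithLp 2 (𝕜 × 𝕜)))
      x.1).toLinearMap ∘ₗ LinearMap.fst ℝ (EuclideanSpace ℝ (Fin (2 * finrank ℝ 𝕜 - 1)))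
        (WithLp 2 (ℝ × 𝕜))
  change L _ = ∑ i, f i • L (v i)
  rw [map_sum]
  simp only [map_smul]

theorem ballDeriv_sum {n : ℕ} (f : Fin n → ℝ) (v : Fin n → TangentSpace (productModel 𝕜) x) :
    ballDeriv x (∑ i, f i • v i) = ∑ i, f i • ballDeriv x (v i) := by
  let L : TangentSpace (productModel 𝕜) x →ₗ[ℝ] WithLp 2 (ℝ × 𝕜) :=
    LinearMap.snd ℝ (EuclideanSpace ℝ (Fin (2 * finrank ℝ 𝕜 - 1))) (WithLp 2 (ℝ × 𝕜))
  change L _ = ∑ i, f i • L (v i)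
  rw [map_sum]
  simp only [map_smul]

theorem inner_columnDeriv (v : TangentSpace (productModel 𝕜) x) :
    ⟪firstColumn x.1.1, columnDeriv x v⟫ = 0 :=
  (exists_mvfderiv_sphere_coe_comp_iff (diffeomorphSphere 𝕜) x.1 _).1 ⟨v.1, rfl⟩

section VectorFields

variable {V : ∀ x : specialUnitaryGroup (Fin 2) 𝕜 × TraceOneBall 𝕜,
  TangentSpace (productModel 𝕜) x}

theorem IsSmoothVectorField.contMDiff_components
    (hV : IsSmoothVectorField (productModel 𝕜) V) :
    ContMDiff (productModel 𝕜) 𝓘(ℝ, WithLp 2 (𝕜 × 𝕜)) ∞ (fun x => columnDeriv x (V x)) ∧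
    ContMDiff (productModel 𝕜) 𝓘(ℝ, WithLp 2 (ℝ × 𝕜)) ∞ (fun x => ballDeriv x (V x)) := by
  have _ : IsManifold (𝓡 (2 * finrank ℝ 𝕜 - 1)) 1 (specialUnitaryGroup (Fin 2) 𝕜) :=
    .of_le (n := ∞) (by simp)
  have h1 := (contMDiff_equivTangentBundleProd (n := ∞) (I := 𝓡 (2 * finrank ℝ 𝕜 - 1))
    (I' := model 𝕜) (M := specialUnitaryGroup (Fin 2) 𝕜) (M' := TraceOneBall 𝕜)).comp hV
  constructor
  · exact contMDiff_mvfderiv_apply (contMDiff_sphere_coe_comp (diffeomorphSphere 𝕜))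
      (contMDiff_fst.comp h1)
  · exact (contMDiff_snd_tangentBundle_modelSpace (TraceOneBall 𝕜) (model 𝕜)).comp
      (contMDiff_snd.comp h1)

/-- Vector fields on `K × B` can be prescribed by their components; the only condition is that the
first one be tangent to the unit sphere that contains the first columns. -/
theorem exists_isSmoothVectorField
    {Z : specialUnitaryGroup (Fin 2) 𝕜 × TraceOneBall 𝕜 → WithLp 2 (𝕜 × 𝕜)}
    {q : specialUnitaryGroup (Fin 2) 𝕜 × TraceOneBall 𝕜 → WithLp 2 (ℝ × 𝕜)}
    (hZ : ContMDiff (productModel 𝕜) 𝓘(ℝ, WithLp 2 (𝕜 × 𝕜)) ∞ Z)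
    (hq : ContMDiff (productModel 𝕜) 𝓘(ℝ, WithLp 2 (ℝ × 𝕜)) ∞ q)
    (h0 : ∀ x, ⟪firstColumn x.1.1, Z x⟫ = 0) :
    ∃ V : ∀ x : specialUnitaryGroup (Fin 2) 𝕜 × TraceOneBall 𝕜,
      TangentSpace (productModel 𝕜) x, IsSmoothVectorField (productModel 𝕜) V ∧
      ∀ x, columnDeriv x (V x) = Z x ∧ ballDeriv x (V x) = q x := by
  have _ : IsManifold (𝓡 (2 * finrank ℝ 𝕜 - 1)) 1 (specialUnitaryGroup (Fin 2) 𝕜) :=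
    .of_le (n := ∞) (by simp)
  obtain ⟨ξ, hξ, hξZ⟩ := exists_contMDiff_tangent_sphere (diffeomorphSphere 𝕜)
    (contMDiff_fst (I := 𝓡 (2 * finrank ℝ 𝕜 - 1)) (J := model 𝕜)
      (M := specialUnitaryGroup (Fin 2) 𝕜) (N := TraceOneBall 𝕜)) hZ h0
  refine ⟨fun x => (ξ x, q x), ?_, fun x => ⟨hξZ x, rfl⟩⟩
  have h1 : ContMDiff (productModel 𝕜) (model 𝕜).tangent ∞
      (fun x : specialUnitaryGroup (Fin 2) 𝕜 × TraceOneBall 𝕜 =>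
        (⟨x.2, q x⟩ : TangentBundle (model 𝕜) (TraceOneBall 𝕜))) :=
    contMDiff_tangentBundle_modelSpace contMDiff_snd hq
  exact (contMDiff_equivTangentBundleProd_symm (n := ∞) (I := 𝓡 (2 * finrank ℝ 𝕜 - 1))
    (I' := model 𝕜) (M := specialUnitaryGroup (Fin 2) 𝕜) (M' := TraceOneBall 𝕜)).comp
    (hξ.prodMk h1)

end VectorFields

theorem mem_interior_product_iff :
    x ∈ (productModel 𝕜).interior (specialUnitaryGroup (Fin 2) 𝕜 × TraceOneBall 𝕜) ↔
      ‖coords x.2.1‖ < 1 := by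
  rw [ModelWithCorners.interior_prod, ModelWithCorners.interior_eq_univ]
  exact ⟨fun h => (isInteriorPoint_iff x.2).1 h.2, fun h => ⟨trivial, (isInteriorPoint_iff x.2).2 h⟩⟩

theorem mem_boundary_product_iff :
    x ∈ (productModel 𝕜).boundary (specialUnitaryGroup (Fin 2) 𝕜 × TraceOneBall 𝕜) ↔
      ‖coords x.2.1‖ = 1 := by
  rw [ModelWithCorners.boundary_of_boundaryless_left]
  exact ⟨fun h => (isBoundaryPoint_iff x.2).1 h.2, fun h => ⟨trivial, (isBoundaryPoint_iff x.2).2 h⟩⟩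

theorem dense_interior_product :
    Dense {x : specialUnitaryGroup (Fin 2) 𝕜 × TraceOneBall 𝕜 | ‖coords x.2.1‖ < 1} := by
  intro x
  let γ : ℝ → specialUnitaryGroup (Fin 2) 𝕜 × TraceOneBall 𝕜 := fun t =>
    (x.1, (model 𝕜).symm (t • coords x.2.1))
  have hγ : Continuous γ := by
    refine continuous_const.prodMk ((model 𝕜).continuous_symm.comp ?_)
    fun_prop
  have h1 : γ 1 = x := by simp [γ, model_symm_coords]
  have h2 : Filter.Tendsto γ (nhdsWithin 1 (Set.Ioo 0 1)) (nhds x) := by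
    have := (hγ.tendsto 1).mono_left (nhdsWithin_le_nhds (s := Set.Ioo 0 1))
    rwa [h1] at this
  have hne : (nhdsWithin (1 : ℝ) (Set.Ioo 0 1)).NeBot := right_nhdsWithin_Ioo_neBot one_pos
  refine mem_closure_of_tendsto h2 ?_
  filter_upwards [self_mem_nhdsWithin] with t ht
  have h3 : ‖t • coords x.2.1‖ < 1 := by
    rw [norm_smul, Real.norm_of_nonneg ht.1.le]
    nlinarith [norm_nonneg (coords x.2.1), norm_coords_le x.2, ht.1, ht.2]
  change ‖coords ((model 𝕜).symm (t • coords x.2.1)).1‖ < 1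
  rwa [coords_model_symm h3.le]

/-- The components of the derivative of a map into `K × B` are the derivatives of the first column
and of the coordinates. -/
theorem mfderiv_components {E H M : Type*} [NormedAddCommGroup E] [NormedSpace ℝ E]
    [TopologicalSpace H] {I : ModelWithCorners ℝ E H} [TopologicalSpace M] [ChartedSpace H M]
    {f : M → specialUnitaryGroup (Fin 2) 𝕜 × TraceOneBall 𝕜}
    (hf : ContMDiff I (productModel 𝕜) ∞ f) (m : M) (ξ : TangentSpace I m) :
    columnDeriv (f m) (mfderiv I (productModel 𝕜) f m ξ) =
      mvfderiv I (fun m => firstColumn (f m).1.1) m ξ ∧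
    ballDeriv (f m) (mfderiv I (productModel 𝕜) f m ξ) =
      mvfderiv I (fun m => coords (f m).2.1) m ξ := by
  have h0 := (hf m).mdifferentiableAt (by simp)
  have e1 : ∀ v : TangentSpace (productModel 𝕜) (f m), columnDeriv (f m) v =
      mvfderiv (productModel 𝕜) (fun x : specialUnitaryGroup (Fin 2) 𝕜 × TraceOneBall 𝕜 =>
        firstColumn x.1.1) (f m) v := by
    intro v
    have h := mvfderiv_comp_mfderiv (I := productModel 𝕜) (x := f m)
      (f := (Prod.fst : specialUnitaryGroup (Fin 2) 𝕜 × TraceOneBall 𝕜 → _))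
      (g := fun k : specialUnitaryGroup (Fin 2) 𝕜 => (diffeomorphSphere 𝕜 k : WithLp 2 (𝕜 × 𝕜)))
      (((contMDiff_sphere_coe_comp (diffeomorphSphere 𝕜)) _).mdifferentiableAt (by simp))
      mdifferentiableAt_fst v
    rw [mfderiv_fst] at h
    exact h.symm
  have e2 : ∀ v : TangentSpace (productModel 𝕜) (f m), ballDeriv (f m) v =
      mvfderiv (productModel 𝕜) (fun x : specialUnitaryGroup (Fin 2) 𝕜 × TraceOneBall 𝕜 =>
        coords x.2.1) (f m) v := by
    intro v
    have h := mvfderiv_comp_mfderiv (I := productModel 𝕜) (x := f m)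
      (f := (Prod.snd : specialUnitaryGroup (Fin 2) 𝕜 × TraceOneBall 𝕜 → _))
      (g := fun b : TraceOneBall 𝕜 => coords b.1)
      ((contMDiff_coords _).mdifferentiableAt (by simp))
      mdifferentiableAt_snd v
    rw [mfderiv_snd, mvfderiv_coords] at h
    exact h.symm
  have s1 : ContMDiff (productModel 𝕜) 𝓘(ℝ, WithLp 2 (𝕜 × 𝕜)) ∞
      (fun x : specialUnitaryGroup (Fin 2) 𝕜 × TraceOneBall 𝕜 => firstColumn x.1.1) :=
    (contMDiff_sphere_coe_comp (diffeomorphSphere 𝕜)).comp contMDiff_fst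
  have s2 : ContMDiff (productModel 𝕜) 𝓘(ℝ, WithLp 2 (ℝ × 𝕜)) ∞
      (fun x : specialUnitaryGroup (Fin 2) 𝕜 × TraceOneBall 𝕜 => coords x.2.1) :=
    contMDiff_coords.comp contMDiff_snd
  rw [e1, e2]
  exact ⟨(mvfderiv_comp_mfderiv ((s1 _).mdifferentiableAt (by simp)) h0 ξ).symm,
    (mvfderiv_comp_mfderiv ((s2 _).mdifferentiableAt (by simp)) h0 ξ).symm⟩

end ProductSmooth

/-! ### Smooth matrix-valued functions -/

section SmoothMatrix

open Matrix

variable {𝕜 : Type*} [RCLike 𝕜] {E H M : Type*} [NormedAddCommGroup E] [NormedSpace ℝ E]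
  [TopologicalSpace H] {I : ModelWithCorners ℝ E H} [TopologicalSpace M] [ChartedSpace H M]

/-- A matrix-valued function is smooth on a set if all its entries are. -/
def SmoothEntriesOn (I : ModelWithCorners ℝ E H) (f : M → Matrix (Fin 2) (Fin 2) 𝕜)
    (s : Set M) : Prop :=
  ∀ i j, ContMDiffOn I 𝓘(ℝ, 𝕜) ∞ (fun x => f x i j) s

namespace SmoothEntriesOn

variable {f g : M → Matrix (Fin 2) (Fin 2) 𝕜} {s : Set M}

theorem const (m : Matrix (Fin 2) (Fin 2) 𝕜) : SmoothEntriesOn I (fun _ : M => m) s :=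
  fun _ _ => contMDiffOn_const

theorem add (hf : SmoothEntriesOn I f s) (hg : SmoothEntriesOn I g s) :
    SmoothEntriesOn I (fun x => f x + g x) s :=
  fun i j => (hf i j).add (hg i j)

theorem sub (hf : SmoothEntriesOn I f s) (hg : SmoothEntriesOn I g s) :
    SmoothEntriesOn I (fun x => f x - g x) s :=
  fun i j => (hf i j).sub (hg i j)

theorem mul (hf : SmoothEntriesOn I f s) (hg : SmoothEntriesOn I g s) :
    SmoothEntriesOn I (fun x => f x * g x) s := by
  have hm : ContDiff ℝ ∞ (fun p : 𝕜 × 𝕜 => p.1 * p.2) := by fun_prop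
  intro i j
  have h := fun l => hm.contMDiff.comp_contMDiffOn ((hf i l).prodMk_space (hg l j))
  refine ((h 0).add (h 1)).congr fun x _ => ?_
  simp [mul_apply, Fin.sum_univ_two]

theorem conjTranspose (hf : SmoothEntriesOn I f s) :
    SmoothEntriesOn I (fun x => (f x)ᴴ) s :=
  fun i j => (RCLike.conjCLE (K := 𝕜)).contDiff.contMDiff.comp_contMDiffOn (hf j i)

theorem smul {c : M → ℝ} (hc : ContMDiffOn I 𝓘(ℝ, ℝ) ∞ c s) (hf : SmoothEntriesOn I f s) :
    SmoothEntriesOn I (fun x => c x • f x) s :=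
  fun i j => hc.smul (hf i j)

theorem adjugate (hf : SmoothEntriesOn I f s) :
    SmoothEntriesOn I (fun x => (f x).adjugate) s := by
  have hn : ContDiff ℝ ∞ (fun p : 𝕜 => -p) := by fun_prop
  intro i j
  simp only [adjugate_fin_two]
  fin_cases i <;> fin_cases j
  · exact hf 1 1
  · exact hn.contMDiff.comp_contMDiffOn (hf 0 1)
  · exact hn.contMDiff.comp_contMDiffOn (hf 1 0)
  · exact hf 0 0

theorem re_trace (hf : SmoothEntriesOn I f s) :
    ContMDiffOn I 𝓘(ℝ, ℝ) ∞ (fun x => RCLike.re (f x).trace) s := by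
  have h := (RCLike.reCLM (K := 𝕜)).contDiff.contMDiff.comp_contMDiffOn ((hf 0 0).add (hf 1 1))
  refine h.congr fun x _ => ?_
  simp [trace_fin_two]

theorem firstColumn (hf : SmoothEntriesOn I f s) :
    ContMDiffOn I 𝓘(ℝ, WithLp 2 (𝕜 × 𝕜)) ∞ (fun x => SpecialUnitary.firstColumn (f x)) s :=
  (WithLp.prodContinuousLinearEquiv 2 ℝ 𝕜 𝕜).symm.contDiff.contMDiff.comp_contMDiffOn
    ((hf 0 0).prodMk_space (hf 1 0))

theorem coords (hf : SmoothEntriesOn I f s) :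
    ContMDiffOn I 𝓘(ℝ, WithLp 2 (ℝ × 𝕜)) ∞ (fun x => TraceOneBall.coords (f x)) s := by
  have h1 := (RCLike.reCLM (K := 𝕜)).contDiff.contMDiff.comp_contMDiffOn ((hf 0 0).sub (hf 1 1))
  have hm : ContDiff ℝ ∞ (fun p : 𝕜 => 2 * p) := by fun_prop
  have h2 := hm.contMDiff.comp_contMDiffOn (hf 0 1)
  exact (WithLp.prodContinuousLinearEquiv 2 ℝ ℝ 𝕜).symm.contDiff.contMDiff.comp_contMDiffOn
    (h1.prodMk_space h2)

end SmoothEntriesOn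

end SmoothMatrix

/-! ### Identities for two by two matrices -/

section TwoByTwo

open Matrix

variable {R : Type*} [CommRing R]

theorem Matrix.mul_self_fin_two (m : Matrix (Fin 2) (Fin 2) R) :
    m * m = m.trace • m - m.det • 1 := by
  ext i j
  fin_cases i <;> fin_cases j <;> simp [mul_apply, Fin.sum_univ_two, trace_fin_two, det_fin_two] <;>
    ring

theorem Matrix.adjugate_eq_fin_two (m : Matrix (Fin 2) (Fin 2) R) :
    m.adjugate = m.trace • 1 - m := by
  ext i j
  fin_cases i <;> fin_cases j <;> simp [adjugate_fin_two, trace_fin_two]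

/-- Polarization of the Cayley–Hamilton theorem for trace-free `2 × 2` matrices, of which the
second one is `b + b - 1`. -/
theorem Matrix.anticommutator_fin_two {w b : Matrix (Fin 2) (Fin 2) R} (hw : w.trace = 0)
    (hb : b.trace = 1) :
    w * (b + b - 1) + (b + b - 1) * w = (2 * (w * b).trace) • 1 := by
  rw [trace_fin_two] at hw hb
  have h1 : w 1 1 = -w 0 0 := by linear_combination hw
  have h2 : b 1 1 = 1 - b 0 0 := by linear_combination hb
  ext i j
  fin_cases i <;> fin_cases j <;>
    simp [mul_apply, Fin.sum_univ_two, trace_fin_two, h1, h2] <;> ring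

end TwoByTwo

/-! ### The polar decomposition of a matrix of determinant one -/

section Polar

open Matrix SpecialUnitary TraceOneBall

variable {𝕜 : Type*} [RCLike 𝕜]

/-- The square of the Hilbert–Schmidt norm of a matrix. -/
noncomputable def normSqHS (m : Matrix (Fin 2) (Fin 2) 𝕜) : ℝ := RCLike.re (mᴴ * m).trace

theorem coe_normSqHS (m : Matrix (Fin 2) (Fin 2) 𝕜) :
    ((normSqHS m : ℝ) : 𝕜) = (mᴴ * m).trace := by
  refine RCLike.conj_eq_iff_re.1 ?_
  rw [← RCLike.star_def, ← trace_conjTranspose, (isHermitian_conjTranspose_mul_self m).eq]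

theorem normSqHS_nonneg (m : Matrix (Fin 2) (Fin 2) 𝕜) : 0 ≤ normSqHS m :=
  (RCLike.nonneg_iff.1 (posSemidef_conjTranspose_mul_self m).trace_nonneg).1

/-- For a matrix `g` of determinant one this is the trace of `(g* g)^(1/2)`. -/
noncomputable def polarTrace (m : Matrix (Fin 2) (Fin 2) 𝕜) : ℝ := √(normSqHS m + 2)

theorem polarTrace_pos (m : Matrix (Fin 2) (Fin 2) 𝕜) : 0 < polarTrace m :=
  Real.sqrt_pos.2 (by linarith [normSqHS_nonneg m])

theorem polarTrace_sq (m : Matrix (Fin 2) (Fin 2) 𝕜) : polarTrace m ^ 2 = normSqHS m + 2 :=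
  Real.sq_sqrt (by linarith [normSqHS_nonneg m])

/-- For a matrix `g` of determinant one this is the unitary factor of its polar decomposition. -/
noncomputable def polarUnitary (m : Matrix (Fin 2) (Fin 2) 𝕜) : Matrix (Fin 2) (Fin 2) 𝕜 :=
  (polarTrace m)⁻¹ • (m + m.adjugateᴴ)

/-- For a matrix `g` of determinant one this is `(g* g)^(1/2)` divided by its trace. -/
noncomputable def polarBall (m : Matrix (Fin 2) (Fin 2) 𝕜) : Matrix (Fin 2) (Fin 2) 𝕜 :=
  (normSqHS m + 2)⁻¹ • (mᴴ * m + 1)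

theorem polarBall_eq (m : Matrix (Fin 2) (Fin 2) 𝕜) :
    polarBall m = ((polarTrace m)⁻¹ * (polarTrace m)⁻¹) • (mᴴ * m + 1) := by
  rw [polarBall, ← polarTrace_sq, sq, mul_inv]

theorem real_smul_eq (c : ℝ) (m : Matrix (Fin 2) (Fin 2) 𝕜) : c • m = (c : 𝕜) • m := by
  ext i j; simp [RCLike.real_smul_eq_coe_mul]

section DetOne

variable {m : Matrix (Fin 2) (Fin 2) 𝕜}

theorem conjTranspose_mul_self_sq (hm : m.det = 1) :
    (mᴴ * m) * (mᴴ * m) = normSqHS m • (mᴴ * m) - 1 := by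
  rw [mul_self_fin_two, det_mul, det_conjTranspose, hm, real_smul_eq, coe_normSqHS]
  simp

/-- `t b` is a square root of `m* m`, where `t = polarTrace m` and `b = polarBall m`. -/
theorem polar_factor_sq (hm : m.det = 1) :
    (polarTrace m • polarBall m) * (polarTrace m • polarBall m) = mᴴ * m := by
  have ht := (polarTrace_pos m).ne'
  have h1 : polarTrace m • polarBall m = (polarTrace m)⁻¹ • (mᴴ * m + 1) := by
    rw [polarBall_eq, smul_smul]; congr 1; field_simp
  rw [h1, smul_mul_smul_comm, add_mul, mul_add, conjTranspose_mul_self_sq hm]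
  have h2 : normSqHS m • (mᴴ * m) - 1 + mᴴ * m * 1 + 1 * (mᴴ * m + 1) =
      (polarTrace m ^ 2) • (mᴴ * m) := by
    rw [polarTrace_sq, mul_one, one_mul]; module
  rw [h2, smul_smul]
  have h3 : (polarTrace m)⁻¹ * (polarTrace m)⁻¹ * polarTrace m ^ 2 = 1 := by field_simp
  rw [h3, one_smul]

theorem mul_conjTranspose_mul_self (hm : m.det = 1) :
    m * (mᴴ * m) + m.adjugateᴴ = normSqHS m • m := by
  have h1 : mᴴ * m + (mᴴ * m).adjugate = normSqHS m • 1 := by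
    rw [adjugate_eq_fin_two, real_smul_eq, coe_normSqHS]; abel
  have h2 : m * (mᴴ * m).adjugate = m.adjugateᴴ := by
    rw [adjugate_mul_distrib, ← mul_assoc, mul_adjugate, hm, one_smul, one_mul,
      adjugate_conjTranspose]
  rw [← h2, ← mul_add, h1, mul_smul_comm, mul_one]

/-- The polar decomposition `m = k (t b)`. -/
theorem polarUnitary_mul (hm : m.det = 1) :
    polarUnitary m * (polarTrace m • polarBall m) = m := by
  have ht := (polarTrace_pos m).ne'
  have h1 : m.adjugateᴴ * (mᴴ * m) = m := by
    rw [← mul_assoc, ← conjTranspose_mul, mul_adjugate, hm]; simp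
  have h2 : (m + m.adjugateᴴ) * (mᴴ * m + 1) = (polarTrace m ^ 2) • m := by
    rw [mul_add, add_mul, h1, mul_one, polarTrace_sq]
    have := mul_conjTranspose_mul_self hm
    calc m * (mᴴ * m) + m + (m + m.adjugateᴴ) = (m * (mᴴ * m) + m.adjugateᴴ) + 2 • m := by
          module
      _ = _ := by rw [this]; module
  rw [polarUnitary, polarBall_eq, smul_smul, smul_mul_smul_comm, h2, smul_smul]
  have h3 : (polarTrace m)⁻¹ * (polarTrace m * ((polarTrace m)⁻¹ * (polarTrace m)⁻¹)) *
      polarTrace m ^ 2 = 1 := by field_simp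
  rw [h3, one_smul]

theorem trace_polarBall (m : Matrix (Fin 2) (Fin 2) 𝕜) : (polarBall m).trace = 1 := by
  have h : ((normSqHS m : ℝ) : 𝕜) + 2 ≠ 0 := by
    have : (normSqHS m + 2 : ℝ) ≠ 0 := by linarith [normSqHS_nonneg m]
    exact_mod_cast this
  rw [polarBall, real_smul_eq, trace_smul, trace_add, ← coe_normSqHS, trace_one]
  have h4 : (algebraMap ℝ 𝕜) 2 = 2 := map_ofNat _ 2
  simp [h4, h]

theorem posDef_polarBall (m : Matrix (Fin 2) (Fin 2) 𝕜) : (polarBall m).PosDef := by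
  have h : (0 : ℝ) < (normSqHS m + 2)⁻¹ := inv_pos.2 (by linarith [normSqHS_nonneg m])
  exact (PosDef.posSemidef_add (posSemidef_conjTranspose_mul_self m) PosDef.one).smul h

theorem polarUnitary_mem (hm : m.det = 1) :
    polarUnitary m ∈ specialUnitaryGroup (Fin 2) 𝕜 := by
  have ht := (polarTrace_pos m).ne'
  have h1 : (polarUnitary m)ᴴ * polarUnitary m = 1 := by
    have e1 : m.adjugate * m = 1 := by rw [adjugate_mul, hm, one_smul]
    have e2 : mᴴ * m.adjugateᴴ = 1 := by rw [← conjTranspose_mul, e1, conjTranspose_one]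
    have e3 : m.adjugate * m.adjugateᴴ = (mᴴ * m).adjugate := by
      rw [adjugate_mul_distrib, adjugate_conjTranspose]
    have e4 : mᴴ * m + (mᴴ * m).adjugate = normSqHS m • 1 := by
      rw [adjugate_eq_fin_two, real_smul_eq, coe_normSqHS]; abel
    have e5 : (m + m.adjugateᴴ)ᴴ * (m + m.adjugateᴴ) = (polarTrace m ^ 2) • 1 := by
      rw [conjTranspose_add, conjTranspose_conjTranspose, add_mul, mul_add, mul_add, e1, e2, e3,
        polarTrace_sq]
      calc mᴴ * m + 1 + (1 + (mᴴ * m).adjugate) = (mᴴ * m + (mᴴ * m).adjugate) + 2 • 1 := by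
            module
        _ = _ := by rw [e4]; module
    rw [polarUnitary, conjTranspose_smul, smul_mul_smul_comm, e5, smul_smul]
    have h3 : star (polarTrace m)⁻¹ * (polarTrace m)⁻¹ * polarTrace m ^ 2 = 1 := by
      rw [star_trivial]; field_simp
    rw [h3, one_smul]
  rw [mem_specialUnitaryGroup_iff, mem_unitaryGroup_iff']
  refine ⟨h1, ?_⟩
  -- `det k * det a = det g = 1`, where `det a` is positive and its square is `det (g* g) = 1`
  have h2 := congrArg det (polarUnitary_mul hm)
  have h3 := congrArg det (polar_factor_sq hm)
  rw [det_mul, hm] at h2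
  rw [det_mul, det_mul, det_conjTranspose, hm] at h3
  have h4 : 0 < (polarTrace m • polarBall m).det :=
    (PosDef.smul (posDef_polarBall m) (polarTrace_pos m)).det_pos
  have h5 : (polarTrace m • polarBall m).det = 1 := by
    have h6 : ((polarTrace m • polarBall m).det - 1) *
        ((polarTrace m • polarBall m).det + 1) = 0 := by
      rw [star_one, mul_one] at h3
      linear_combination h3
    rcases mul_eq_zero.1 h6 with h7 | h7
    · exact sub_eq_zero.1 h7
    · exfalso
      have h8 : (polarTrace m • polarBall m).det = -1 := by linear_combination h7
      rw [h8] at h4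
      have := (RCLike.pos_iff.1 h4).1
      simp at this
      linarith
  rw [h5, mul_one] at h2
  exact h2

end DetOne

end Polar

/-! ### The polar map and its inverse -/

section PolarMap

open Matrix SpecialUnitary TraceOneBall Module

variable {𝕜 : Type*} [RCLike 𝕜]

theorem TraceOneBall.det_eq (b : TraceOneBall 𝕜) :
    b.1.det = (((1 - ‖coords b.1‖ ^ 2) / 4 : ℝ) : 𝕜) := by
  rw [← det_ofCoords, ofCoords_coords b.2.1.1 b.2.2]

theorem SpecialUnitary.adjugate_eq (k : specialUnitaryGroup (Fin 2) 𝕜) :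
    k.1.adjugate = k.1ᴴ := by
  obtain ⟨h1, h2⟩ := entries 𝕜 k.2
  ext i j
  fin_cases i <;> fin_cases j <;> simp [adjugate_fin_two, h1, h2]

theorem SpecialUnitary.conjTranspose_mul_self (k : specialUnitaryGroup (Fin 2) 𝕜) :
    k.1ᴴ * k.1 = 1 :=
  mem_unitaryGroup_iff'.1 (mem_specialUnitaryGroup_iff.1 k.2).1

theorem SpecialUnitary.mul_conjTranspose_self (k : specialUnitaryGroup (Fin 2) 𝕜) :
    k.1 * k.1ᴴ = 1 :=
  mem_unitaryGroup_iff.1 (mem_specialUnitaryGroup_iff.1 k.2).1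

/-- A map into `K × B` is smooth if the entries of both matrices are. -/
theorem contMDiff_productMap {E H M : Type*} [NormedAddCommGroup E] [NormedSpace ℝ E]
    [TopologicalSpace H] {I : ModelWithCorners ℝ E H} [TopologicalSpace M] [ChartedSpace H M]
    [IsManifold I ∞ M] {f : M → specialUnitaryGroup (Fin 2) 𝕜 × TraceOneBall 𝕜}
    (h1 : SmoothEntriesOn I (fun m => (f m).1.1) Set.univ)
    (h2 : SmoothEntriesOn I (fun m => (f m).2.1) Set.univ) :
    ContMDiff I (productModel 𝕜) ∞ f :=
  (contMDiff_of_sphere_coe_comp (diffeomorphSphere 𝕜) (f := fun m => (f m).1)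
    (contMDiffOn_univ.1 h1.firstColumn)).prodMk
    (contMDiff_of_coords (f := fun m => (f m).2) (contMDiffOn_univ.1 h2.coords))

theorem smoothEntriesOn_unitary {s : Set (specialUnitaryGroup (Fin 2) 𝕜 × TraceOneBall 𝕜)} :
    SmoothEntriesOn (productModel 𝕜)
      (fun x : specialUnitaryGroup (Fin 2) 𝕜 × TraceOneBall 𝕜 => x.1.1) s := by
  have hc : ContMDiff (productModel 𝕜) 𝓘(ℝ, WithLp 2 (𝕜 × 𝕜)) ∞
      (fun x : specialUnitaryGroup (Fin 2) 𝕜 × TraceOneBall 𝕜 => firstColumn x.1.1) :=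
    (contMDiff_sphere_coe_comp (diffeomorphSphere 𝕜)).comp contMDiff_fst
  have hL := (WithLp.prodContinuousLinearEquiv 2 ℝ 𝕜 𝕜).contDiff (n := ∞)
  have h0 : ContMDiff (productModel 𝕜) 𝓘(ℝ, 𝕜) ∞
      (fun x : specialUnitaryGroup (Fin 2) 𝕜 × TraceOneBall 𝕜 => x.1.1 0 0) :=
    (contDiff_fst.comp hL).contMDiff.comp hc
  have h1 : ContMDiff (productModel 𝕜) 𝓘(ℝ, 𝕜) ∞
      (fun x : specialUnitaryGroup (Fin 2) 𝕜 × TraceOneBall 𝕜 => x.1.1 1 0) :=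
    (contDiff_snd.comp hL).contMDiff.comp hc
  have hs := (RCLike.conjCLE (K := 𝕜)).contDiff (n := ∞)
  intro i j
  refine ContMDiff.contMDiffOn ?_
  fin_cases i <;> fin_cases j
  · exact h0
  · refine (hs.neg.contMDiff.comp h1).congr fun x => ?_
    exact (entries 𝕜 x.1.2).1
  · exact h1
  · refine (hs.contMDiff.comp h0).congr fun x => ?_
    exact (entries 𝕜 x.1.2).2

theorem contMDiff_ball_coords :
    ContMDiff (productModel 𝕜) 𝓘(ℝ, WithLp 2 (ℝ × 𝕜)) ∞
      (fun x : specialUnitaryGroup (Fin 2) 𝕜 × TraceOneBall 𝕜 => coords x.2.1) :=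
  contMDiff_coords.comp contMDiff_snd

theorem smoothEntriesOn_ofCoords {E H M : Type*} [NormedAddCommGroup E] [NormedSpace ℝ E]
    [TopologicalSpace H] {I : ModelWithCorners ℝ E H} [TopologicalSpace M] [ChartedSpace H M]
    {q : M → WithLp 2 (ℝ × 𝕜)} {s : Set M} (hq : ContMDiffOn I 𝓘(ℝ, WithLp 2 (ℝ × 𝕜)) ∞ q s) :
    SmoothEntriesOn I (fun m => ofCoords (q m)) s := by
  have hL := (WithLp.prodContinuousLinearEquiv 2 ℝ ℝ 𝕜).contDiff (n := ∞)
  have h1 : ContDiff ℝ ∞ (fun x : WithLp 2 (ℝ × 𝕜) => x.fst) := contDiff_fst.comp hL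
  have h2 : ContDiff ℝ ∞ (fun x : WithLp 2 (ℝ × 𝕜) => x.snd) := contDiff_snd.comp hL
  have hr := (RCLike.ofRealCLM (K := 𝕜)).contDiff (n := ∞)
  have hs := (RCLike.conjCLE (K := 𝕜)).contDiff (n := ∞)
  have key : ∀ i j, ContDiff ℝ ∞ (fun x : WithLp 2 (ℝ × 𝕜) => ofCoords x i j) := by
    intro i j
    fin_cases i <;> fin_cases j
    · exact hr.comp ((contDiff_const.add h1).div_const 2)
    · exact h2.div_const 2
    · exact (hs.comp h2).div_const 2
    · exact hr.comp ((contDiff_const.sub h1).div_const 2)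
  exact fun i j => (key i j).contMDiff.comp_contMDiffOn hq

theorem smoothEntriesOn_ball {s : Set (specialUnitaryGroup (Fin 2) 𝕜 × TraceOneBall 𝕜)} :
    SmoothEntriesOn (productModel 𝕜)
      (fun x : specialUnitaryGroup (Fin 2) 𝕜 × TraceOneBall 𝕜 => x.2.1) s := by
  intro i j
  refine (smoothEntriesOn_ofCoords (contMDiff_ball_coords (𝕜 := 𝕜)).contMDiffOn i j).congr
    fun x _ => ?_
  exact (congrFun (congrFun (ofCoords_coords x.2.2.1.1 x.2.2.2) i) j).symm

theorem SL2.smoothEntriesOn_coe {s : Set (SpecialLinearGroup (Fin 2) 𝕜)} :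
    SmoothEntriesOn 𝓘(ℝ, 𝕜 × 𝕜 × 𝕜)
      (fun g : SpecialLinearGroup (Fin 2) 𝕜 => (g : Matrix (Fin 2) (Fin 2) 𝕜)) s :=
  fun i j => (SL2.contMDiff_entry i j).contMDiffOn

/-- A map into `SL(2)` is smooth on a set if its entries are. -/
theorem SL2.contMDiffOn_of_entries {E H M : Type*} [NormedAddCommGroup E] [NormedSpace ℝ E]
    [TopologicalSpace H] {I : ModelWithCorners ℝ E H} [TopologicalSpace M] [ChartedSpace H M]
    {f : M → SpecialLinearGroup (Fin 2) 𝕜} {s : Set M}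
    (h : SmoothEntriesOn I (fun x => (f x : Matrix (Fin 2) (Fin 2) 𝕜)) s) :
    ContMDiffOn I 𝓘(ℝ, 𝕜 × 𝕜 × 𝕜) ∞ f s := by
  intro x hx
  rw [contMDiffWithinAt_iff_target]
  constructor
  · exact SL2.continuousOn_of_entries (fun i j => (h i j).continuousOn) x hx
  · have hc : extChartAt 𝓘(ℝ, 𝕜 × 𝕜 × 𝕜) (f x) ∘ f = chartAt (𝕜 × 𝕜 × 𝕜) (f x) ∘ f := by
      ext y <;> simp
    rw [hc]
    rcases chart_mem_atlas (𝕜 × 𝕜 × 𝕜) (f x) with h1 | h1 <;> rw [h1]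
    · exact ((h 0 0).prodMk_space ((h 0 1).prodMk_space (h 1 0))) x hx
    · exact ((h 0 0).prodMk_space ((h 1 0).prodMk_space (h 1 1))) x hx

/-- The polar decomposition `g = k a`, as the map `g ↦ (k, a / Tr a)` into the compactification. -/
noncomputable def polarMap (g : SpecialLinearGroup (Fin 2) 𝕜) :
    specialUnitaryGroup (Fin 2) 𝕜 × TraceOneBall 𝕜 :=
  (⟨polarUnitary g.1, polarUnitary_mem g.2⟩,
    ⟨polarBall g.1, (posDef_polarBall g.1).posSemidef, trace_polarBall g.1⟩)

theorem polarMap_spec (g : SpecialLinearGroup (Fin 2) 𝕜) :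
    ∃ a : Matrix (Fin 2) (Fin 2) 𝕜, a.PosDef ∧
      a * a = (g : Matrix (Fin 2) (Fin 2) 𝕜).conjTranspose * g ∧
      (g : Matrix (Fin 2) (Fin 2) 𝕜) = (polarMap g).1 * a ∧
      ((polarMap g).2 : Matrix (Fin 2) (Fin 2) 𝕜) = a.trace⁻¹ • a := by
  refine ⟨polarTrace g.1 • polarBall g.1, (posDef_polarBall g.1).smul (polarTrace_pos g.1),
    polar_factor_sq g.2, (polarUnitary_mul g.2).symm, ?_⟩
  have h : ((polarTrace g.1 : ℝ) : 𝕜) ≠ 0 := by exact_mod_cast (polarTrace_pos g.1).ne'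
  rw [trace_smul, trace_polarBall, real_smul_eq, RCLike.real_smul_eq_coe_mul, mul_one, smul_smul,
    inv_mul_cancel₀ h, one_smul]
  rfl

/-- In the interior `det b = t⁻²`, as `t b` has determinant one. -/
theorem one_sub_norm_sq_polarMap (g : SpecialLinearGroup (Fin 2) 𝕜) :
    1 - ‖coords (polarMap g).2.1‖ ^ 2 = 4 * ((polarTrace g.1)⁻¹ * (polarTrace g.1)⁻¹) := by
  have h1 := congrArg det (polarUnitary_mul g.2)
  have h2 := (mem_specialUnitaryGroup_iff.1 (polarUnitary_mem g.2)).2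
  rw [det_mul, h2, g.2, one_mul, real_smul_eq, det_smul, Fintype.card_fin] at h1
  have h3 := TraceOneBall.det_eq (polarMap g).2
  change (polarBall g.1).det = _ at h3
  rw [h3] at h1
  have h4 : polarTrace g.1 ^ 2 * ((1 - ‖coords (polarMap g).2.1‖ ^ 2) / 4) = 1 := by
    exact_mod_cast h1
  have ht := (polarTrace_pos g.1).ne'
  field_simp
  linarith

theorem norm_coords_polarMap (g : SpecialLinearGroup (Fin 2) 𝕜) :
    ‖coords (polarMap g).2.1‖ < 1 := by
  have h := one_sub_norm_sq_polarMap g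
  have ht := polarTrace_pos g.1
  have h1 : 0 < 4 * ((polarTrace g.1)⁻¹ * (polarTrace g.1)⁻¹) := by positivity
  nlinarith [norm_nonneg (coords (polarMap g).2.1)]

section SmoothPolar

variable {E H M : Type*} [NormedAddCommGroup E] [NormedSpace ℝ E]
  [TopologicalSpace H] {I : ModelWithCorners ℝ E H} [TopologicalSpace M] [ChartedSpace H M]
  {f : M → Matrix (Fin 2) (Fin 2) 𝕜} {s : Set M}

theorem SmoothEntriesOn.comp_normSqHS (hf : SmoothEntriesOn I f s) {u : ℝ → ℝ}
    (hu : ∀ r, 0 ≤ r → ContDiffAt ℝ ∞ u r) :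
    ContMDiffOn I 𝓘(ℝ, ℝ) ∞ (fun x => u (normSqHS (f x))) s := fun x hx =>
  (hu _ (normSqHS_nonneg (f x))).contMDiffAt.comp_contMDiffWithinAt x
    ((hf.conjTranspose.mul hf).re_trace x hx)

theorem SmoothEntriesOn.polarUnitary (hf : SmoothEntriesOn I f s) :
    SmoothEntriesOn I (fun x => polarUnitary (f x)) s := by
  refine SmoothEntriesOn.smul (hf.comp_normSqHS (u := fun r => (√(r + 2))⁻¹) fun r hr => ?_)
    (hf.add hf.adjugate.conjTranspose)
  have h2 : r + 2 ≠ 0 := by linarith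
  refine ContDiffAt.inv (ContDiffAt.sqrt (by fun_prop) h2) ?_
  exact (Real.sqrt_pos.2 (by linarith)).ne'

theorem SmoothEntriesOn.polarBall (hf : SmoothEntriesOn I f s) :
    SmoothEntriesOn I (fun x => polarBall (f x)) s :=
  SmoothEntriesOn.smul (hf.comp_normSqHS (u := fun r => (r + 2)⁻¹) fun r hr =>
    ContDiffAt.inv (by fun_prop) (by linarith))
    ((hf.conjTranspose.mul hf).add (SmoothEntriesOn.const 1))

end SmoothPolar

theorem contMDiff_polarMap :
    ContMDiff 𝓘(ℝ, 𝕜 × 𝕜 × 𝕜) (productModel 𝕜) ∞ (polarMap (𝕜 := 𝕜)) :=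
  contMDiff_productMap SL2.smoothEntriesOn_coe.polarUnitary SL2.smoothEntriesOn_coe.polarBall

theorem det_polar_product {x : specialUnitaryGroup (Fin 2) 𝕜 × TraceOneBall 𝕜}
    (hx : ‖coords x.2.1‖ < 1) :
    ((2 / √(1 - ‖coords x.2.1‖ ^ 2)) • (x.1.1 * x.2.1)).det = 1 := by
  have h0 : 0 < 1 - ‖coords x.2.1‖ ^ 2 := by nlinarith [norm_nonneg (coords x.2.1)]
  rw [real_smul_eq, det_smul, det_mul, (mem_specialUnitaryGroup_iff.1 x.1.2).2, one_mul,
    TraceOneBall.det_eq, Fintype.card_fin]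
  have h1 : (2 / √(1 - ‖coords x.2.1‖ ^ 2)) ^ 2 * ((1 - ‖coords x.2.1‖ ^ 2) / 4) = 1 := by
    rw [div_pow, Real.sq_sqrt h0.le]
    field_simp
    norm_num
  exact_mod_cast congrArg (fun r : ℝ => (r : 𝕜)) h1

/-- The inverse of the polar map: `(k, b) ↦ k b / √(det b)` on the interior. -/
noncomputable def polarInverse (x : specialUnitaryGroup (Fin 2) 𝕜 × TraceOneBall 𝕜) :
    SpecialLinearGroup (Fin 2) 𝕜 :=
  open Classical in
  if hx : ‖coords x.2.1‖ < 1 then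
    ⟨(2 / √(1 - ‖coords x.2.1‖ ^ 2)) • (x.1.1 * x.2.1), det_polar_product hx⟩
  else 1

theorem coe_polarInverse {x : specialUnitaryGroup (Fin 2) 𝕜 × TraceOneBall 𝕜}
    (hx : ‖coords x.2.1‖ < 1) : (polarInverse x).1 =
      (2 / √(1 - ‖coords x.2.1‖ ^ 2)) • (x.1.1 * x.2.1) := by
  exact congrArg Subtype.val (dif_pos hx)

theorem polarInverse_polarMap (g : SpecialLinearGroup (Fin 2) 𝕜) :
    polarInverse (polarMap g) = g := by
  apply Subtype.ext
  have ht := polarTrace_pos g.1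
  rw [coe_polarInverse (norm_coords_polarMap g), one_sub_norm_sq_polarMap]
  have h1 : √(4 * ((polarTrace g.1)⁻¹ * (polarTrace g.1)⁻¹)) = 2 * (polarTrace g.1)⁻¹ := by
    rw [show 4 * ((polarTrace g.1)⁻¹ * (polarTrace g.1)⁻¹) = (2 * (polarTrace g.1)⁻¹) ^ 2 by ring]
    exact Real.sqrt_sq (by positivity)
  have h2 : 2 / (2 * (polarTrace g.1)⁻¹) = polarTrace g.1 := by field_simp
  rw [h1, h2, ← mul_smul_comm]
  exact polarUnitary_mul g.2

/-- The polar map recovers both factors of a product `k a`. -/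
theorem polar_product {k : specialUnitaryGroup (Fin 2) 𝕜} {b : Matrix (Fin 2) (Fin 2) 𝕜}
    (hb : b.IsHermitian) (htr : b.trace = 1) {t : ℝ} (ht : 0 < t) (hdet : (t • b).det = 1) :
    polarTrace (k.1 * (t • b)) = t ∧ polarUnitary (k.1 * (t • b)) = k.1 ∧
      polarBall (k.1 * (t • b)) = b := by
  have hH : (t • b)ᴴ = t • b := by rw [conjTranspose_smul, hb.eq, star_trivial]
  have htr' : (t • b).trace = (t : 𝕜) := by
    rw [trace_smul, htr, RCLike.real_smul_eq_coe_mul, mul_one]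
  have hsq : (k.1 * (t • b))ᴴ * (k.1 * (t • b)) = t • (t • b) - 1 := by
    rw [conjTranspose_mul, mul_assoc, ← mul_assoc _ k.1, SpecialUnitary.conjTranspose_mul_self,
      one_mul, hH, mul_self_fin_two, htr', hdet, one_smul, real_smul_eq t (t • b)]
  -- by the Cayley–Hamilton theorem `(t b)² = t (t b) - 1`, whose trace is `t² - 2`
  have hN : normSqHS (k.1 * (t • b)) = t ^ 2 - 2 := by
    have h1 : ((normSqHS (k.1 * (t • b)) : ℝ) : 𝕜) = ((t ^ 2 - 2 : ℝ) : 𝕜) := by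
      rw [coe_normSqHS, hsq, trace_sub, trace_smul, htr', trace_one]
      have h4 : (algebraMap ℝ 𝕜) 2 = 2 := map_ofNat _ 2
      simp [RCLike.real_smul_eq_coe_mul, sq, h4]
    exact_mod_cast h1
  have hT : polarTrace (k.1 * (t • b)) = t := by
    rw [polarTrace, hN, sub_add_cancel, Real.sqrt_sq ht.le]
  refine ⟨hT, ?_, ?_⟩
  · rw [polarUnitary, hT, adjugate_mul_distrib, conjTranspose_mul, SpecialUnitary.adjugate_eq,
      conjTranspose_conjTranspose, adjugate_conjTranspose, hH, ← mul_add, adjugate_eq_fin_two,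
      add_sub_cancel, htr', ← real_smul_eq, mul_smul_comm, mul_one, smul_smul,
      inv_mul_cancel₀ ht.ne', one_smul]
  · rw [polarBall, hsq, hN, sub_add_cancel, sub_add_cancel, smul_smul, smul_smul]
    have : (t ^ 2)⁻¹ * (t * t) = 1 := by field_simp
    rw [mul_comm t t] at this
    rw [← mul_assoc] at this
    rw [this, one_smul]

theorem polarMap_polarInverse {x : specialUnitaryGroup (Fin 2) 𝕜 × TraceOneBall 𝕜}
    (hx : ‖coords x.2.1‖ < 1) : polarMap (polarInverse x) = x := by
  have h0 : 0 < 1 - ‖coords x.2.1‖ ^ 2 := by nlinarith [norm_nonneg (coords x.2.1)]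
  have ht : 0 < 2 / √(1 - ‖coords x.2.1‖ ^ 2) := div_pos two_pos (Real.sqrt_pos.2 h0)
  have h1 : (polarInverse x).1 = x.1.1 * ((2 / √(1 - ‖coords x.2.1‖ ^ 2)) • x.2.1) := by
    rw [coe_polarInverse hx, mul_smul_comm]
  have hd : ((2 / √(1 - ‖coords x.2.1‖ ^ 2)) • x.2.1).det = 1 := by
    have := (polarInverse x).2
    rw [h1, det_mul, (mem_specialUnitaryGroup_iff.1 x.1.2).2, one_mul] at this
    exact this
  obtain ⟨-, h2, h3⟩ := polar_product (k := x.1) x.2.2.1.1 x.2.2.2 ht hd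
  rw [← h1] at h2 h3
  exact Prod.ext (Subtype.ext h2) (Subtype.ext h3)

theorem range_polarMap :
    Set.range (polarMap (𝕜 := 𝕜)) =
      (productModel 𝕜).interior (specialUnitaryGroup (Fin 2) 𝕜 × TraceOneBall 𝕜) := by
  ext x
  rw [mem_interior_product_iff]
  constructor
  · rintro ⟨g, rfl⟩
    exact norm_coords_polarMap g
  · exact fun hx => ⟨_, polarMap_polarInverse hx⟩

theorem contMDiffOn_polarInverse :
    ContMDiffOn (productModel 𝕜) 𝓘(ℝ, 𝕜 × 𝕜 × 𝕜) ∞ (polarInverse (𝕜 := 𝕜))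
      ((productModel 𝕜).interior (specialUnitaryGroup (Fin 2) 𝕜 × TraceOneBall 𝕜)) := by
  apply SL2.contMDiffOn_of_entries
  have hs : ContMDiffOn (productModel 𝕜) 𝓘(ℝ, ℝ) ∞
      (fun x : specialUnitaryGroup (Fin 2) 𝕜 × TraceOneBall 𝕜 =>
        2 / √(1 - ‖coords x.2.1‖ ^ 2))
      ((productModel 𝕜).interior (specialUnitaryGroup (Fin 2) 𝕜 × TraceOneBall 𝕜)) := by
    intro x hx
    rw [mem_interior_product_iff] at hx
    have h0 : 0 < 1 - ‖coords x.2.1‖ ^ 2 := by nlinarith [norm_nonneg (coords x.2.1)]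
    have h1 : ContDiffAt ℝ ∞ (fun p : WithLp 2 (ℝ × 𝕜) => 2 / √(1 - ‖p‖ ^ 2)) (coords x.2.1) := by
      refine ContDiffAt.div contDiffAt_const (ContDiffAt.sqrt ?_ h0.ne') (Real.sqrt_pos.2 h0).ne'
      exact (contDiff_const.sub (contDiff_id.norm_sq ℝ)).contDiffAt
    exact h1.contMDiffAt.comp_contMDiffWithinAt (f :=
      fun x : specialUnitaryGroup (Fin 2) 𝕜 × TraceOneBall 𝕜 => coords x.2.1) x
      (contMDiff_ball_coords x).contMDiffWithinAt
  have h := SmoothEntriesOn.smul hs (smoothEntriesOn_unitary.mul smoothEntriesOn_ball)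
  intro i j
  refine (h i j).congr fun x hx => ?_
  rw [mem_interior_product_iff] at hx
  exact congrFun (congrFun (coe_polarInverse hx) i) j

/-- The extension of inversion to the compactification: if `g = k a` then
`g⁻¹ = k⁻¹ (k a⁻¹ k⁻¹)`, and `a⁻¹ = (Tr a) (1 - a / Tr a)` as `det a = 1`. -/
noncomputable def polarInversion (x : specialUnitaryGroup (Fin 2) 𝕜 × TraceOneBall 𝕜) :
    specialUnitaryGroup (Fin 2) 𝕜 × TraceOneBall 𝕜 :=
  (star x.1, ⟨x.1.1 * (1 - x.2.1) * x.1.1ᴴ, by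
    have h1 : (1 - x.2.1 : Matrix (Fin 2) (Fin 2) 𝕜) = ofCoords (-coords x.2.1) := by
      have hb := ofCoords_coords x.2.2.1.1 x.2.2.2
      have : ofCoords (-coords x.2.1) + ofCoords (coords x.2.1) = 1 := by
        generalize coords x.2.1 = p
        have h4 : (algebraMap ℝ 𝕜) 2 = 2 := map_ofNat _ 2
        ext i j
        fin_cases i <;> fin_cases j <;> simp [ofCoords, h4] <;> ring
      rw [hb] at this
      exact (eq_sub_of_add_eq this).symm
    have h2 : (1 - x.2.1).PosSemidef := by
      rw [h1, posSemidef_ofCoords_iff, norm_neg]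
      exact norm_coords_le x.2
    exact h2.mul_mul_conjTranspose_same x.1.1, by
    rw [trace_mul_comm, ← mul_assoc, SpecialUnitary.conjTranspose_mul_self, one_mul, trace_sub,
      trace_one, x.2.2.2]
    norm_num⟩)

theorem polarInversion_involutive : Function.Involutive (polarInversion (𝕜 := 𝕜)) := by
  intro x
  refine Prod.ext (star_star x.1) (Subtype.ext ?_)
  change x.1.1ᴴ * (1 - x.1.1 * (1 - x.2.1) * x.1.1ᴴ) * x.1.1ᴴᴴ = x.2.1
  rw [conjTranspose_conjTranspose, mul_sub, sub_mul, mul_one,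
    SpecialUnitary.conjTranspose_mul_self]
  have : x.1.1ᴴ * (x.1.1 * (1 - x.2.1) * x.1.1ᴴ) * x.1.1 =
      (x.1.1ᴴ * x.1.1) * (1 - x.2.1) * (x.1.1ᴴ * x.1.1) := by simp only [mul_assoc]
  rw [this, SpecialUnitary.conjTranspose_mul_self, one_mul, mul_one, sub_sub_cancel]

theorem contMDiff_polarInversion :
    ContMDiff (productModel 𝕜) (productModel 𝕜) ∞ (polarInversion (𝕜 := 𝕜)) :=
  contMDiff_productMap smoothEntriesOn_unitary.conjTranspose
    ((smoothEntriesOn_unitary.mul ((SmoothEntriesOn.const 1).sub smoothEntriesOn_ball)).mul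
      smoothEntriesOn_unitary.conjTranspose)

theorem polarInversion_polarMap (g : SpecialLinearGroup (Fin 2) 𝕜) :
    polarInversion (polarMap g) = polarMap g⁻¹ := by
  have ht := polarTrace_pos g.1
  have hk := SpecialUnitary.conjTranspose_mul_self (polarMap g).1
  have hdk := (mem_specialUnitaryGroup_iff.1 (polarMap g).1.2).2
  have hm : (polarMap g).1.1 * (polarTrace g.1 • (polarMap g).2.1) = g.1 := polarUnitary_mul g.2
  have hda : (polarTrace g.1 • (polarMap g).2.1).det = 1 := by
    have h1 := congrArg det hm
    rwa [det_mul, hdk, one_mul, g.2] at h1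
  have hadj : polarTrace g.1 • (1 - (polarMap g).2.1) =
      (polarTrace g.1 • (polarMap g).2.1).adjugate := by
    rw [real_smul_eq, real_smul_eq, adjugate_smul, adjugate_eq_fin_two (polarMap g).2.1,
      (polarMap g).2.2.2, one_smul]
    simp
  have he : polarTrace g.1 • (polarInversion (polarMap g)).2.1 =
      (polarMap g).1.1 * (polarTrace g.1 • (polarMap g).2.1).adjugate * (polarMap g).1.1ᴴ := by
    rw [← hadj, mul_smul_comm, smul_mul_assoc]
    rfl
  have hdet : (polarTrace g.1 • (polarInversion (polarMap g)).2.1).det = 1 := by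
    rw [he, det_mul, det_mul, det_conjTranspose, hdk, det_adjugate, hda]
    simp
  have hg : (g⁻¹).1 = (star (polarMap g).1).1 *
      (polarTrace g.1 • (polarInversion (polarMap g)).2.1) := by
    rw [he]
    change _ = (polarMap g).1.1ᴴ * _
    rw [← mul_assoc, ← mul_assoc, hk, one_mul, ← SpecialUnitary.adjugate_eq,
      ← adjugate_mul_distrib, hm]
    exact Matrix.SpecialLinearGroup.coe_inv g
  obtain ⟨-, h2, h3⟩ := polar_product (k := star (polarMap g).1)
    (polarInversion (polarMap g)).2.2.1.1 (polarInversion (polarMap g)).2.2.2 ht hdet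
  rw [← hg] at h2 h3
  exact (Prod.ext (Subtype.ext h2) (Subtype.ext h3)).symm

/-- The extension of inversion as a diffeomorphism. -/
noncomputable def polarInversionDiffeomorph :
    (specialUnitaryGroup (Fin 2) 𝕜 × TraceOneBall 𝕜) ≃ₘ^∞⟮productModel 𝕜, productModel 𝕜⟯
      (specialUnitaryGroup (Fin 2) 𝕜 × TraceOneBall 𝕜) where
  toEquiv := polarInversion_involutive.toPerm
  contMDiff_toFun := contMDiff_polarInversion
  contMDiff_invFun := contMDiff_polarInversion

end PolarMap

/-! ### The derivative of the polar map -/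

section EntryDerivative

open Matrix SpecialUnitary TraceOneBall Module

variable {𝕜 : Type*} [RCLike 𝕜]

/-- The trace-free matrix with entries `a`, `b`, `c`, an element of the Lie algebra of `SL(2)` in
the coordinates of the chart at the identity. -/
def slMatrix (v : 𝕜 × 𝕜 × 𝕜) : Matrix (Fin 2) (Fin 2) 𝕜 :=
  !![v.1, v.2.1; v.2.2, -v.1]

theorem trace_slMatrix (v : 𝕜 × 𝕜 × 𝕜) : (slMatrix v).trace = 0 := by
  simp [slMatrix, trace_fin_two]

/-- The entries of a matrix in `SL(2)`, as a vector of a normed space. -/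
def slEntries (g : SpecialLinearGroup (Fin 2) 𝕜) : Fin 2 → Fin 2 → 𝕜 := g.1

theorem contMDiff_slEntries :
    ContMDiff 𝓘(ℝ, 𝕜 × 𝕜 × 𝕜) 𝓘(ℝ, Fin 2 → Fin 2 → 𝕜) ∞ (slEntries (𝕜 := 𝕜)) := by
  rw [contMDiff_pi_space]
  intro i
  rw [contMDiff_pi_space]
  exact fun j => SL2.contMDiff_entry i j

/-- At the identity, the derivative of the matrix entries identifies the tangent space in the
coordinates `(a, b, c)` with the trace-free matrices. -/
theorem mvfderiv_slEntries_one (v : 𝕜 × 𝕜 × 𝕜) :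
    mvfderiv 𝓘(ℝ, 𝕜 × 𝕜 × 𝕜) (slEntries (𝕜 := 𝕜)) 1 v = slMatrix v := by
  have h1 := (contMDiff_slEntries (𝕜 := 𝕜) 1).mdifferentiableAt (by simp)
  have hc : chartAt (𝕜 × 𝕜 × 𝕜) (1 : SpecialLinearGroup (Fin 2) 𝕜) = SL2.chartTop :=
    if_pos (by simp)
  have h2 : mvfderiv 𝓘(ℝ, 𝕜 × 𝕜 × 𝕜) (slEntries (𝕜 := 𝕜)) 1 =
      fderiv ℝ (fun p => slEntries (SL2.ofTop p)) ((1, 0, 0) : 𝕜 × 𝕜 × 𝕜) := by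
    rw [h1.mvfderiv]
    simp only [modelWithCornersSelf_coe, Set.range_id, fderivWithin_univ]
    have e1 : writtenInExtChartAt 𝓘(ℝ, 𝕜 × 𝕜 × 𝕜) 𝓘(ℝ, Fin 2 → Fin 2 → 𝕜) 1
        (slEntries (𝕜 := 𝕜)) = fun p => slEntries (SL2.ofTop p) := by
      funext p
      simp only [writtenInExtChartAt, extChartAt, hc]
      rfl
    have e2 : extChartAt 𝓘(ℝ, 𝕜 × 𝕜 × 𝕜) (1 : SpecialLinearGroup (Fin 2) 𝕜) 1 =
        ((1, 0, 0) : 𝕜 × 𝕜 × 𝕜) := by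
      simp only [extChartAt, hc]
      change ((1 : Matrix (Fin 2) (Fin 2) 𝕜) 0 0, (1 : Matrix (Fin 2) (Fin 2) 𝕜) 0 1,
        (1 : Matrix (Fin 2) (Fin 2) 𝕜) 1 0) = _
      simp
    rw [e1, e2]
  have hopen : IsOpen {p : 𝕜 × 𝕜 × 𝕜 | p.1 ≠ 0} :=
    isOpen_ne_fun continuous_fst continuous_const
  have hd : DifferentiableAt ℝ (fun p => slEntries (SL2.ofTop p)) ((1, 0, 0) : 𝕜 × 𝕜 × 𝕜) := by
    rw [differentiableAt_pi]
    intro i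
    rw [differentiableAt_pi]
    intro j
    exact ((SL2.contDiffOn_ofTop i j).contDiffAt (hopen.mem_nhds one_ne_zero)).differentiableAt
      (by simp)
  have hline : HasDerivAt (fun s : ℝ => ((1, 0, 0) : 𝕜 × 𝕜 × 𝕜) + s • v) v 0 := by
    simpa using ((hasDerivAt_id (0 : ℝ)).smul_const v).const_add ((1, 0, 0) : 𝕜 × 𝕜 × 𝕜)
  have hd' : HasFDerivAt (fun p => slEntries (SL2.ofTop p))
      (fderiv ℝ (fun p => slEntries (SL2.ofTop p)) ((1, 0, 0) : 𝕜 × 𝕜 × 𝕜))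
      ((fun s : ℝ => ((1, 0, 0) : 𝕜 × 𝕜 × 𝕜) + s • v) 0) := by
    simpa using hd.hasFDerivAt
  have h3 := hd'.comp_hasDerivAt 0 hline
  rw [h2]
  have hlin : HasDerivAt (fun s : ℝ => 1 + s • v.1) v.1 0 := by
    simpa using ((hasDerivAt_id (0 : ℝ)).smul_const v.1).const_add 1
  have hne : ∀ᶠ s : ℝ in nhds 0, 1 + s • v.1 ≠ 0 :=
    hlin.continuousAt.eventually_ne (by simp)
  let c : ℝ → Fin 2 → Fin 2 → 𝕜 := fun s => !![1 + s • v.1, s • v.2.1; s • v.2.2,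
    (1 + (s • v.2.1) * (s • v.2.2)) / (1 + s • v.1)]
  let d : Fin 2 → Fin 2 → 𝕜 := slMatrix v
  have h4 : HasDerivAt c d 0 := by
    have hs : ∀ w : 𝕜, HasDerivAt (fun s : ℝ => s • w) w 0 := fun w => by
      simpa using (hasDerivAt_id (0 : ℝ)).smul_const w
    refine hasDerivAt_pi.2 fun i => hasDerivAt_pi.2 fun j => ?_
    fin_cases i <;> fin_cases j
    · exact hlin
    · exact hs _
    · exact hs _
    · have h5 := (((hs v.2.1).mul (hs v.2.2)).const_add 1).div hlin (by simp)
      refine h5.congr_deriv ?_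
      simp [d, slMatrix]
  refine h3.unique (h4.congr_of_eventuallyEq ?_)
  filter_upwards [hne] with s hs
  have hs' : (((1, 0, 0) : 𝕜 × 𝕜 × 𝕜) + s • v).1 ≠ 0 := hs
  refine (SL2.coe_ofTop hs').trans ?_
  simp [c]

/-- If `φ` is linear in the matrix entries, then so is its derivative at the identity. -/
theorem mvfderiv_slEntries_mfderiv_one
    {φ : SpecialLinearGroup (Fin 2) 𝕜 → SpecialLinearGroup (Fin 2) 𝕜}
    (hφ : ContMDiff 𝓘(ℝ, 𝕜 × 𝕜 × 𝕜) 𝓘(ℝ, 𝕜 × 𝕜 × 𝕜) ∞ φ)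
    (Λ : (Fin 2 → Fin 2 → 𝕜) →ₗ[ℝ] (Fin 2 → Fin 2 → 𝕜))
    (hΛ : ∀ h, slEntries (φ h) = Λ (slEntries h)) {g : SpecialLinearGroup (Fin 2) 𝕜} (hg : φ 1 = g)
    (v : 𝕜 × 𝕜 × 𝕜) :
    mvfderiv 𝓘(ℝ, 𝕜 × 𝕜 × 𝕜) slEntries g
      (mfderiv 𝓘(ℝ, 𝕜 × 𝕜 × 𝕜) 𝓘(ℝ, 𝕜 × 𝕜 × 𝕜) φ 1 v : 𝕜 × 𝕜 × 𝕜) = Λ (slMatrix v) := by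
  subst hg
  have hE := fun g => (contMDiff_slEntries (𝕜 := 𝕜) g).mdifferentiableAt (by simp)
  have h1 := mvfderiv_comp_mfderiv (hE (φ 1)) ((hφ 1).mdifferentiableAt (by simp)) v
  refine h1.symm.trans ?_
  have h2 : slEntries ∘ φ = LinearMap.toContinuousLinearMap Λ ∘ slEntries := funext hΛ
  rw [h2]
  refine (mvfderiv_fderiv_comp (ContinuousLinearMap.differentiableAt _) (hE 1) v).trans ?_
  rw [ContinuousLinearMap.fderiv, mvfderiv_slEntries_one]
  rfl

theorem mvfderiv_slEntries_right
    (v : GroupLieAlgebra 𝓘(ℝ, 𝕜 × 𝕜 × 𝕜) (SpecialLinearGroup (Fin 2) 𝕜))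
    (g : SpecialLinearGroup (Fin 2) 𝕜) :
    mvfderiv 𝓘(ℝ, 𝕜 × 𝕜 × 𝕜) slEntries g
      (rightInvariantVectorField 𝓘(ℝ, 𝕜 × 𝕜 × 𝕜) v g) = slMatrix v * g.1 := by
  let Λ : (Fin 2 → Fin 2 → 𝕜) →ₗ[ℝ] (Fin 2 → Fin 2 → 𝕜) :=
    { toFun := fun m => (of m * g.1 : Matrix (Fin 2) (Fin 2) 𝕜)
      map_add' := fun m m' => Matrix.add_mul (of m) (of m') g.1
      map_smul' := fun c m => smul_mul_assoc c (of m) g.1 }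
  exact mvfderiv_slEntries_mfderiv_one (contMDiff_mul_right (a := g)) Λ
    (fun h => Matrix.SpecialLinearGroup.coe_mul h g) (one_mul g) v

theorem mvfderiv_slEntries_left
    (v : GroupLieAlgebra 𝓘(ℝ, 𝕜 × 𝕜 × 𝕜) (SpecialLinearGroup (Fin 2) 𝕜))
    (g : SpecialLinearGroup (Fin 2) 𝕜) :
    mvfderiv 𝓘(ℝ, 𝕜 × 𝕜 × 𝕜) slEntries g
      (mulInvariantVectorField (I := 𝓘(ℝ, 𝕜 × 𝕜 × 𝕜)) v g) = g.1 * slMatrix v := by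
  let Λ : (Fin 2 → Fin 2 → 𝕜) →ₗ[ℝ] (Fin 2 → Fin 2 → 𝕜) :=
    { toFun := fun m => (g.1 * of m : Matrix (Fin 2) (Fin 2) 𝕜)
      map_add' := fun m m' => Matrix.mul_add g.1 (of m) (of m')
      map_smul' := fun c m => mul_smul_comm c g.1 (of m) }
  exact mvfderiv_slEntries_mfderiv_one (contMDiff_mul_left (a := g)) Λ
    (fun h => Matrix.SpecialLinearGroup.coe_mul g h) (mul_one g) v

theorem firstColumn_add_smul (a b : Matrix (Fin 2) (Fin 2) 𝕜) (s : ℝ) :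
    firstColumn (a + s • b) = firstColumn a + s • firstColumn b := rfl

theorem coords_add_smul (a b : Matrix (Fin 2) (Fin 2) 𝕜) (s : ℝ) :
    coords (a + s • b) = coords a + s • coords b := by
  apply WithLp.ofLp_injective 2
  refine Prod.ext ?_ ?_
  · simp [coords, RCLike.smul_re]; ring
  · simp [coords, RCLike.real_smul_eq_coe_mul]; ring

theorem coords_smul (c : ℝ) (y : Matrix (Fin 2) (Fin 2) 𝕜) : coords (c • y) = c • coords y := by
  have h := coords_add_smul 0 y c
  have h0 : coords (0 : Matrix (Fin 2) (Fin 2) 𝕜) = 0 := by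
    apply WithLp.ofLp_injective 2
    simp [coords]
  rwa [zero_add, h0, zero_add] at h

theorem coords_add (a b : Matrix (Fin 2) (Fin 2) 𝕜) : coords (a + b) = coords a + coords b := by
  simpa using coords_add_smul a b 1

theorem normSqHS_add_smul (a b : Matrix (Fin 2) (Fin 2) 𝕜) (s : ℝ) :
    normSqHS (a + s • b) =
      normSqHS a + s * (2 * RCLike.re (aᴴ * b).trace) + s ^ 2 * normSqHS b := by
  have h1 : RCLike.re (bᴴ * a).trace = RCLike.re (aᴴ * b).trace := by
    have : (bᴴ * a).trace = star (aᴴ * b).trace := by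
      rw [← trace_conjTranspose, conjTranspose_mul, conjTranspose_conjTranspose]
    rw [this, RCLike.star_def, RCLike.conj_re]
  simp only [normSqHS, conjTranspose_add, conjTranspose_smul, star_trivial, add_mul, mul_add,
    smul_mul_assoc, mul_smul_comm, trace_add, trace_smul, map_add, RCLike.smul_re, h1]
  ring

theorem hasDerivAt_normSqHS (a b : Matrix (Fin 2) (Fin 2) 𝕜) :
    HasDerivAt (fun s : ℝ => normSqHS (a + s • b)) (2 * RCLike.re (aᴴ * b).trace) 0 := by
  simp only [normSqHS_add_smul]
  have h1 := ((hasDerivAt_id (0 : ℝ)).mul_const (2 * RCLike.re (aᴴ * b).trace)).const_add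
    (normSqHS a)
  have h2 := h1.add ((hasDerivAt_pow 2 (0 : ℝ)).mul_const (normSqHS b))
  simpa using! h2

/-- The derivative of a function of the matrix entries along a tangent vector of `SL(2)` may be
computed along an affine line in the space of matrices. -/
theorem mvfderiv_line {W : Type*} [NormedAddCommGroup W] [NormedSpace ℝ W]
    {F : Matrix (Fin 2) (Fin 2) 𝕜 → W}
    (hF : ContMDiff 𝓘(ℝ, Fin 2 → Fin 2 → 𝕜) 𝓘(ℝ, W) ∞ (fun m : Fin 2 → Fin 2 → 𝕜 => F (of m)))
    {g : SpecialLinearGroup (Fin 2) 𝕜} {ξ : TangentSpace 𝓘(ℝ, 𝕜 × 𝕜 × 𝕜) g}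
    {m : Matrix (Fin 2) (Fin 2) 𝕜} (hξ : mvfderiv 𝓘(ℝ, 𝕜 × 𝕜 × 𝕜) slEntries g ξ = m) {w : W}
    (hw : HasDerivAt (fun s : ℝ => F (g.1 + s • m)) w 0) :
    mvfderiv 𝓘(ℝ, 𝕜 × 𝕜 × 𝕜) (fun g : SpecialLinearGroup (Fin 2) 𝕜 => F g.1) g ξ = w := by
  have hd : DifferentiableAt ℝ (fun m : Fin 2 → Fin 2 → 𝕜 => F (of m)) (slEntries g) :=
    (contMDiff_iff_contDiff.1 hF).contDiffAt.differentiableAt (by simp)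
  have h1 := mvfderiv_fderiv_comp (f := slEntries (𝕜 := 𝕜)) (x := g)
    (g := fun m : Fin 2 → Fin 2 → 𝕜 => F (of m)) hd
    ((contMDiff_slEntries g).mdifferentiableAt (by simp)) ξ
  refine h1.trans ?_
  rw [hξ]
  let m' : Fin 2 → Fin 2 → 𝕜 := m
  have hline : HasDerivAt (fun s : ℝ => slEntries g + s • m') m' 0 := by
    simpa using ((hasDerivAt_id (0 : ℝ)).smul_const m').const_add (slEntries g)
  have hd' : HasFDerivAt (fun m : Fin 2 → Fin 2 → 𝕜 => F (of m))
      (fderiv ℝ (fun m : Fin 2 → Fin 2 → 𝕜 => F (of m)) (slEntries g))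
      ((fun s : ℝ => slEntries g + s • m') 0) := by
    simpa using hd.hasFDerivAt
  exact (hd'.comp_hasDerivAt 0 hline).unique hw

theorem smoothEntriesOn_of :
    SmoothEntriesOn 𝓘(ℝ, Fin 2 → Fin 2 → 𝕜)
      (fun m : Fin 2 → Fin 2 → 𝕜 => (of m : Matrix (Fin 2) (Fin 2) 𝕜)) Set.univ := by
  intro i j
  have : ContDiff ℝ ∞ (fun m : Fin 2 → Fin 2 → 𝕜 => m i j) := by fun_prop
  exact this.contMDiff.contMDiffOn

/-- The derivative of the unitary factor `t⁻¹ (g + (adj g)*)` in the direction of the matrix `m`;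
the second term comes from the derivative of `t⁻¹`. -/
theorem mvfderiv_polarMap_unitary {g : SpecialLinearGroup (Fin 2) 𝕜}
    {ξ : TangentSpace 𝓘(ℝ, 𝕜 × 𝕜 × 𝕜) g} {m : Matrix (Fin 2) (Fin 2) 𝕜}
    (hξ : mvfderiv 𝓘(ℝ, 𝕜 × 𝕜 × 𝕜) slEntries g ξ = m) :
    mvfderiv 𝓘(ℝ, 𝕜 × 𝕜 × 𝕜) (fun g : SpecialLinearGroup (Fin 2) 𝕜 =>
      firstColumn (polarMap g).1.1) g ξ =
      firstColumn ((polarTrace g.1)⁻¹ • (m + m.adjugateᴴ) -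
        (RCLike.re (g.1ᴴ * m).trace * ((polarTrace g.1)⁻¹) ^ 2) • polarUnitary g.1) := by
  refine mvfderiv_line (F := fun m => firstColumn (polarUnitary m))
    (contMDiffOn_univ.1 smoothEntriesOn_of.polarUnitary.firstColumn) hξ ?_
  have ht := polarTrace_pos g.1
  have h1 : HasDerivAt (fun s : ℝ => (polarTrace (g.1 + s • m))⁻¹)
      (-(RCLike.re (g.1ᴴ * m).trace * ((polarTrace g.1)⁻¹) ^ 3)) 0 := by
    have h2 := ((hasDerivAt_normSqHS g.1 m).add_const 2).sqrt
      (by simpa using (by linarith [normSqHS_nonneg g.1] : normSqHS g.1 + 2 ≠ 0))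
    have h3 := h2.fun_inv (by simpa [polarTrace] using ht.ne')
    refine h3.congr_deriv ?_
    simp only [zero_smul, add_zero]
    change -(2 * RCLike.re (g.1ᴴ * m).trace / (2 * polarTrace g.1)) / (polarTrace g.1) ^ 2 = _
    field_simp
  have h4 : ∀ s : ℝ, firstColumn (polarUnitary (g.1 + s • m)) =
      (polarTrace (g.1 + s • m))⁻¹ •
        (firstColumn (g.1 + g.1.adjugateᴴ) + s • firstColumn (m + m.adjugateᴴ)) := by
    intro s
    have h5 : g.1 + s • m + (g.1 + s • m).adjugateᴴ =
        (g.1 + g.1.adjugateᴴ) + s • (m + m.adjugateᴴ) := by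
      have : (g.1 + s • m).adjugate = g.1.adjugate + s • m.adjugate := by
        ext i j
        fin_cases i <;> fin_cases j <;> simp [adjugate_fin_two, add_comm]
      rw [this, conjTranspose_add, conjTranspose_smul, star_trivial]
      module
    rw [polarUnitary, h5, ← firstColumn_add_smul]
    rfl
  simp only [h4]
  have h6 : HasDerivAt (fun s : ℝ => firstColumn (g.1 + g.1.adjugateᴴ) +
      s • firstColumn (m + m.adjugateᴴ)) (firstColumn (m + m.adjugateᴴ)) 0 := by
    simpa using ((hasDerivAt_id (0 : ℝ)).smul_const (firstColumn (m + m.adjugateᴴ))).const_add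
      (firstColumn (g.1 + g.1.adjugateᴴ))
  refine (h1.smul h6).congr_deriv ?_
  simp only [zero_smul, add_zero]
  rw [sub_eq_add_neg, ← neg_smul, firstColumn_add_smul, polarUnitary]
  change _ = (polarTrace g.1)⁻¹ • firstColumn (m + m.adjugateᴴ) + _ •
    (polarTrace g.1)⁻¹ • firstColumn (g.1 + g.1.adjugateᴴ)
  rw [smul_smul]
  congr 2
  ring

/-- The derivative of the ball component `t⁻² (g* g + 1)` in the direction of the matrix `m`. -/
theorem mvfderiv_polarMap_ball {g : SpecialLinearGroup (Fin 2) 𝕜}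
    {ξ : TangentSpace 𝓘(ℝ, 𝕜 × 𝕜 × 𝕜) g} {m : Matrix (Fin 2) (Fin 2) 𝕜}
    (hξ : mvfderiv 𝓘(ℝ, 𝕜 × 𝕜 × 𝕜) slEntries g ξ = m) :
    mvfderiv 𝓘(ℝ, 𝕜 × 𝕜 × 𝕜) (fun g : SpecialLinearGroup (Fin 2) 𝕜 =>
      coords (polarMap g).2.1) g ξ =
      coords (((polarTrace g.1)⁻¹) ^ 2 • (g.1ᴴ * m + mᴴ * g.1) -
        (2 * RCLike.re (g.1ᴴ * m).trace * ((polarTrace g.1)⁻¹) ^ 2) • polarBall g.1) := by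
  refine mvfderiv_line (F := fun m => coords (polarBall m))
    (contMDiffOn_univ.1 smoothEntriesOn_of.polarBall.coords) hξ ?_
  have ht := polarTrace_pos g.1
  have hN : normSqHS g.1 + 2 ≠ 0 := by linarith [normSqHS_nonneg g.1]
  have h1 : HasDerivAt (fun s : ℝ => (normSqHS (g.1 + s • m) + 2)⁻¹)
      (-(2 * RCLike.re (g.1ᴴ * m).trace) * ((polarTrace g.1)⁻¹) ^ 4) 0 := by
    have h3 := ((hasDerivAt_normSqHS g.1 m).add_const 2).fun_inv (by simpa using hN)
    refine h3.congr_deriv ?_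
    simp only [zero_smul, add_zero]
    rw [← polarTrace_sq]
    field_simp
  have h4 : ∀ s : ℝ, coords (polarBall (g.1 + s • m)) =
      (normSqHS (g.1 + s • m) + 2)⁻¹ •
        (coords (g.1ᴴ * g.1 + 1) + s • coords (g.1ᴴ * m + mᴴ * g.1) +
          (s ^ 2) • coords (mᴴ * m)) := by
    intro s
    have h5 : (g.1 + s • m)ᴴ * (g.1 + s • m) + 1 =
        (g.1ᴴ * g.1 + 1) + s • (g.1ᴴ * m + mᴴ * g.1) + (s ^ 2) • (mᴴ * m) := by
      simp only [conjTranspose_add, conjTranspose_smul, star_trivial, add_mul, mul_add,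
        smul_mul_assoc, mul_smul_comm]
      module
    rw [polarBall, h5, coords_smul, coords_add_smul, coords_add_smul]
  simp only [h4]
  have h6 : HasDerivAt (fun s : ℝ => coords (g.1ᴴ * g.1 + 1) +
      s • coords (g.1ᴴ * m + mᴴ * g.1) + (s ^ 2) • coords (mᴴ * m))
      (coords (g.1ᴴ * m + mᴴ * g.1)) 0 := by
    have h7 := (((hasDerivAt_id (0 : ℝ)).smul_const (coords (g.1ᴴ * m + mᴴ * g.1))).const_add
      (coords (g.1ᴴ * g.1 + 1))).add ((hasDerivAt_pow 2 (0 : ℝ)).smul_const (coords (mᴴ * m)))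
    simpa using! h7
  refine (h1.smul h6).congr_deriv ?_
  rw [sub_eq_add_neg, ← neg_smul, coords_add_smul, coords_smul, polarBall, coords_smul, ← polarTrace_sq]
  simp only [zero_smul, add_zero, smul_smul, ne_eq, OfNat.ofNat_ne_zero, not_false_eq_true,
    zero_pow]
  rw [← polarTrace_sq]
  congr 2
  · rw [inv_pow]
  · field_simp

end EntryDerivative

/-! ### Hermitian and anti-Hermitian parts -/

section HermitianPart

open Matrix

variable {𝕜 : Type*} [RCLike 𝕜]

/-- The Hermitian part of a matrix. -/
noncomputable def hermPart (w : Matrix (Fin 2) (Fin 2) 𝕜) : Matrix (Fin 2) (Fin 2) 𝕜 :=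
  (1 / 2 : ℝ) • (w + wᴴ)

/-- The anti-Hermitian part of a matrix. -/
noncomputable def skewPart (w : Matrix (Fin 2) (Fin 2) 𝕜) : Matrix (Fin 2) (Fin 2) 𝕜 :=
  (1 / 2 : ℝ) • (w - wᴴ)

variable {w b : Matrix (Fin 2) (Fin 2) 𝕜}

theorem hermPart_add_skewPart (w : Matrix (Fin 2) (Fin 2) 𝕜) : hermPart w + skewPart w = w := by
  rw [hermPart, skewPart]; module

theorem hermPart_sub_skewPart (w : Matrix (Fin 2) (Fin 2) 𝕜) : hermPart w - skewPart w = wᴴ := by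
  rw [hermPart, skewPart]; module

theorem conjTranspose_hermPart (w : Matrix (Fin 2) (Fin 2) 𝕜) : (hermPart w)ᴴ = hermPart w := by
  rw [hermPart, conjTranspose_smul, conjTranspose_add, conjTranspose_conjTranspose, star_trivial,
    add_comm]

theorem conjTranspose_skewPart (w : Matrix (Fin 2) (Fin 2) 𝕜) :
    (skewPart w)ᴴ = -skewPart w := by
  rw [skewPart, conjTranspose_smul, conjTranspose_sub, conjTranspose_conjTranspose, star_trivial]
  module

theorem trace_hermPart (hw : w.trace = 0) : (hermPart w).trace = 0 := by
  rw [hermPart, trace_smul, trace_add, trace_conjTranspose, hw]; simp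

theorem trace_hermPart_mul (hb : bᴴ = b) :
    (hermPart w * b).trace = ((RCLike.re (w * b).trace : ℝ) : 𝕜) := by
  have h1 : (wᴴ * b).trace = star (w * b).trace := by
    rw [← trace_conjTranspose, conjTranspose_mul, hb, trace_mul_comm]
  rw [hermPart, smul_mul_assoc, trace_smul, add_mul, trace_add, h1, RCLike.star_def,
    RCLike.add_conj, RCLike.real_smul_eq_coe_mul]
  push_cast
  ring

theorem hermPart_anticommutator (hw : w.trace = 0) (hb : bᴴ = b) (ht : b.trace = 1) :
    hermPart w * (b + b - 1) + (b + b - 1) * hermPart w = (2 * RCLike.re (w * b).trace) •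
      (1 : Matrix (Fin 2) (Fin 2) 𝕜) := by
  rw [anticommutator_fin_two (trace_hermPart hw) ht, trace_hermPart_mul hb, real_smul_eq]
  congr 1
  push_cast
  simp

/-- The derivative of the unitary factor along a right-invariant field, simplified: the scalar
part of `w b - w* (1 - b)` is removed by the normalization. -/
theorem mul_sub_conjTranspose_mul (hw : w.trace = 0) (hb : bᴴ = b) (ht : b.trace = 1) :
    w * b - wᴴ * (1 - b) - RCLike.re (w * b).trace • (1 : Matrix (Fin 2) (Fin 2) 𝕜) =
      skewPart w + (1 / 2 : ℝ) • (hermPart w * (b + b - 1) - (b + b - 1) * hermPart w) := by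
  have h1 := hermPart_anticommutator hw hb ht
  have h2 : RCLike.re (w * b).trace • (1 : Matrix (Fin 2) (Fin 2) 𝕜) =
      (1 / 2 : ℝ) • (hermPart w * (b + b - 1) + (b + b - 1) * hermPart w) := by
    rw [h1, smul_smul]; congr 1; ring
  have h3 : w * b - wᴴ * (1 - b) = hermPart w * (b + b - 1) + skewPart w := by
    rw [← hermPart_sub_skewPart w]
    nth_rewrite 1 [← hermPart_add_skewPart w]
    simp only [add_mul, sub_mul, mul_add, mul_sub, mul_one]
    abel
  rw [h2, h3]
  module

/-- The derivative of the unitary factor along a left-invariant field, simplified. -/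
theorem mul_sub_mul_conjTranspose (hw : w.trace = 0) (hb : bᴴ = b) (ht : b.trace = 1) :
    b * w - (1 - b) * wᴴ - RCLike.re (b * w).trace • (1 : Matrix (Fin 2) (Fin 2) 𝕜) =
      skewPart w + (1 / 2 : ℝ) • ((b + b - 1) * hermPart w - hermPart w * (b + b - 1)) := by
  have h1 := hermPart_anticommutator hw hb ht
  have h2 : RCLike.re (b * w).trace • (1 : Matrix (Fin 2) (Fin 2) 𝕜) =
      (1 / 2 : ℝ) • (hermPart w * (b + b - 1) + (b + b - 1) * hermPart w) := by
    rw [h1, smul_smul, trace_mul_comm]; congr 1; ring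
  have h3 : b * w - (1 - b) * wᴴ = (b + b - 1) * hermPart w + skewPart w := by
    rw [← hermPart_sub_skewPart w]
    nth_rewrite 1 [← hermPart_add_skewPart w]
    simp only [add_mul, sub_mul, mul_add, mul_sub, one_mul]
    abel
  rw [h2, h3]
  module

/-- The derivative of the ball component along a right-invariant field is a multiple of `det b`. -/
theorem mul_hermPart_mul (hw : w.trace = 0) (hb : bᴴ = b) (ht : b.trace = 1) {d : ℝ}
    (hd : b.det = (d : 𝕜)) :
    b * hermPart w * b - RCLike.re (w * b).trace • b = d • hermPart w := by
  have h1 := hermPart_anticommutator hw hb ht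
  have hbb : b * b = b - d • 1 := by rw [mul_self_fin_two, ht, hd, one_smul, real_smul_eq]
  have h2 := congrArg (fun m => (1 / 2 : ℝ) • (b * m)) h1
  simp only [mul_add, mul_sub, add_mul, sub_mul, mul_one, one_mul, mul_smul_comm,
    ← mul_assoc, hbb, smul_mul_assoc] at h2
  have h3 : b * hermPart w * b = (1 / 2 : ℝ) • (2 * RCLike.re (w * b).trace) • b +
      d • hermPart w := by
    rw [← h2]; module
  rw [h3]
  module

end HermitianPart

/-! ### The lifts of the invariant vector fields -/

section ExplicitFields

open Matrix SpecialUnitary TraceOneBall Module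
open scoped RealInnerProductSpace

variable {𝕜 : Type*} [RCLike 𝕜]

theorem inner_firstColumn (m n : Matrix (Fin 2) (Fin 2) 𝕜) :
    ⟪firstColumn m, firstColumn n⟫ = RCLike.re ((mᴴ * n) 0 0) := by
  rw [WithLp.prod_inner_apply, mul_apply, Fin.sum_univ_two, map_add]
  simp only [conjTranspose_apply, firstColumn]
  simp only [real_inner_eq_re_inner 𝕜, RCLike.inner_apply, RCLike.star_def, mul_comm]

/-- `k κ` with `κ` anti-Hermitian is tangent to the group at `k`. -/
theorem inner_firstColumn_mul (k : specialUnitaryGroup (Fin 2) 𝕜) {κ : Matrix (Fin 2) (Fin 2) 𝕜}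
    (hκ : κᴴ = -κ) : ⟪firstColumn k.1, firstColumn (k.1 * κ)⟫ = 0 := by
  rw [inner_firstColumn, ← mul_assoc, SpecialUnitary.conjTranspose_mul_self, one_mul]
  have h := congrArg RCLike.re (congrFun (congrFun hκ 0) 0)
  simp at h
  linarith

variable (x : specialUnitaryGroup (Fin 2) 𝕜 × TraceOneBall 𝕜) (V : Matrix (Fin 2) (Fin 2) 𝕜)

/-- The `SU(2)`-component of the lift of the right-invariant vector field `g ↦ V g`. With
`w = k* V k` it is `k` times the anti-Hermitian matrix
`skewPart w + ½ [hermPart w, 2 b - 1]`. -/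
noncomputable def rightColumn : Matrix (Fin 2) (Fin 2) 𝕜 :=
  x.1.1 * (skewPart (x.1.1ᴴ * V * x.1.1) + (1 / 2 : ℝ) •
    (hermPart (x.1.1ᴴ * V * x.1.1) * (x.2.1 + x.2.1 - 1) -
      (x.2.1 + x.2.1 - 1) * hermPart (x.1.1ᴴ * V * x.1.1)))

/-- The ball component of the lift of the right-invariant vector field `g ↦ V g`; the factor in
front vanishes on the boundary. -/
noncomputable def rightBall : Matrix (Fin 2) (Fin 2) 𝕜 :=
  ((1 - ‖coords x.2.1‖ ^ 2) / 2) • hermPart (x.1.1ᴴ * V * x.1.1)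

/-- The `SU(2)`-component of the lift of the left-invariant vector field `g ↦ g V`. -/
noncomputable def leftColumn : Matrix (Fin 2) (Fin 2) 𝕜 :=
  x.1.1 * (skewPart V + (1 / 2 : ℝ) •
    ((x.2.1 + x.2.1 - 1) * hermPart V - hermPart V * (x.2.1 + x.2.1 - 1)))

/-- The ball component of the lift of the left-invariant vector field `g ↦ g V`. -/
noncomputable def leftBall : Matrix (Fin 2) (Fin 2) 𝕜 :=
  x.2.1 * V + Vᴴ * x.2.1 - ((1 - ‖coords x.2.1‖ ^ 2) / 4) • (V + Vᴴ) -
    (2 * RCLike.re (x.2.1 * V).trace) • x.2.1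

variable {V}

theorem conjTranspose_two_mul_sub_one (b : TraceOneBall 𝕜) :
    (b.1 + b.1 - 1)ᴴ = b.1 + b.1 - 1 := by
  rw [conjTranspose_sub, conjTranspose_add, b.2.1.1.eq, conjTranspose_one]

theorem conjTranspose_commutator {h p : Matrix (Fin 2) (Fin 2) 𝕜} (hh : hᴴ = h) (hp : pᴴ = p) :
    (h * p - p * h)ᴴ = -(h * p - p * h) := by
  rw [conjTranspose_sub, conjTranspose_mul, conjTranspose_mul, hh, hp, neg_sub]

theorem inner_rightColumn (V : Matrix (Fin 2) (Fin 2) 𝕜) :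
    ⟪firstColumn x.1.1, firstColumn (rightColumn x V)⟫ = 0 := by
  refine inner_firstColumn_mul x.1 ?_
  rw [conjTranspose_add, conjTranspose_skewPart, conjTranspose_smul, conjTranspose_commutator
    (conjTranspose_hermPart _) (conjTranspose_two_mul_sub_one _), star_trivial]
  module

theorem inner_leftColumn (V : Matrix (Fin 2) (Fin 2) 𝕜) :
    ⟪firstColumn x.1.1, firstColumn (leftColumn x V)⟫ = 0 := by
  refine inner_firstColumn_mul x.1 ?_
  rw [conjTranspose_add, conjTranspose_skewPart, conjTranspose_smul, conjTranspose_commutator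
    (conjTranspose_two_mul_sub_one _) (conjTranspose_hermPart _), star_trivial]
  module

end ExplicitFields

section Lifts

open Matrix SpecialUnitary TraceOneBall Module

variable {𝕜 : Type*} [RCLike 𝕜] {V : Matrix (Fin 2) (Fin 2) 𝕜}
  (g : SpecialLinearGroup (Fin 2) 𝕜)

theorem polarMap_mul : (polarMap g).1.1 * (polarTrace g.1 • (polarMap g).2.1) = g.1 :=
  polarUnitary_mul g.2

theorem conjTranspose_adjugate_polarMap :
    g.1.adjugateᴴ = polarTrace g.1 • ((polarMap g).1.1 * (1 - (polarMap g).2.1)) := by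
  have hb : ((polarMap g).2.1)ᴴ = (polarMap g).2.1 := (polarMap g).2.2.1.1.eq
  have h : g.1.adjugateᴴ =
      ((polarMap g).1.1 * (polarTrace g.1 • (polarMap g).2.1)).adjugateᴴ := by
    rw [polarMap_mul g]
  rw [h, adjugate_mul_distrib, SpecialUnitary.adjugate_eq, conjTranspose_mul,
    conjTranspose_conjTranspose, real_smul_eq (polarTrace g.1), adjugate_smul, adjugate_eq_fin_two,
    (polarMap g).2.2.2, one_smul, Fintype.card_fin, pow_one, ← real_smul_eq, conjTranspose_smul,
    conjTranspose_sub, hb, conjTranspose_one, star_trivial, mul_smul_comm]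

/-- The square of a point of the ball, by the Cayley–Hamilton theorem. -/
theorem ball_mul_self (b : TraceOneBall 𝕜) :
    b.1 * b.1 = b.1 - ((1 - ‖coords b.1‖ ^ 2) / 4) • (1 : Matrix (Fin 2) (Fin 2) 𝕜) := by
  rw [mul_self_fin_two, b.2.2, one_smul, TraceOneBall.det_eq, real_smul_eq]

theorem re_trace_ball_mul_mul {w : Matrix (Fin 2) (Fin 2) 𝕜} (hw : w.trace = 0)
    (b : TraceOneBall 𝕜) : RCLike.re (b.1 * b.1 * w).trace = RCLike.re (b.1 * w).trace := by
  rw [ball_mul_self, sub_mul, smul_mul_assoc, one_mul, trace_sub, trace_smul, hw, smul_zero,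
    sub_zero]

theorem adjugate_of_trace_eq_zero {w : Matrix (Fin 2) (Fin 2) 𝕜} (hw : w.trace = 0) :
    w.adjugate = -w := by
  rw [adjugate_eq_fin_two, hw, zero_smul, zero_sub]

theorem trace_conj (k : specialUnitaryGroup (Fin 2) 𝕜) (hV : V.trace = 0) :
    (k.1ᴴ * V * k.1).trace = 0 := by
  rw [trace_mul_comm, ← mul_assoc, SpecialUnitary.mul_conjTranspose_self, one_mul, hV]

theorem conjTranspose_mul_right_polarMap :
    g.1ᴴ * (V * g.1) = (polarTrace g.1) ^ 2 • ((polarMap g).2.1 *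
      ((polarMap g).1.1ᴴ * V * (polarMap g).1.1) * (polarMap g).2.1) := by
  have hb : ((polarMap g).2.1)ᴴ = (polarMap g).2.1 := (polarMap g).2.2.1.1.eq
  have h : g.1ᴴ * (V * g.1) = ((polarMap g).1.1 * (polarTrace g.1 • (polarMap g).2.1))ᴴ *
      (V * ((polarMap g).1.1 * (polarTrace g.1 • (polarMap g).2.1))) := by rw [polarMap_mul g]
  rw [h, conjTranspose_mul, conjTranspose_smul, hb, star_trivial]
  simp only [mul_smul_comm, smul_mul_assoc, smul_smul, mul_assoc, sq]

theorem conjTranspose_mul_left_polarMap :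
    g.1ᴴ * (g.1 * V) =
      (polarTrace g.1) ^ 2 • ((polarMap g).2.1 * (polarMap g).2.1 * V) := by
  have hb : ((polarMap g).2.1)ᴴ = (polarMap g).2.1 := (polarMap g).2.2.1.1.eq
  have h : g.1ᴴ * (g.1 * V) = ((polarMap g).1.1 * (polarTrace g.1 • (polarMap g).2.1))ᴴ *
      ((polarMap g).1.1 * (polarTrace g.1 • (polarMap g).2.1) * V) := by rw [polarMap_mul g]
  rw [h, conjTranspose_mul, conjTranspose_smul, hb, star_trivial, mul_assoc (polarMap g).1.1,
    ← mul_assoc _ (polarMap g).1.1, mul_assoc _ _ (polarMap g).1.1,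
    SpecialUnitary.conjTranspose_mul_self, mul_one]
  simp only [smul_mul_assoc, mul_smul_comm, smul_smul, mul_assoc, sq]

theorem re_trace_right_polarMap (hV : V.trace = 0) :
    RCLike.re (g.1ᴴ * (V * g.1)).trace = polarTrace g.1 ^ 2 *
      RCLike.re ((polarMap g).1.1ᴴ * V * (polarMap g).1.1 * (polarMap g).2.1).trace := by
  rw [conjTranspose_mul_right_polarMap, trace_smul, RCLike.smul_re, trace_mul_comm, ← mul_assoc,
    re_trace_ball_mul_mul (trace_conj (polarMap g).1 hV), trace_mul_comm]

theorem re_trace_left_polarMap (hV : V.trace = 0) :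
    RCLike.re (g.1ᴴ * (g.1 * V)).trace = polarTrace g.1 ^ 2 *
      RCLike.re ((polarMap g).2.1 * V).trace := by
  rw [conjTranspose_mul_left_polarMap, trace_smul, RCLike.smul_re, re_trace_ball_mul_mul hV]

theorem rightColumn_polarMap (hV : V.trace = 0) :
    rightColumn (polarMap g) V = (polarTrace g.1)⁻¹ • (V * g.1 + (V * g.1).adjugateᴴ) -
      (RCLike.re (g.1ᴴ * (V * g.1)).trace * ((polarTrace g.1)⁻¹) ^ 2) • polarUnitary g.1 := by
  have ht := (polarTrace_pos g.1).ne'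
  have hb : ((polarMap g).2.1)ᴴ = (polarMap g).2.1 := (polarMap g).2.2.1.1.eq
  have hw := trace_conj (polarMap g).1 hV
  have hk := SpecialUnitary.mul_conjTranspose_self (polarMap g).1
  have e1 : (V * g.1).adjugateᴴ =
      -(polarTrace g.1 • (Vᴴ * (polarMap g).1.1 * (1 - (polarMap g).2.1))) := by
    rw [adjugate_mul_distrib, conjTranspose_mul, conjTranspose_adjugate_polarMap,
      adjugate_of_trace_eq_zero hV, conjTranspose_neg, neg_mul, mul_smul_comm, mul_assoc]
  have e2 : V * g.1 = polarTrace g.1 • (V * (polarMap g).1.1 * (polarMap g).2.1) := by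
    have h : V * g.1 = V * ((polarMap g).1.1 * (polarTrace g.1 • (polarMap g).2.1)) := by
      rw [polarMap_mul g]
    rw [h, mul_smul_comm, mul_smul_comm, mul_assoc]
  have e3 := re_trace_right_polarMap g hV
  have e4 : ∀ U : Matrix (Fin 2) (Fin 2) 𝕜, (polarMap g).1.1 *
      ((polarMap g).1.1ᴴ * U * (polarMap g).1.1) = U * (polarMap g).1.1 := fun U => by
    rw [← mul_assoc, ← mul_assoc, hk, one_mul]
  have e5 : ((polarMap g).1.1ᴴ * V * (polarMap g).1.1)ᴴ =
      (polarMap g).1.1ᴴ * Vᴴ * (polarMap g).1.1 := by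
    rw [conjTranspose_mul, conjTranspose_mul, conjTranspose_conjTranspose, mul_assoc]
  rw [rightColumn, ← mul_sub_conjTranspose_mul hw hb (polarMap g).2.2.2, e1, e3, e2, mul_sub,
    mul_sub, ← mul_assoc, e4, e5, ← mul_assoc, e4, mul_smul_comm, mul_one, ← sub_eq_add_neg,
    ← smul_sub, smul_smul, inv_mul_cancel₀ ht, one_smul]
  congr 2
  field_simp

theorem rightBall_polarMap (hV : V.trace = 0) :
    rightBall (polarMap g) V = ((polarTrace g.1)⁻¹) ^ 2 • (g.1ᴴ * (V * g.1) + (V * g.1)ᴴ * g.1) -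
        (2 * RCLike.re (g.1ᴴ * (V * g.1)).trace * ((polarTrace g.1)⁻¹) ^ 2) • polarBall g.1 := by
  have ht := (polarTrace_pos g.1).ne'
  have hb : ((polarMap g).2.1)ᴴ = (polarMap g).2.1 := (polarMap g).2.2.1.1.eq
  have hw := trace_conj (polarMap g).1 hV
  have e3 := re_trace_right_polarMap g hV
  have e6 : (V * g.1)ᴴ * g.1 = (g.1ᴴ * (V * g.1))ᴴ := by
    rw [conjTranspose_mul g.1ᴴ, conjTranspose_conjTranspose]
  have h1 := mul_hermPart_mul hw hb (polarMap g).2.2.2 (TraceOneBall.det_eq (polarMap g).2)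
  have h2 : rightBall (polarMap g) V = (2 : ℝ) • (((1 - ‖coords (polarMap g).2.1‖ ^ 2) / 4) •
      hermPart ((polarMap g).1.1ᴴ * V * (polarMap g).1.1)) := by
    rw [rightBall, smul_smul]; congr 1; ring
  rw [h2, ← h1, e6, e3, conjTranspose_mul_right_polarMap, hermPart]
  change _ = _ - _ • (polarMap g).2.1
  generalize (polarMap g).1.1ᴴ * V * (polarMap g).1.1 = w
  rw [conjTranspose_smul, conjTranspose_mul, conjTranspose_mul, hb, star_trivial, ← smul_add,
    smul_smul, mul_smul_comm, smul_mul_assoc, mul_add, add_mul, ← mul_assoc]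
  have h3 : (polarTrace g.1)⁻¹ ^ 2 * polarTrace g.1 ^ 2 = 1 := by field_simp
  have h4 : 2 * (polarTrace g.1 ^ 2 * RCLike.re (w * (polarMap g).2.1).trace) *
      (polarTrace g.1)⁻¹ ^ 2 = 2 * RCLike.re (w * (polarMap g).2.1).trace := by field_simp
  rw [h3, h4]
  module

theorem leftColumn_polarMap (hV : V.trace = 0) :
    leftColumn (polarMap g) V = (polarTrace g.1)⁻¹ • (g.1 * V + (g.1 * V).adjugateᴴ) -
      (RCLike.re (g.1ᴴ * (g.1 * V)).trace * ((polarTrace g.1)⁻¹) ^ 2) • polarUnitary g.1 := by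
  have ht := (polarTrace_pos g.1).ne'
  have hb : ((polarMap g).2.1)ᴴ = (polarMap g).2.1 := (polarMap g).2.2.1.1.eq
  have e1 : (g.1 * V).adjugateᴴ =
      -(polarTrace g.1 • ((polarMap g).1.1 * ((1 - (polarMap g).2.1) * Vᴴ))) := by
    rw [adjugate_mul_distrib, conjTranspose_mul, conjTranspose_adjugate_polarMap,
      adjugate_of_trace_eq_zero hV, conjTranspose_neg, mul_neg, smul_mul_assoc, mul_assoc]
  have e2 : g.1 * V = polarTrace g.1 • ((polarMap g).1.1 * ((polarMap g).2.1 * V)) := by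
    have h : g.1 * V = (polarMap g).1.1 * (polarTrace g.1 • (polarMap g).2.1) * V := by
      rw [polarMap_mul g]
    rw [h, mul_smul_comm, smul_mul_assoc, mul_assoc]
  have e3 := re_trace_left_polarMap g hV
  rw [leftColumn, ← mul_sub_mul_conjTranspose hV hb (polarMap g).2.2.2, e1, e3, e2, mul_sub,
    mul_sub, mul_smul_comm, mul_one, ← sub_eq_add_neg,
    ← smul_sub, smul_smul, inv_mul_cancel₀ ht, one_smul]
  congr 2
  field_simp

theorem leftBall_polarMap (hV : V.trace = 0) :
    leftBall (polarMap g) V = ((polarTrace g.1)⁻¹) ^ 2 • (g.1ᴴ * (g.1 * V) + (g.1 * V)ᴴ * g.1) -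
        (2 * RCLike.re (g.1ᴴ * (g.1 * V)).trace * ((polarTrace g.1)⁻¹) ^ 2) • polarBall g.1 := by
  have ht := (polarTrace_pos g.1).ne'
  have hb : ((polarMap g).2.1)ᴴ = (polarMap g).2.1 := (polarMap g).2.2.1.1.eq
  have e3 := re_trace_left_polarMap g hV
  have e6 : (g.1 * V)ᴴ * g.1 = (g.1ᴴ * (g.1 * V))ᴴ := by
    rw [conjTranspose_mul g.1ᴴ, conjTranspose_conjTranspose]
  rw [e6, e3, conjTranspose_mul_left_polarMap, leftBall]
  change _ = _ - _ • (polarMap g).2.1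
  rw [conjTranspose_smul, conjTranspose_mul, conjTranspose_mul, hb, star_trivial, ← smul_add,
    smul_smul, ball_mul_self, sub_mul, mul_sub, smul_mul_assoc, mul_smul_comm, one_mul, mul_one]
  have h3 : (polarTrace g.1)⁻¹ ^ 2 * polarTrace g.1 ^ 2 = 1 := by field_simp
  have h4 : 2 * (polarTrace g.1 ^ 2 * RCLike.re ((polarMap g).2.1 * V).trace) *
      (polarTrace g.1)⁻¹ ^ 2 = 2 * RCLike.re ((polarMap g).2.1 * V).trace := by field_simp
  rw [h3, h4]
  module

section Smooth

theorem smoothEntriesOn_conj {w : specialUnitaryGroup (Fin 2) 𝕜 × TraceOneBall 𝕜 →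
      Matrix (Fin 2) (Fin 2) 𝕜} {s : Set (specialUnitaryGroup (Fin 2) 𝕜 × TraceOneBall 𝕜)}
    (hw : SmoothEntriesOn (productModel 𝕜) w s) :
    SmoothEntriesOn (productModel 𝕜) (fun x => x.1.1ᴴ * w x * x.1.1) s :=
  (smoothEntriesOn_unitary.conjTranspose.mul hw).mul smoothEntriesOn_unitary

theorem SmoothEntriesOn.const_smul {E H M : Type*} [NormedAddCommGroup E] [NormedSpace ℝ E]
    [TopologicalSpace H] {I : ModelWithCorners ℝ E H} [TopologicalSpace M] [ChartedSpace H M]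
    {f : M → Matrix (Fin 2) (Fin 2) 𝕜} {s : Set M} (c : ℝ) (hf : SmoothEntriesOn I f s) :
    SmoothEntriesOn I (fun x => c • f x) s :=
  SmoothEntriesOn.smul contMDiffOn_const hf

theorem SmoothEntriesOn.hermPart {E H M : Type*} [NormedAddCommGroup E] [NormedSpace ℝ E]
    [TopologicalSpace H] {I : ModelWithCorners ℝ E H} [TopologicalSpace M] [ChartedSpace H M]
    {f : M → Matrix (Fin 2) (Fin 2) 𝕜} {s : Set M} (hf : SmoothEntriesOn I f s) :
    SmoothEntriesOn I (fun x => hermPart (f x)) s :=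
  (hf.add hf.conjTranspose).const_smul _

theorem SmoothEntriesOn.skewPart {E H M : Type*} [NormedAddCommGroup E] [NormedSpace ℝ E]
    [TopologicalSpace H] {I : ModelWithCorners ℝ E H} [TopologicalSpace M] [ChartedSpace H M]
    {f : M → Matrix (Fin 2) (Fin 2) 𝕜} {s : Set M} (hf : SmoothEntriesOn I f s) :
    SmoothEntriesOn I (fun x => skewPart (f x)) s :=
  (hf.sub hf.conjTranspose).const_smul _

theorem smoothEntriesOn_two_mul_sub_one
    {s : Set (specialUnitaryGroup (Fin 2) 𝕜 × TraceOneBall 𝕜)} :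
    SmoothEntriesOn (productModel 𝕜)
      (fun x : specialUnitaryGroup (Fin 2) 𝕜 × TraceOneBall 𝕜 => x.2.1 + x.2.1 - 1) s :=
  (smoothEntriesOn_ball.add smoothEntriesOn_ball).sub (SmoothEntriesOn.const 1)

theorem contMDiff_one_sub_norm_sq :
    ContMDiff (productModel 𝕜) 𝓘(ℝ, ℝ) ∞
      (fun x : specialUnitaryGroup (Fin 2) 𝕜 × TraceOneBall 𝕜 => 1 - ‖coords x.2.1‖ ^ 2) := by
  have h : ContDiff ℝ ∞ (fun p : WithLp 2 (ℝ × 𝕜) => 1 - ‖p‖ ^ 2) :=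
    contDiff_const.sub (contDiff_id.norm_sq ℝ)
  exact h.contMDiff.comp contMDiff_ball_coords

theorem smoothEntriesOn_rightColumn {w : specialUnitaryGroup (Fin 2) 𝕜 × TraceOneBall 𝕜 →
      Matrix (Fin 2) (Fin 2) 𝕜} {s : Set (specialUnitaryGroup (Fin 2) 𝕜 × TraceOneBall 𝕜)}
    (hw : SmoothEntriesOn (productModel 𝕜) w s) :
    SmoothEntriesOn (productModel 𝕜) (fun x => rightColumn x (w x)) s := by
  have h := smoothEntriesOn_conj hw
  exact smoothEntriesOn_unitary.mul (h.skewPart.add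
    (((h.hermPart.mul smoothEntriesOn_two_mul_sub_one).sub
      (smoothEntriesOn_two_mul_sub_one.mul h.hermPart)).const_smul _))

theorem smoothEntriesOn_rightBall {w : specialUnitaryGroup (Fin 2) 𝕜 × TraceOneBall 𝕜 →
      Matrix (Fin 2) (Fin 2) 𝕜} {s : Set (specialUnitaryGroup (Fin 2) 𝕜 × TraceOneBall 𝕜)}
    (hw : SmoothEntriesOn (productModel 𝕜) w s) :
    SmoothEntriesOn (productModel 𝕜) (fun x => rightBall x (w x)) s := by
  refine SmoothEntriesOn.smul ?_ (smoothEntriesOn_conj hw).hermPart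
  have h : ContDiff ℝ ∞ (fun r : ℝ => r / 2) := by fun_prop
  exact (h.contMDiff.comp contMDiff_one_sub_norm_sq).contMDiffOn

theorem smoothEntriesOn_leftColumn {w : specialUnitaryGroup (Fin 2) 𝕜 × TraceOneBall 𝕜 →
      Matrix (Fin 2) (Fin 2) 𝕜} {s : Set (specialUnitaryGroup (Fin 2) 𝕜 × TraceOneBall 𝕜)}
    (h : SmoothEntriesOn (productModel 𝕜) w s) :
    SmoothEntriesOn (productModel 𝕜) (fun x => leftColumn x (w x)) s :=
  smoothEntriesOn_unitary.mul (h.skewPart.add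
    (((smoothEntriesOn_two_mul_sub_one.mul h.hermPart).sub
      (h.hermPart.mul smoothEntriesOn_two_mul_sub_one)).const_smul _))

theorem smoothEntriesOn_leftBall {w : specialUnitaryGroup (Fin 2) 𝕜 × TraceOneBall 𝕜 →
      Matrix (Fin 2) (Fin 2) 𝕜} {s : Set (specialUnitaryGroup (Fin 2) 𝕜 × TraceOneBall 𝕜)}
    (hw : SmoothEntriesOn (productModel 𝕜) w s) :
    SmoothEntriesOn (productModel 𝕜) (fun x => leftBall x (w x)) s := by
  have h1 : ContDiff ℝ ∞ (fun r : ℝ => r / 4) := by fun_prop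
  have h2 : ContDiff ℝ ∞ (fun r : ℝ => 2 * r) := by fun_prop
  refine (((smoothEntriesOn_ball.mul hw).add (hw.conjTranspose.mul smoothEntriesOn_ball)).sub
    (SmoothEntriesOn.smul ?_ (hw.add hw.conjTranspose))).sub
    (SmoothEntriesOn.smul ?_ smoothEntriesOn_ball)
  · exact (h1.contMDiff.comp contMDiff_one_sub_norm_sq).contMDiffOn
  · exact h2.contMDiff.comp_contMDiffOn (smoothEntriesOn_ball.mul hw).re_trace

end Smooth

open scoped RealInnerProductSpace

/-- A vector field on `SL(2)` whose derivatives of the two polar factors are given by formulas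
that make sense and are smooth up to the boundary has a lift. -/
theorem exists_isLift {w : ∀ g : SpecialLinearGroup (Fin 2) 𝕜, TangentSpace 𝓘(ℝ, 𝕜 × 𝕜 × 𝕜) g}
    {Z q : specialUnitaryGroup (Fin 2) 𝕜 × TraceOneBall 𝕜 → Matrix (Fin 2) (Fin 2) 𝕜}
    (hZ : SmoothEntriesOn (productModel 𝕜) Z Set.univ)
    (hq : SmoothEntriesOn (productModel 𝕜) q Set.univ)
    (h0 : ∀ x, ⟪firstColumn x.1.1, firstColumn (Z x)⟫ = 0)
    (h1 : ∀ g, mvfderiv 𝓘(ℝ, 𝕜 × 𝕜 × 𝕜) (fun g : SpecialLinearGroup (Fin 2) 𝕜 =>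
      firstColumn (polarMap g).1.1) g (w g) = firstColumn (Z (polarMap g)))
    (h2 : ∀ g, mvfderiv 𝓘(ℝ, 𝕜 × 𝕜 × 𝕜) (fun g : SpecialLinearGroup (Fin 2) 𝕜 =>
      coords (polarMap g).2.1) g (w g) = coords (q (polarMap g))) :
    ∃ W, IsLift 𝓘(ℝ, 𝕜 × 𝕜 × 𝕜) (productModel 𝕜) polarMap w W := by
  obtain ⟨W, hW, hWZ⟩ := exists_isSmoothVectorField (contMDiffOn_univ.1 hZ.firstColumn)
    (contMDiffOn_univ.1 hq.coords) h0
  refine ⟨W, hW, fun g => ?_⟩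
  obtain ⟨e1, e2⟩ := mfderiv_components contMDiff_polarMap g (w g)
  apply tangent_ext
  · rw [(hWZ _).1, e1, h1]
  · rw [(hWZ _).2, e2, h2]

/-- By density of the interior, the two components of a lift are given on all of the
compactification by the formulas that hold in the interior. -/
theorem IsLift.components
    {w : ∀ g : SpecialLinearGroup (Fin 2) 𝕜, TangentSpace 𝓘(ℝ, 𝕜 × 𝕜 × 𝕜) g}
    {Z q : specialUnitaryGroup (Fin 2) 𝕜 × TraceOneBall 𝕜 → Matrix (Fin 2) (Fin 2) 𝕜}
    (hZ : SmoothEntriesOn (productModel 𝕜) Z Set.univ)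
    (hq : SmoothEntriesOn (productModel 𝕜) q Set.univ)
    (h1 : ∀ g, mvfderiv 𝓘(ℝ, 𝕜 × 𝕜 × 𝕜) (fun g : SpecialLinearGroup (Fin 2) 𝕜 =>
      firstColumn (polarMap g).1.1) g (w g) = firstColumn (Z (polarMap g)))
    (h2 : ∀ g, mvfderiv 𝓘(ℝ, 𝕜 × 𝕜 × 𝕜) (fun g : SpecialLinearGroup (Fin 2) 𝕜 =>
      coords (polarMap g).2.1) g (w g) = coords (q (polarMap g)))
    {W : ∀ x : specialUnitaryGroup (Fin 2) 𝕜 × TraceOneBall 𝕜, TangentSpace (productModel 𝕜) x}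
    (hW : IsLift 𝓘(ℝ, 𝕜 × 𝕜 × 𝕜) (productModel 𝕜) polarMap w W)
    (x : specialUnitaryGroup (Fin 2) 𝕜 × TraceOneBall 𝕜) :
    columnDeriv x (W x) = firstColumn (Z x) ∧ ballDeriv x (W x) = coords (q x) := by
  obtain ⟨c1, c2⟩ := hW.1.contMDiff_components
  have hd : Dense (Set.range (polarMap (𝕜 := 𝕜))) := by
    have : Set.range (polarMap (𝕜 := 𝕜)) = {x | ‖coords x.2.1‖ < 1} := by
      rw [range_polarMap]; ext x; exact mem_interior_product_iff
    rw [this]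
    exact dense_interior_product
  have k1 := c1.continuous.ext_on hd (contMDiffOn_univ.1 hZ.firstColumn).continuous (by
    rintro _ ⟨g, rfl⟩
    dsimp only
    rw [hW.2 g, (mfderiv_components contMDiff_polarMap g (w g)).1, h1])
  have k2 := c2.continuous.ext_on hd (contMDiffOn_univ.1 hq.coords).continuous (by
    rintro _ ⟨g, rfl⟩
    dsimp only
    rw [hW.2 g, (mfderiv_components contMDiff_polarMap g (w g)).2, h2])
  exact ⟨congrFun k1 x, congrFun k2 x⟩

variable (v : GroupLieAlgebra 𝓘(ℝ, 𝕜 × 𝕜 × 𝕜) (SpecialLinearGroup (Fin 2) 𝕜))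

theorem mvfderiv_right_unitary :
    mvfderiv 𝓘(ℝ, 𝕜 × 𝕜 × 𝕜) (fun g : SpecialLinearGroup (Fin 2) 𝕜 =>
      firstColumn (polarMap g).1.1) g (rightInvariantVectorField 𝓘(ℝ, 𝕜 × 𝕜 × 𝕜) v g) =
      firstColumn (rightColumn (polarMap g) (slMatrix v)) := by
  rw [rightColumn_polarMap g (trace_slMatrix v)]
  exact mvfderiv_polarMap_unitary (mvfderiv_slEntries_right v g)

theorem mvfderiv_right_ball :
    mvfderiv 𝓘(ℝ, 𝕜 × 𝕜 × 𝕜) (fun g : SpecialLinearGroup (Fin 2) 𝕜 =>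
      coords (polarMap g).2.1) g (rightInvariantVectorField 𝓘(ℝ, 𝕜 × 𝕜 × 𝕜) v g) =
      coords (rightBall (polarMap g) (slMatrix v)) := by
  rw [rightBall_polarMap g (trace_slMatrix v)]
  exact mvfderiv_polarMap_ball (mvfderiv_slEntries_right v g)

theorem mvfderiv_left_unitary :
    mvfderiv 𝓘(ℝ, 𝕜 × 𝕜 × 𝕜) (fun g : SpecialLinearGroup (Fin 2) 𝕜 =>
      firstColumn (polarMap g).1.1) g (mulInvariantVectorField (I := 𝓘(ℝ, 𝕜 × 𝕜 × 𝕜)) v g) =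
      firstColumn (leftColumn (polarMap g) (slMatrix v)) := by
  rw [leftColumn_polarMap g (trace_slMatrix v)]
  exact mvfderiv_polarMap_unitary (mvfderiv_slEntries_left v g)

theorem mvfderiv_left_ball :
    mvfderiv 𝓘(ℝ, 𝕜 × 𝕜 × 𝕜) (fun g : SpecialLinearGroup (Fin 2) 𝕜 =>
      coords (polarMap g).2.1) g (mulInvariantVectorField (I := 𝓘(ℝ, 𝕜 × 𝕜 × 𝕜)) v g) =
      coords (leftBall (polarMap g) (slMatrix v)) := by
  rw [leftBall_polarMap g (trace_slMatrix v)]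
  exact mvfderiv_polarMap_ball (mvfderiv_slEntries_left v g)

theorem exists_isLift_right : ∃ W, IsLift 𝓘(ℝ, 𝕜 × 𝕜 × 𝕜) (productModel 𝕜) polarMap
    (rightInvariantVectorField 𝓘(ℝ, 𝕜 × 𝕜 × 𝕜) v) W :=
  exists_isLift (smoothEntriesOn_rightColumn (.const (slMatrix v)))
    (smoothEntriesOn_rightBall (.const (slMatrix v))) (fun x => inner_rightColumn x _)
    (fun g => mvfderiv_right_unitary g v) (fun g => mvfderiv_right_ball g v)

theorem exists_isLift_left : ∃ W, IsLift 𝓘(ℝ, 𝕜 × 𝕜 × 𝕜) (productModel 𝕜) polarMap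
    (mulInvariantVectorField (I := 𝓘(ℝ, 𝕜 × 𝕜 × 𝕜)) v) W :=
  exists_isLift (smoothEntriesOn_leftColumn (.const (slMatrix v)))
    (smoothEntriesOn_leftBall (.const (slMatrix v))) (fun x => inner_leftColumn x _)
    (fun g => mvfderiv_left_unitary g v) (fun g => mvfderiv_left_ball g v)

variable {v}
  {W : ∀ x : specialUnitaryGroup (Fin 2) 𝕜 × TraceOneBall 𝕜, TangentSpace (productModel 𝕜) x}

theorem components_of_isLift_right (hW : IsLift 𝓘(ℝ, 𝕜 × 𝕜 × 𝕜) (productModel 𝕜) polarMap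
    (rightInvariantVectorField 𝓘(ℝ, 𝕜 × 𝕜 × 𝕜) v) W)
    (x : specialUnitaryGroup (Fin 2) 𝕜 × TraceOneBall 𝕜) :
    columnDeriv x (W x) = firstColumn (rightColumn x (slMatrix v)) ∧
      ballDeriv x (W x) = coords (rightBall x (slMatrix v)) :=
  IsLift.components (smoothEntriesOn_rightColumn (.const (slMatrix v)))
    (smoothEntriesOn_rightBall (.const (slMatrix v)))
    (fun g => mvfderiv_right_unitary g v) (fun g => mvfderiv_right_ball g v) hW x

theorem components_of_isLift_left (hW : IsLift 𝓘(ℝ, 𝕜 × 𝕜 × 𝕜) (productModel 𝕜) polarMap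
    (mulInvariantVectorField (I := 𝓘(ℝ, 𝕜 × 𝕜 × 𝕜)) v) W)
    (x : specialUnitaryGroup (Fin 2) 𝕜 × TraceOneBall 𝕜) :
    columnDeriv x (W x) = firstColumn (leftColumn x (slMatrix v)) ∧
      ballDeriv x (W x) = coords (leftBall x (slMatrix v)) :=
  IsLift.components (smoothEntriesOn_leftColumn (.const (slMatrix v)))
    (smoothEntriesOn_leftBall (.const (slMatrix v)))
    (fun g => mvfderiv_left_unitary g v) (fun g => mvfderiv_left_ball g v) hW x

end Lifts

/-! ### Division by the boundary defining function -/

section RadialProjection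

open Metric Module

variable {E M : Type*} [NormedAddCommGroup E] [InnerProductSpace ℝ E]
  {n : ℕ} [Fact (finrank ℝ E = n + 1)]
  [TopologicalSpace M] [ChartedSpace (EuclideanSpace ℝ (Fin n)) M]
  (Φ : M ≃ₘ^∞⟮𝓡 n, 𝓡 n⟯ sphere (0 : E) 1) (m₀ : M)

/-- The radial projection of `E ∖ 0` to the unit sphere, or to a manifold identified with the
unit sphere; the value at the origin is arbitrary. -/
noncomputable def radialProjection (a : E) : M :=
  open Classical in
  if h : a ≠ 0 then Φ.symm ⟨‖a‖⁻¹ • a, by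
      rw [mem_sphere_zero_iff_norm, norm_smul, norm_inv, norm_norm,
        inv_mul_cancel₀ (norm_ne_zero_iff.2 h)]⟩
  else m₀

theorem coe_radialProjection {a : E} (h : a ≠ 0) :
    (Φ (radialProjection Φ m₀ a) : E) = ‖a‖⁻¹ • a := by
  rw [radialProjection, dif_pos h, Diffeomorph.apply_symm_apply]

theorem radialProjection_smul (m : M) {r : ℝ} (hr : 0 < r) :
    radialProjection Φ m₀ (r • (Φ m : E)) = m := by
  have h1 : ‖(Φ m : E)‖ = 1 := mem_sphere_zero_iff_norm.1 (Φ m).2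
  have h2 : r • (Φ m : E) ≠ 0 :=
    smul_ne_zero hr.ne' (norm_ne_zero_iff.1 (by rw [h1]; exact one_ne_zero))
  apply Φ.injective
  apply Subtype.ext
  refine (coe_radialProjection Φ m₀ h2).trans ?_
  change _ = (Φ m : E)
  rw [norm_smul, h1, Real.norm_of_nonneg hr.le, mul_one, smul_smul,
    inv_mul_cancel₀ hr.ne', one_smul]

theorem contMDiffOn_radialProjection :
    ContMDiffOn 𝓘(ℝ, E) (𝓡 n) ∞ (radialProjection Φ m₀) {a | a ≠ 0} := by
  -- smoothness of maps into the sphere is available for maps defined on a manifold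
  let T : TopologicalSpace.Opens E := ⟨{a | a ≠ 0}, isOpen_ne⟩
  have h1 : ContMDiff 𝓘(ℝ, E) (𝓡 n) ∞ (fun a : T => radialProjection Φ m₀ (a : E)) := by
    refine contMDiff_of_sphere_coe_comp Φ fun a => ?_
    have h2 : ContDiffAt ℝ ∞ (fun a : E => ‖a‖⁻¹ • a) a :=
      ((contDiffAt_id.norm ℝ a.2).inv (norm_ne_zero_iff.2 a.2)).smul contDiffAt_id
    have h3 := (contMDiffAt_subtype_iff (U := T) (x := a)).2 h2.contMDiffAt
    exact h3.congr_of_eventuallyEq (Filter.Eventually.of_forall fun a =>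
      coe_radialProjection Φ m₀ a.2)
  exact fun a ha => ((contMDiffAt_subtype_iff (U := T) (x := ⟨a, ha⟩)).1
    (h1 ⟨a, ha⟩)).contMDiffWithinAt

end RadialProjection

section Hadamard

open Matrix SpecialUnitary TraceOneBall Module Metric

variable {𝕜 : Type*} [RCLike 𝕜]

theorem contMDiff_firstColumn :
    ContMDiff (productModel 𝕜) 𝓘(ℝ, WithLp 2 (𝕜 × 𝕜)) ∞
      (fun x : specialUnitaryGroup (Fin 2) 𝕜 × TraceOneBall 𝕜 => firstColumn x.1.1) :=
  (contMDiff_sphere_coe_comp (diffeomorphSphere 𝕜)).comp contMDiff_fst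

theorem firstColumn_ne_zero (k : specialUnitaryGroup (Fin 2) 𝕜) : firstColumn k.1 ≠ 0 := by
  have h : ‖firstColumn k.1‖ = 1 := mem_sphere_zero_iff_norm.1 (diffeomorphSphere 𝕜 k).2
  exact norm_ne_zero_iff.1 (by rw [h]; exact one_ne_zero)

/-- A smooth function on `K × B` that vanishes on the boundary is a smooth multiple of the
boundary defining function `1 - ‖p‖²`. -/
theorem exists_contMDiff_smul_eq
    {q : specialUnitaryGroup (Fin 2) 𝕜 × TraceOneBall 𝕜 → WithLp 2 (ℝ × 𝕜)}
    (hq : ContMDiff (productModel 𝕜) 𝓘(ℝ, WithLp 2 (ℝ × 𝕜)) ∞ q)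
    (h0 : ∀ x, ‖coords x.2.1‖ = 1 → q x = 0) :
    ∃ h : specialUnitaryGroup (Fin 2) 𝕜 × TraceOneBall 𝕜 → WithLp 2 (ℝ × 𝕜),
      ContMDiff (productModel 𝕜) 𝓘(ℝ, WithLp 2 (ℝ × 𝕜)) ∞ h ∧
      ∀ x, (1 - ‖coords x.2.1‖ ^ 2) • h x = q x := by
  -- extended by homogeneity in the first column, `q` becomes a function on an open set of
  -- parameters times the closed ball
  let f : WithLp 2 (𝕜 × 𝕜) × WithLp 2 (ℝ × 𝕜) → WithLp 2 (ℝ × 𝕜) := fun y =>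
    q (radialProjection (diffeomorphSphere 𝕜) 1 y.1, (model 𝕜).symm y.2)
  have hT : IsOpen {α : WithLp 2 (𝕜 × 𝕜) | α ≠ 0} := isOpen_ne
  have hf : ContDiffOn ℝ ∞ f ({α | α ≠ 0} ×ˢ closedBall 0 1) := by
    rw [← contMDiffOn_iff_contDiffOn]
    have h1 : ContMDiffOn 𝓘(ℝ, WithLp 2 (𝕜 × 𝕜) × WithLp 2 (ℝ × 𝕜)) (𝓡 (2 * finrank ℝ 𝕜 - 1)) ∞
        (fun y : WithLp 2 (𝕜 × 𝕜) × WithLp 2 (ℝ × 𝕜) => radialProjection (diffeomorphSphere 𝕜) 1 y.1)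
        ({α | α ≠ 0} ×ˢ closedBall 0 1) :=
      (contMDiffOn_radialProjection (diffeomorphSphere 𝕜) 1).comp (contDiff_fst (𝕜 := ℝ)).contMDiff.contMDiffOn fun y hy => hy.1
    have h2 : ContMDiffOn 𝓘(ℝ, WithLp 2 (𝕜 × 𝕜) × WithLp 2 (ℝ × 𝕜)) (model 𝕜) ∞
        (fun y : WithLp 2 (𝕜 × 𝕜) × WithLp 2 (ℝ × 𝕜) => (model 𝕜).symm y.2)
        ({α | α ≠ 0} ×ˢ closedBall 0 1) := by
      have h3 := (model 𝕜).contMDiffOn_symm (n := ∞)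
      rw [range_model] at h3
      exact h3.comp (contDiff_snd (𝕜 := ℝ)).contMDiff.contMDiffOn fun y hy => hy.2
    exact hq.comp_contMDiffOn (h1.prodMk h2)
  have hf0 : ∀ y ∈ {α : WithLp 2 (𝕜 × 𝕜) | α ≠ 0}, ∀ p, ‖p‖ = 1 → f (y, p) = 0 := by
    intro y _ p hp
    exact h0 _ (by simp only [coords_model_symm hp.le, hp])
  have hQ := contDiffOn_ballQuotient hT hf hf0
  have hc : ContMDiff (productModel 𝕜) 𝓘(ℝ, WithLp 2 (𝕜 × 𝕜) × WithLp 2 (ℝ × 𝕜)) ∞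
      (fun x : specialUnitaryGroup (Fin 2) 𝕜 × TraceOneBall 𝕜 =>
        (firstColumn x.1.1, coords x.2.1)) :=
    contMDiff_firstColumn.prodMk_space contMDiff_ball_coords
  refine ⟨fun x => ballQuotient (fun p => f (firstColumn x.1.1, p)) (coords x.2.1), ?_,
    fun x => ?_⟩
  · have h1 := hQ.contMDiffOn.comp (s := Set.univ) hc.contMDiffOn fun x _ =>
      ⟨firstColumn_ne_zero x.1, by simpa using norm_coords_le x.2⟩
    exact contMDiffOn_univ.1 h1
  · refine (smul_ballQuotient (norm_coords_le x.2) (hf0 _ (firstColumn_ne_zero x.1) _)).trans ?_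
    have h1 := radialProjection_smul (diffeomorphSphere 𝕜) 1 x.1 one_pos
    rw [one_smul] at h1
    change q (radialProjection _ _ (diffeomorphSphere 𝕜 x.1 : WithLp 2 (𝕜 × 𝕜)), _) = _
    rw [h1, model_symm_coords]

end Hadamard

/-! ### Spans of vector fields -/

section Components

open Matrix SpecialUnitary TraceOneBall Module
open scoped RealInnerProductSpace

variable {𝕜 : Type*} [RCLike 𝕜]
  {V : ∀ x : specialUnitaryGroup (Fin 2) 𝕜 × TraceOneBall 𝕜, TangentSpace (productModel 𝕜) x}

theorem isSmoothVectorField_of_components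
    (h1 : ContMDiff (productModel 𝕜) 𝓘(ℝ, WithLp 2 (𝕜 × 𝕜)) ∞ (fun x => columnDeriv x (V x)))
    (h2 : ContMDiff (productModel 𝕜) 𝓘(ℝ, WithLp 2 (ℝ × 𝕜)) ∞ (fun x => ballDeriv x (V x))) :
    IsSmoothVectorField (productModel 𝕜) V := by
  obtain ⟨V', hV', h⟩ := exists_isSmoothVectorField h1 h2 fun x => inner_columnDeriv (V x)
  have : V = V' := funext fun x => tangent_ext (h x).1.symm (h x).2.symm
  rwa [this]

theorem isSmoothVectorField_of_mem_smoothSpan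
    {S : Set (∀ x : specialUnitaryGroup (Fin 2) 𝕜 × TraceOneBall 𝕜,
      TangentSpace (productModel 𝕜) x)}
    (hS : ∀ W ∈ S, IsSmoothVectorField (productModel 𝕜) W)
    (hV : V ∈ smoothSpan (productModel 𝕜) S) : IsSmoothVectorField (productModel 𝕜) V := by
  obtain ⟨n, f, W, hW, hV⟩ := hV
  have h := fun i => (hS _ (hW i)).contMDiff_components
  apply isSmoothVectorField_of_components
  · simp only [hV, columnDeriv_sum]
    exact contMDiff_finsetSum fun i _ => (f i).contMDiff.smul (h i).1
  · simp only [hV, ballDeriv_sum]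
    exact contMDiff_finsetSum fun i _ => (f i).contMDiff.smul (h i).2

/-- Vector fields whose two components depend linearly on a parameter span all fields that are
obtained by letting the parameter vary smoothly. -/
theorem mem_smoothSpan_of_components
    {S : Set (∀ x : specialUnitaryGroup (Fin 2) 𝕜 × TraceOneBall 𝕜,
      TangentSpace (productModel 𝕜) x)}
    {C : specialUnitaryGroup (Fin 2) 𝕜 × TraceOneBall 𝕜 → (𝕜 × 𝕜 × 𝕜) →ₗ[ℝ] WithLp 2 (𝕜 × 𝕜)}
    {D : specialUnitaryGroup (Fin 2) 𝕜 × TraceOneBall 𝕜 → (𝕜 × 𝕜 × 𝕜) →ₗ[ℝ] WithLp 2 (ℝ × 𝕜)}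
    (hS : ∀ u, ∃ W ∈ S, ∀ x, columnDeriv x (W x) = C x u ∧ ballDeriv x (W x) = D x u)
    {u : specialUnitaryGroup (Fin 2) 𝕜 × TraceOneBall 𝕜 → 𝕜 × 𝕜 × 𝕜}
    (hu : ContMDiff (productModel 𝕜) 𝓘(ℝ, 𝕜 × 𝕜 × 𝕜) ∞ u)
    (h : ∀ x, columnDeriv x (V x) = C x (u x) ∧ ballDeriv x (V x) = D x (u x)) :
    V ∈ smoothSpan (productModel 𝕜) S := by
  choose W hWS hW using hS
  let e := Module.finBasis ℝ (𝕜 × 𝕜 × 𝕜)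
  have hf : ∀ i, ContMDiff (productModel 𝕜) 𝓘(ℝ, ℝ) ∞ (fun x => e.repr (u x) i) := fun i =>
    (LinearMap.toContinuousLinearMap (e.coord i)).contDiff.contMDiff.comp hu
  refine ⟨_, fun i => ⟨fun x => e.repr (u x) i, hf i⟩, fun i => W (e i), fun i => hWS _,
    fun x => ?_⟩
  apply tangent_ext
  · rw [columnDeriv_sum, (h x).1]
    nth_rewrite 1 [← e.sum_repr (u x)]
    rw [map_sum]
    refine Finset.sum_congr rfl fun i _ => ?_
    rw [map_smul, (hW _ x).1]
    rfl
  · rw [ballDeriv_sum, (h x).2]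
    nth_rewrite 1 [← e.sum_repr (u x)]
    rw [map_sum]
    refine Finset.sum_congr rfl fun i _ => ?_
    rw [map_smul, (hW _ x).2]
    rfl

theorem slMatrix_add (u v : 𝕜 × 𝕜 × 𝕜) : slMatrix (u + v) = slMatrix u + slMatrix v := by
  ext i j
  fin_cases i <;> fin_cases j <;> simp [slMatrix, add_comm]

theorem slMatrix_smul (c : ℝ) (u : 𝕜 × 𝕜 × 𝕜) : slMatrix (c • u) = c • slMatrix u := by
  ext i j
  fin_cases i <;> fin_cases j <;> simp [slMatrix]

theorem hermPart_add (a b : Matrix (Fin 2) (Fin 2) 𝕜) :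
    hermPart (a + b) = hermPart a + hermPart b := by
  simp only [hermPart, conjTranspose_add]; module

theorem hermPart_smul (c : ℝ) (a : Matrix (Fin 2) (Fin 2) 𝕜) :
    hermPart (c • a) = c • hermPart a := by
  simp only [hermPart, conjTranspose_smul, star_trivial]; module

theorem skewPart_add (a b : Matrix (Fin 2) (Fin 2) 𝕜) :
    skewPart (a + b) = skewPart a + skewPart b := by
  simp only [skewPart, conjTranspose_add]; module

theorem skewPart_smul (c : ℝ) (a : Matrix (Fin 2) (Fin 2) 𝕜) :
    skewPart (c • a) = c • skewPart a := by
  simp only [skewPart, conjTranspose_smul, star_trivial]; module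

variable (x : specialUnitaryGroup (Fin 2) 𝕜 × TraceOneBall 𝕜)

/-- `rightColumn` as a linear map on the Lie algebra. -/
noncomputable def rightColumnLinear : (𝕜 × 𝕜 × 𝕜) →ₗ[ℝ] WithLp 2 (𝕜 × 𝕜) where
  toFun u := firstColumn (rightColumn x (slMatrix u))
  map_add' u v := by
    have : rightColumn x (slMatrix (u + v)) =
        rightColumn x (slMatrix u) + (1 : ℝ) • rightColumn x (slMatrix v) := by
      simp only [rightColumn, slMatrix_add, mul_add, add_mul, hermPart_add, skewPart_add,
        mul_sub, mul_smul_comm]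
      module
    rw [this, firstColumn_add_smul, one_smul]
  map_smul' c u := by
    have : rightColumn x (slMatrix (c • u)) = 0 + c • rightColumn x (slMatrix u) := by
      simp only [rightColumn, slMatrix_smul, mul_smul_comm, smul_mul_assoc, hermPart_smul,
        skewPart_smul, mul_add, mul_sub]
      module
    rw [this, firstColumn_add_smul]
    exact zero_add _

/-- `rightBall` as a linear map on the Lie algebra. -/
noncomputable def rightBallLinear : (𝕜 × 𝕜 × 𝕜) →ₗ[ℝ] WithLp 2 (ℝ × 𝕜) where
  toFun u := coords (rightBall x (slMatrix u))
  map_add' u v := by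
    rw [← coords_add]
    simp only [rightBall, slMatrix_add, mul_add, add_mul, hermPart_add, smul_add]
  map_smul' c u := by
    rw [RingHom.id_apply, ← coords_smul]
    congr 1
    simp only [rightBall, slMatrix_smul, mul_smul_comm, smul_mul_assoc, hermPart_smul]
    module

/-- `leftColumn` as a linear map on the Lie algebra. -/
noncomputable def leftColumnLinear : (𝕜 × 𝕜 × 𝕜) →ₗ[ℝ] WithLp 2 (𝕜 × 𝕜) where
  toFun u := firstColumn (leftColumn x (slMatrix u))
  map_add' u v := by
    have : leftColumn x (slMatrix (u + v)) =
        leftColumn x (slMatrix u) + (1 : ℝ) • leftColumn x (slMatrix v) := by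
      simp only [leftColumn, slMatrix_add, mul_add, add_mul, hermPart_add, skewPart_add,
        mul_sub, mul_smul_comm]
      module
    rw [this, firstColumn_add_smul, one_smul]
  map_smul' c u := by
    have : leftColumn x (slMatrix (c • u)) = 0 + c • leftColumn x (slMatrix u) := by
      simp only [leftColumn, slMatrix_smul, mul_smul_comm, smul_mul_assoc, hermPart_smul,
        skewPart_smul, mul_add, mul_sub]
      module
    rw [this, firstColumn_add_smul]
    exact zero_add _

/-- `leftBall` as a linear map on the Lie algebra. -/
noncomputable def leftBallLinear : (𝕜 × 𝕜 × 𝕜) →ₗ[ℝ] WithLp 2 (ℝ × 𝕜) where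
  toFun u := coords (leftBall x (slMatrix u))
  map_add' u v := by
    rw [← coords_add]
    congr 1
    simp only [leftBall, slMatrix_add, mul_add, add_mul, conjTranspose_add, trace_add, map_add]
    module
  map_smul' c u := by
    rw [RingHom.id_apply, ← coords_smul]
    congr 1
    simp only [leftBall, slMatrix_smul, mul_smul_comm, smul_mul_assoc, conjTranspose_smul,
      star_trivial, trace_smul, RCLike.smul_re]
    module

end Components

/-! ### Tangency to the boundary and to the fibres -/

section BoundaryConditions

open Matrix SpecialUnitary TraceOneBall Module Metric
open scoped RealInnerProductSpace

variable {𝕜 : Type*} [RCLike 𝕜]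

variable (𝕜) in
/-- The sphere of matrices of trace one and rank one is diffeomorphic to the unit sphere. -/
noncomputable def TraceOneSphere.diffeomorphSphere :
    TraceOneSphere 𝕜 ≃ₘ^∞⟮𝓡 (finrank ℝ 𝕜), 𝓡 (finrank ℝ 𝕜)⟯
      sphere (0 : WithLp 2 (ℝ × 𝕜)) 1 :=
  transportDiffeomorph (𝓡 (finrank ℝ 𝕜)) (TraceOneSphere.homeomorphSphere 𝕜)

variable (𝕜) in
/-- The model with corners of the product of the maximal compact subgroup and the sphere. -/
noncomputable abbrev boundaryModel :=
  (𝓡 (2 * finrank ℝ 𝕜 - 1)).prod (𝓡 (finrank ℝ 𝕜))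

variable (𝕜) in
/-- The inclusion of `K × ∂B` into `K × B`. -/
abbrev boundaryIncl : specialUnitaryGroup (Fin 2) 𝕜 × TraceOneSphere 𝕜 →
    specialUnitaryGroup (Fin 2) 𝕜 × TraceOneBall 𝕜 :=
  Prod.map id TraceOneSphere.incl

theorem contMDiff_coords_sphere :
    ContMDiff (𝓡 (finrank ℝ 𝕜)) 𝓘(ℝ, WithLp 2 (ℝ × 𝕜)) ∞
      (fun s : TraceOneSphere 𝕜 => coords s.1) :=
  contMDiff_sphere_coe_comp (TraceOneSphere.diffeomorphSphere 𝕜)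

theorem contMDiff_boundaryIncl :
    ContMDiff (boundaryModel 𝕜) (productModel 𝕜) ∞ (boundaryIncl 𝕜) :=
  ContMDiff.prodMap contMDiff_id (contMDiff_of_coords contMDiff_coords_sphere)

theorem mfderiv_boundaryIncl (n : specialUnitaryGroup (Fin 2) 𝕜 × TraceOneSphere 𝕜)
    (ξ : TangentSpace (boundaryModel 𝕜) n) :
    columnDeriv (boundaryIncl 𝕜 n) (mfderiv (boundaryModel 𝕜) (productModel 𝕜)
      (boundaryIncl 𝕜) n ξ) =
      mvfderiv (𝓡 (2 * finrank ℝ 𝕜 - 1)) (fun k : specialUnitaryGroup (Fin 2) 𝕜 =>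
        (SpecialUnitary.diffeomorphSphere 𝕜 k : WithLp 2 (𝕜 × 𝕜))) n.1 ξ.1 ∧
    ballDeriv (boundaryIncl 𝕜 n) (mfderiv (boundaryModel 𝕜) (productModel 𝕜)
      (boundaryIncl 𝕜) n ξ) =
      mvfderiv (𝓡 (finrank ℝ 𝕜)) (fun s : TraceOneSphere 𝕜 =>
        (TraceOneSphere.diffeomorphSphere 𝕜 s : WithLp 2 (ℝ × 𝕜))) n.2 ξ.2 := by
  obtain ⟨h1, h2⟩ := mfderiv_components contMDiff_boundaryIncl n ξ
  constructor
  · have h := mvfderiv_comp_mfderiv (I := boundaryModel 𝕜) (x := n)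
      (f := (Prod.fst : specialUnitaryGroup (Fin 2) 𝕜 × TraceOneSphere 𝕜 → _))
      (g := fun k : specialUnitaryGroup (Fin 2) 𝕜 =>
        (SpecialUnitary.diffeomorphSphere 𝕜 k : WithLp 2 (𝕜 × 𝕜)))
      (((contMDiff_sphere_coe_comp (SpecialUnitary.diffeomorphSphere 𝕜)) _).mdifferentiableAt
        (by simp)) mdifferentiableAt_fst ξ
    rw [mfderiv_fst] at h
    exact h1.trans h
  · have h := mvfderiv_comp_mfderiv (I := boundaryModel 𝕜) (x := n)
      (f := (Prod.snd : specialUnitaryGroup (Fin 2) 𝕜 × TraceOneSphere 𝕜 → _))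
      (g := fun s : TraceOneSphere 𝕜 =>
        (TraceOneSphere.diffeomorphSphere 𝕜 s : WithLp 2 (ℝ × 𝕜)))
      (((contMDiff_sphere_coe_comp (TraceOneSphere.diffeomorphSphere 𝕜)) _).mdifferentiableAt
        (by simp)) mdifferentiableAt_snd ξ
    rw [mfderiv_snd] at h
    exact h2.trans h

theorem range_boundaryIncl : Set.range (boundaryIncl 𝕜) =
    (productModel 𝕜).boundary (specialUnitaryGroup (Fin 2) 𝕜 × TraceOneBall 𝕜) := by
  ext x
  rw [mem_boundary_product_iff]
  constructor
  · rintro ⟨n, rfl⟩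
    exact TraceOneSphere.norm_coords n.2
  · intro hx
    refine ⟨(x.1, ⟨x.2.1, x.2.2.1, x.2.2.2, ?_⟩), rfl⟩
    rw [TraceOneBall.det_eq, hx]
    simp

theorem injective_mfderiv_boundaryIncl
    (n : specialUnitaryGroup (Fin 2) 𝕜 × TraceOneSphere 𝕜) :
    Function.Injective (mfderiv (boundaryModel 𝕜) (productModel 𝕜) (boundaryIncl 𝕜) n) := by
  intro ξ η h
  obtain ⟨a1, a2⟩ := mfderiv_boundaryIncl n ξ
  obtain ⟨b1, b2⟩ := mfderiv_boundaryIncl n η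
  rw [h] at a1 a2
  exact Prod.ext (injective_mvfderiv_sphere_coe_comp _ _ (a1.symm.trans b1))
    (injective_mvfderiv_sphere_coe_comp _ _ (a2.symm.trans b2))

/-- A tangent vector at a boundary point is tangent to the boundary if its ball component is
orthogonal to the radius. -/
theorem exists_mfderiv_boundaryIncl_iff (n : specialUnitaryGroup (Fin 2) 𝕜 × TraceOneSphere 𝕜)
    (v : TangentSpace (productModel 𝕜) (boundaryIncl 𝕜 n)) :
    (∃ ξ : TangentSpace (boundaryModel 𝕜) n,
      mfderiv (boundaryModel 𝕜) (productModel 𝕜) (boundaryIncl 𝕜) n ξ = v) ↔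
      ⟪coords n.2.1, ballDeriv _ v⟫ = 0 := by
  have h := exists_mvfderiv_sphere_coe_comp_iff (TraceOneSphere.diffeomorphSphere 𝕜) n.2
    (ballDeriv _ v)
  constructor
  · rintro ⟨ξ, rfl⟩
    exact h.1 ⟨ξ.2, (mfderiv_boundaryIncl n ξ).2.symm⟩
  · intro h0
    obtain ⟨w, hw⟩ := h.2 h0
    refine ⟨(v.1, w), tangent_ext ?_ ?_⟩
    · exact (mfderiv_boundaryIncl n (v.1, w)).1
    · exact (mfderiv_boundaryIncl n (v.1, w)).2.trans hw

/-- A tangent vector at a boundary point is tangent to the fibre of `K × ∂B → ∂B` if its ball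
component vanishes. -/
theorem exists_mfderiv_fibre_iff (n : specialUnitaryGroup (Fin 2) 𝕜 × TraceOneSphere 𝕜)
    (v : TangentSpace (productModel 𝕜) (boundaryIncl 𝕜 n)) :
    (∃ ξ : TangentSpace (boundaryModel 𝕜) n,
      mfderiv (boundaryModel 𝕜) (productModel 𝕜) (boundaryIncl 𝕜) n ξ = v ∧
      mfderiv (boundaryModel 𝕜) (𝓡 (finrank ℝ 𝕜)) Prod.snd n ξ = 0) ↔ ballDeriv _ v = 0 := by
  constructor
  · rintro ⟨ξ, rfl, h⟩
    rw [mfderiv_snd] at h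
    have h' : ξ.2 = 0 := h
    rw [(mfderiv_boundaryIncl n ξ).2, h']
    exact map_zero _
  · intro h0
    refine ⟨(v.1, 0), tangent_ext ?_ ?_, ?_⟩
    · exact (mfderiv_boundaryIncl n (v.1, 0)).1
    · refine (mfderiv_boundaryIncl n (v.1, 0)).2.trans ?_
      rw [h0]
      exact map_zero _
    · rw [mfderiv_snd]
      rfl

theorem mem_bVectorFields_iff
    {V : ∀ x : specialUnitaryGroup (Fin 2) 𝕜 × TraceOneBall 𝕜, TangentSpace (productModel 𝕜) x} :
    V ∈ bVectorFields (productModel 𝕜) (boundaryModel 𝕜) (boundaryIncl 𝕜) ↔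
      IsSmoothVectorField (productModel 𝕜) V ∧
      ∀ x, ‖coords x.2.1‖ = 1 → ⟪coords x.2.1, ballDeriv x (V x)⟫ = 0 := by
  refine and_congr_right fun _ => ⟨fun h x hx => ?_, fun h n => ?_⟩
  · rw [← mem_boundary_product_iff, ← range_boundaryIncl] at hx
    obtain ⟨n, rfl⟩ := hx
    exact (exists_mfderiv_boundaryIncl_iff n _).1 (h n)
  · exact (exists_mfderiv_boundaryIncl_iff n _).2 (h _ (TraceOneSphere.norm_coords n.2))

theorem mem_edgeVectorFields_iff
    {V : ∀ x : specialUnitaryGroup (Fin 2) 𝕜 × TraceOneBall 𝕜, TangentSpace (productModel 𝕜) x} :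
    V ∈ edgeVectorFields (productModel 𝕜) (boundaryModel 𝕜) (𝓡 (finrank ℝ 𝕜)) (boundaryIncl 𝕜)
        Prod.snd ↔
      IsSmoothVectorField (productModel 𝕜) V ∧
      ∀ x, ‖coords x.2.1‖ = 1 → ballDeriv x (V x) = 0 := by
  refine and_congr_right fun _ => ⟨fun h x hx => ?_, fun h n => ?_⟩
  · rw [← mem_boundary_product_iff, ← range_boundaryIncl] at hx
    obtain ⟨n, rfl⟩ := hx
    exact (exists_mfderiv_fibre_iff n _).1 (h n)
  · exact (exists_mfderiv_fibre_iff n _).2 (h _ (TraceOneSphere.norm_coords n.2))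

end BoundaryConditions

/-! ### The spans of the invariant vector fields -/

section Spans

open Matrix SpecialUnitary TraceOneBall Module
open scoped RealInnerProductSpace

variable {𝕜 : Type*} [RCLike 𝕜]

/-- The trace-free Hermitian matrix with given coordinates. -/
noncomputable def traceFree (y : WithLp 2 (ℝ × 𝕜)) : Matrix (Fin 2) (Fin 2) 𝕜 :=
  ofCoords y - ofCoords 0

theorem coords_traceFree (y : WithLp 2 (ℝ × 𝕜)) : coords (traceFree y) = y := by
  have h : traceFree y = ofCoords y + (-1 : ℝ) • ofCoords 0 := by
    rw [traceFree, neg_one_smul, sub_eq_add_neg]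
  rw [h, coords_add_smul, coords_ofCoords, coords_ofCoords, smul_zero, add_zero]

theorem conjTranspose_traceFree (y : WithLp 2 (ℝ × 𝕜)) : (traceFree y)ᴴ = traceFree y := by
  rw [traceFree, conjTranspose_sub, (isHermitian_ofCoords y).eq, (isHermitian_ofCoords 0).eq]

theorem trace_traceFree (y : WithLp 2 (ℝ × 𝕜)) : (traceFree y).trace = 0 := by
  rw [traceFree, trace_sub, trace_ofCoords, trace_ofCoords, sub_self]

theorem re_trace_mul_traceFree (b : TraceOneBall 𝕜) (y : WithLp 2 (ℝ × 𝕜)) :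
    RCLike.re (b.1 * traceFree y).trace = ⟪coords b.1, y⟫ / 2 := by
  have hb := ofCoords_coords b.2.1.1 b.2.2
  rw [← hb]
  generalize coords b.1 = p
  have h4 : (algebraMap ℝ 𝕜) 2 = 2 := map_ofNat _ 2
  have h1 := RCLike.add_conj (star p.snd * y.snd)
  have key : (ofCoords p * traceFree y).trace =
      (((p.fst * y.fst + RCLike.re (star p.snd * y.snd)) / 2 : ℝ) : 𝕜) := by
    generalize RCLike.re (star p.snd * y.snd) = r at h1 ⊢
    simp only [map_mul, RCLike.star_def, RCLike.conj_conj] at h1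
    simp only [trace_fin_two, mul_apply, Fin.sum_univ_two, traceFree, Matrix.sub_apply, ofCoords]
    simp [h4]
    linear_combination h1 / 4
  rw [key, RCLike.ofReal_re, coords_ofCoords, WithLp.prod_inner_apply]
  have h2 : ⟪p.snd, y.snd⟫ = RCLike.re (star p.snd * y.snd) := by
    rw [real_inner_eq_re_inner 𝕜, RCLike.inner_apply, RCLike.star_def, mul_comm]
  change _ = (y.fst * p.fst + ⟪p.snd, y.snd⟫) / 2
  rw [h2, mul_comm p.fst]

/-- Trace-free Hermitian matrices are recovered from their coordinates. -/
theorem traceFree_coords {m : Matrix (Fin 2) (Fin 2) 𝕜} (hm : mᴴ = m) (ht : m.trace = 0) :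
    traceFree (coords m) = m := by
  have h := ofCoords_coords (b := m + ofCoords 0)
    (by rw [IsHermitian, conjTranspose_add, hm, (isHermitian_ofCoords 0).eq])
    (by rw [trace_add, ht, trace_ofCoords, zero_add])
  rw [coords_add, coords_ofCoords, add_zero] at h
  rw [traceFree, h, add_sub_cancel_right]

/-- The matrix `[[α, -conj β], [β, conj α]]` with a given first column `(α, β)`. -/
def quaternionic (z : WithLp 2 (𝕜 × 𝕜)) : Matrix (Fin 2) (Fin 2) 𝕜 :=
  !![z.fst, -star z.snd; z.snd, star z.fst]

theorem add_star_of_inner_eq_zero {k : specialUnitaryGroup (Fin 2) 𝕜}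
    {z : WithLp 2 (𝕜 × 𝕜)} (hz : ⟪firstColumn k.1, z⟫ = 0) :
    star (k.1 0 0) * z.fst + star (k.1 1 0) * z.snd +
      (k.1 0 0 * star z.fst + k.1 1 0 * star z.snd) = 0 := by
  have h1 : RCLike.re (star (k.1 0 0) * z.fst + star (k.1 1 0) * z.snd) = 0 := by
    have h2 := inner_firstColumn k.1 (quaternionic z)
    change ⟪firstColumn k.1, z⟫ = _ at h2
    rw [hz, mul_apply, Fin.sum_univ_two] at h2
    exact h2.symm
  have h3 := RCLike.add_conj (star (k.1 0 0) * z.fst + star (k.1 1 0) * z.snd)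
  rw [h1] at h3
  simpa using h3

/-- A vector `z` tangent at the first column of `k` is the first column of `k κ` for the
anti-Hermitian matrix `κ = k* [z]`. -/
theorem conjTranspose_mul_quaternionic (k : specialUnitaryGroup (Fin 2) 𝕜)
    {z : WithLp 2 (𝕜 × 𝕜)} (hz : ⟪firstColumn k.1, z⟫ = 0) :
    (k.1ᴴ * quaternionic z)ᴴ = -(k.1ᴴ * quaternionic z) := by
  obtain ⟨h1, h2⟩ := entries 𝕜 k.2
  have h3 := add_star_of_inner_eq_zero hz
  ext i j
  fin_cases i <;> fin_cases j <;>
    simp [mul_apply, Fin.sum_univ_two, quaternionic, h1, h2, -RCLike.star_def]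
  · linear_combination h3
  · linear_combination h3

theorem trace_conjTranspose_mul_quaternionic (k : specialUnitaryGroup (Fin 2) 𝕜)
    {z : WithLp 2 (𝕜 × 𝕜)} (hz : ⟪firstColumn k.1, z⟫ = 0) :
    (k.1ᴴ * quaternionic z).trace = 0 := by
  obtain ⟨h1, h2⟩ := entries 𝕜 k.2
  have h3 := add_star_of_inner_eq_zero hz
  simp [trace_fin_two, mul_apply, Fin.sum_univ_two, quaternionic, h1, h2, -RCLike.star_def]
  linear_combination h3

/-- The element of the Lie algebra whose right-invariant field has, at `x`, the components
`z` and `(1 - ‖p‖²) y`. -/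
noncomputable def rightSymbol (x : specialUnitaryGroup (Fin 2) 𝕜 × TraceOneBall 𝕜)
    (z : WithLp 2 (𝕜 × 𝕜)) (y : WithLp 2 (ℝ × 𝕜)) : Matrix (Fin 2) (Fin 2) 𝕜 :=
  x.1.1 * (x.1.1ᴴ * quaternionic z - (1 / 2 : ℝ) •
    (traceFree ((2 : ℝ) • y) * (x.2.1 + x.2.1 - 1) -
      (x.2.1 + x.2.1 - 1) * traceFree ((2 : ℝ) • y)) + traceFree ((2 : ℝ) • y)) * x.1.1ᴴ

variable {x : specialUnitaryGroup (Fin 2) 𝕜 × TraceOneBall 𝕜}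
    {z : WithLp 2 (𝕜 × 𝕜)} {y : WithLp 2 (ℝ × 𝕜)}

/-- The decomposition into an anti-Hermitian and a Hermitian matrix is unique. -/
theorem parts_of_add {s h : Matrix (Fin 2) (Fin 2) 𝕜} (hs : sᴴ = -s) (hh : hᴴ = h) :
    skewPart (s + h) = s ∧ hermPart (s + h) = h := by
  rw [skewPart, hermPart, conjTranspose_add, hs, hh]
  constructor <;> module

theorem conj_rightSymbol : x.1.1ᴴ * rightSymbol x z y * x.1.1 =
    (x.1.1ᴴ * quaternionic z - (1 / 2 : ℝ) •
    (traceFree ((2 : ℝ) • y) * (x.2.1 + x.2.1 - 1) -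
      (x.2.1 + x.2.1 - 1) * traceFree ((2 : ℝ) • y))) + traceFree ((2 : ℝ) • y) := by
  rw [rightSymbol]
  generalize (x.1.1ᴴ * quaternionic z - _) + _ = m
  have h : x.1.1ᴴ * (x.1.1 * m * x.1.1ᴴ) * x.1.1 = (x.1.1ᴴ * x.1.1) * m * (x.1.1ᴴ * x.1.1) := by
    simp only [mul_assoc]
  rw [h, SpecialUnitary.conjTranspose_mul_self, one_mul, mul_one]

theorem trace_rightSymbol (hz : ⟪firstColumn x.1.1, z⟫ = 0) : (rightSymbol x z y).trace = 0 := by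
  rw [rightSymbol, trace_mul_comm, ← mul_assoc, SpecialUnitary.conjTranspose_mul_self, one_mul,
    trace_add, trace_sub, trace_conjTranspose_mul_quaternionic x.1 hz, trace_smul, trace_sub,
    trace_mul_comm, sub_self, trace_traceFree]
  simp

/-- The lift formulas of the right-invariant fields solved for the Lie algebra element. -/
theorem components_rightSymbol (hz : ⟪firstColumn x.1.1, z⟫ = 0) :
    firstColumn (rightColumn x (rightSymbol x z y)) = z ∧
      coords (rightBall x (rightSymbol x z y)) = (1 - ‖coords x.2.1‖ ^ 2) • y := by
  have hs : (x.1.1ᴴ * quaternionic z - (1 / 2 : ℝ) •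
    (traceFree ((2 : ℝ) • y) * (x.2.1 + x.2.1 - 1) -
      (x.2.1 + x.2.1 - 1) * traceFree ((2 : ℝ) • y)))ᴴ = -(x.1.1ᴴ * quaternionic z - (1 / 2 : ℝ) •
    (traceFree ((2 : ℝ) • y) * (x.2.1 + x.2.1 - 1) -
      (x.2.1 + x.2.1 - 1) * traceFree ((2 : ℝ) • y))) := by
    rw [conjTranspose_sub, conjTranspose_mul_quaternionic x.1 hz, conjTranspose_smul,
      conjTranspose_commutator (conjTranspose_traceFree _) (conjTranspose_two_mul_sub_one _),
      star_trivial]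
    module
  obtain ⟨h1, h2⟩ := parts_of_add hs (conjTranspose_traceFree ((2 : ℝ) • y))
  constructor
  · rw [rightColumn, conj_rightSymbol, h1, h2, sub_add_cancel, ← mul_assoc,
      SpecialUnitary.mul_conjTranspose_self, one_mul]
    rfl
  · rw [rightBall, conj_rightSymbol, h2, coords_smul, coords_traceFree, smul_smul]
    congr 1
    ring

/-- On the boundary, the left-invariant field of a trace-free Hermitian matrix that is orthogonal
to the radius moves the ball component by that matrix. -/
theorem leftBall_traceFree (hx : ‖coords x.2.1‖ = 1) (hy : ⟪coords x.2.1, y⟫ = 0) :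
    leftBall x (traceFree y) = traceFree y := by
  have hb : x.2.1ᴴ = x.2.1 := x.2.2.1.1.eq
  have h1 : hermPart (traceFree y) = traceFree y := by
    rw [hermPart, conjTranspose_traceFree]; module
  have h2 := hermPart_anticommutator (trace_traceFree y) hb x.2.2.2
  rw [h1, trace_mul_comm, re_trace_mul_traceFree, hy, zero_div, mul_zero, zero_smul] at h2
  rw [leftBall, hx, re_trace_mul_traceFree, hy, conjTranspose_traceFree]
  simp only [mul_add, add_mul, mul_sub, sub_mul, mul_one, one_mul] at h2
  have h3 : x.2.1 * traceFree y + traceFree y * x.2.1 = traceFree y +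
      (1 / 2 : ℝ) • (traceFree y * x.2.1 + traceFree y * x.2.1 - traceFree y +
      (x.2.1 * traceFree y + x.2.1 * traceFree y - traceFree y)) := by module
  rw [h3, h2]
  norm_num

/-- The lifts of left-invariant fields are tangent to the boundary. -/
theorem inner_leftBall (hx : ‖coords x.2.1‖ = 1) (V : Matrix (Fin 2) (Fin 2) 𝕜) : ⟪coords x.2.1, coords (leftBall x V)⟫ = 0 := by
  have hb : x.2.1ᴴ = x.2.1 := x.2.2.1.1.eq
  have hbb : x.2.1 * x.2.1 = x.2.1 := by rw [ball_mul_self, hx]; simp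
  have e1 : leftBall x V =
      x.2.1 * V + Vᴴ * x.2.1 - (2 * RCLike.re (x.2.1 * V).trace) • x.2.1 := by
    rw [leftBall, hx]; simp
  have h1 : (Vᴴ * x.2.1).trace = star (x.2.1 * V).trace := by
    rw [← trace_conjTranspose, conjTranspose_mul, hb]
  have h2 : (leftBall x V)ᴴ = leftBall x V := by
    rw [e1, conjTranspose_sub, conjTranspose_add, conjTranspose_mul, conjTranspose_mul,
      conjTranspose_conjTranspose, conjTranspose_smul, hb, star_trivial, add_comm (Vᴴ * _)]
  have h3 : (leftBall x V).trace = 0 := by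
    rw [e1, trace_sub, trace_add, h1, RCLike.star_def, RCLike.add_conj, trace_smul, x.2.2.2,
      RCLike.real_smul_eq_coe_mul]
    push_cast
    ring
  have h4 := re_trace_mul_traceFree x.2 (coords (leftBall x V))
  have h5 : (x.2.1 * (Vᴴ * x.2.1)).trace = (Vᴴ * x.2.1).trace := by
    rw [trace_mul_comm, mul_assoc, hbb]
  rw [traceFree_coords h2 h3, e1, mul_sub, mul_add, ← mul_assoc, hbb, mul_smul_comm, hbb,
    trace_sub, trace_add, h5, h1, trace_smul, x.2.2.2, RCLike.star_def, map_sub, map_add,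
    RCLike.conj_re, RCLike.smul_re, RCLike.one_re, ← e1] at h4
  linarith

variable (𝕜) in
theorem exists_mem_rightInvariantLifts (u : 𝕜 × 𝕜 × 𝕜) :
    ∃ W ∈ rightInvariantLifts 𝓘(ℝ, 𝕜 × 𝕜 × 𝕜) (productModel 𝕜) polarMap,
      ∀ x, columnDeriv x (W x) = rightColumnLinear x u ∧
        ballDeriv x (W x) = rightBallLinear x u := by
  obtain ⟨W, hW⟩ := exists_isLift_right (𝕜 := 𝕜) u
  exact ⟨W, ⟨u, hW⟩, components_of_isLift_right hW⟩

variable (𝕜) in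
theorem exists_mem_leftInvariantLifts (u : 𝕜 × 𝕜 × 𝕜) :
    ∃ W ∈ leftInvariantLifts 𝓘(ℝ, 𝕜 × 𝕜 × 𝕜) (productModel 𝕜) polarMap,
      ∀ x, columnDeriv x (W x) = leftColumnLinear x u ∧
        ballDeriv x (W x) = leftBallLinear x u := by
  obtain ⟨W, hW⟩ := exists_isLift_left (𝕜 := 𝕜) u
  exact ⟨W, ⟨u, hW⟩, components_of_isLift_left hW⟩

theorem slMatrix_entries {m : Matrix (Fin 2) (Fin 2) 𝕜} (hm : m.trace = 0) :
    slMatrix (m 0 0, m 0 1, m 1 0) = m := by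
  rw [trace_fin_two] at hm
  ext i j
  fin_cases i <;> fin_cases j <;> simp [slMatrix]
  linear_combination -hm

theorem SmoothEntriesOn.contMDiff_entries
    {m : specialUnitaryGroup (Fin 2) 𝕜 × TraceOneBall 𝕜 → Matrix (Fin 2) (Fin 2) 𝕜}
    (hm : SmoothEntriesOn (productModel 𝕜) m Set.univ) :
    ContMDiff (productModel 𝕜) 𝓘(ℝ, 𝕜 × 𝕜 × 𝕜) ∞ (fun x => (m x 0 0, m x 0 1, m x 1 0)) :=
  contMDiffOn_univ.1 ((hm 0 0).prodMk_space ((hm 0 1).prodMk_space (hm 1 0)))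

theorem smoothEntriesOn_quaternionic
    {z : specialUnitaryGroup (Fin 2) 𝕜 × TraceOneBall 𝕜 → WithLp 2 (𝕜 × 𝕜)}
    (hz : ContMDiff (productModel 𝕜) 𝓘(ℝ, WithLp 2 (𝕜 × 𝕜)) ∞ z) :
    SmoothEntriesOn (productModel 𝕜) (fun x => quaternionic (z x)) Set.univ := by
  have hL := (WithLp.prodContinuousLinearEquiv 2 ℝ 𝕜 𝕜).contDiff (n := ∞)
  have h1 : ContDiff ℝ ∞ (fun x : WithLp 2 (𝕜 × 𝕜) => x.fst) := contDiff_fst.comp hL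
  have h2 : ContDiff ℝ ∞ (fun x : WithLp 2 (𝕜 × 𝕜) => x.snd) := contDiff_snd.comp hL
  have hs := (RCLike.conjCLE (K := 𝕜)).contDiff (n := ∞)
  have key : ∀ i j, ContDiff ℝ ∞ (fun x : WithLp 2 (𝕜 × 𝕜) => quaternionic x i j) := by
    intro i j
    fin_cases i <;> fin_cases j
    · exact h1
    · exact (hs.comp h2).neg
    · exact h2
    · exact hs.comp h1
  exact fun i j => ((key i j).contMDiff.comp hz).contMDiffOn

theorem smoothEntriesOn_traceFree
    {y : specialUnitaryGroup (Fin 2) 𝕜 × TraceOneBall 𝕜 → WithLp 2 (ℝ × 𝕜)}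
    (hy : ContMDiff (productModel 𝕜) 𝓘(ℝ, WithLp 2 (ℝ × 𝕜)) ∞ y) :
    SmoothEntriesOn (productModel 𝕜) (fun x => traceFree (y x)) Set.univ :=
  (smoothEntriesOn_ofCoords hy.contMDiffOn).sub (.const _)

theorem smoothEntriesOn_rightSymbol
    {z : specialUnitaryGroup (Fin 2) 𝕜 × TraceOneBall 𝕜 → WithLp 2 (𝕜 × 𝕜)}
    {y : specialUnitaryGroup (Fin 2) 𝕜 × TraceOneBall 𝕜 → WithLp 2 (ℝ × 𝕜)}
    (hz : ContMDiff (productModel 𝕜) 𝓘(ℝ, WithLp 2 (𝕜 × 𝕜)) ∞ z)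
    (hy : ContMDiff (productModel 𝕜) 𝓘(ℝ, WithLp 2 (ℝ × 𝕜)) ∞ y) :
    SmoothEntriesOn (productModel 𝕜) (fun x => rightSymbol x (z x) (y x)) Set.univ := by
  have h2 : ContDiff ℝ ∞ (fun v : WithLp 2 (ℝ × 𝕜) => (2 : ℝ) • v) := by fun_prop
  have ht := smoothEntriesOn_traceFree (h2.contMDiff.comp hy)
  have hp := smoothEntriesOn_two_mul_sub_one (𝕜 := 𝕜) (s := Set.univ)
  have hk := smoothEntriesOn_unitary (𝕜 := 𝕜) (s := Set.univ)
  exact (hk.mul (((hk.conjTranspose.mul (smoothEntriesOn_quaternionic hz)).sub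
    (((ht.mul hp).sub (hp.mul ht)).const_smul _)).add ht)).mul hk.conjTranspose

variable {V : ∀ x : specialUnitaryGroup (Fin 2) 𝕜 × TraceOneBall 𝕜,
  TangentSpace (productModel 𝕜) x}

/-- Edge vector fields are combinations of right-invariant ones: by Hadamard's lemma the ball
component is `1 - ‖p‖²` times a smooth function, and the right-invariant fields then realize all
values of the two components. -/
theorem mem_smoothSpan_right (hV : IsSmoothVectorField (productModel 𝕜) V)
    (h0 : ∀ x, ‖coords x.2.1‖ = 1 → ballDeriv x (V x) = 0) :
    V ∈ smoothSpan (productModel 𝕜)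
      (rightInvariantLifts 𝓘(ℝ, 𝕜 × 𝕜 × 𝕜) (productModel 𝕜) polarMap) := by
  obtain ⟨hz, hq⟩ := hV.contMDiff_components
  obtain ⟨y, hy, hyq⟩ := exists_contMDiff_smul_eq hq h0
  refine mem_smoothSpan_of_components (exists_mem_rightInvariantLifts 𝕜)
    (smoothEntriesOn_rightSymbol hz hy).contMDiff_entries fun x => ?_
  have h1 := components_rightSymbol (x := x) (y := y x) (inner_columnDeriv (V x))
  have h2 := slMatrix_entries (trace_rightSymbol (x := x) (y := y x) (inner_columnDeriv (V x)))
  constructor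
  · change _ = firstColumn (rightColumn x (slMatrix _))
    rw [h2, h1.1]
  · change _ = coords (rightBall x (slMatrix _))
    rw [h2, h1.2, hyq]

theorem smoothSpan_right_eq :
    smoothSpan (productModel 𝕜)
      (rightInvariantLifts 𝓘(ℝ, 𝕜 × 𝕜 × 𝕜) (productModel 𝕜) polarMap) =
      edgeVectorFields (productModel 𝕜) (boundaryModel 𝕜) (𝓡 (finrank ℝ 𝕜)) (boundaryIncl 𝕜)
        Prod.snd := by
  ext V
  rw [mem_edgeVectorFields_iff]
  refine ⟨fun hV => ⟨isSmoothVectorField_of_mem_smoothSpan ?_ hV, ?_⟩,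
    fun hV => mem_smoothSpan_right hV.1 hV.2⟩
  · rintro W ⟨v, hW⟩
    exact hW.1
  obtain ⟨n, f, W, hW, hV⟩ := hV
  intro x hx
  rw [hV, ballDeriv_sum]
  refine Finset.sum_eq_zero fun i _ => ?_
  obtain ⟨v, hv⟩ := hW i
  rw [(components_of_isLift_right hv x).2, rightBall, coords_smul, hx]
  simp

theorem smoothSpan_mono {S T : Set (∀ x : specialUnitaryGroup (Fin 2) 𝕜 × TraceOneBall 𝕜,
    TangentSpace (productModel 𝕜) x)} (h : S ⊆ T) :
    smoothSpan (productModel 𝕜) S ⊆ smoothSpan (productModel 𝕜) T := by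
  rintro V ⟨n, f, W, hW, hV⟩
  exact ⟨n, f, W, fun i => h (hW i), hV⟩

theorem add_mem_smoothSpan {S : Set (∀ x : specialUnitaryGroup (Fin 2) 𝕜 × TraceOneBall 𝕜,
      TangentSpace (productModel 𝕜) x)}
    {V₁ V₂ : ∀ x : specialUnitaryGroup (Fin 2) 𝕜 × TraceOneBall 𝕜,
      TangentSpace (productModel 𝕜) x}
    (h₁ : V₁ ∈ smoothSpan (productModel 𝕜) S) (h₂ : V₂ ∈ smoothSpan (productModel 𝕜) S) :
    (fun x => V₁ x + V₂ x) ∈ smoothSpan (productModel 𝕜) S := by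
  obtain ⟨n₁, f₁, W₁, hW₁, hV₁⟩ := h₁
  obtain ⟨n₂, f₂, W₂, hW₂, hV₂⟩ := h₂
  refine ⟨n₁ + n₂, Fin.append f₁ f₂, Fin.append W₁ W₂, fun i => ?_, fun x => ?_⟩
  · induction i using Fin.addCases with
    | left i => simpa using hW₁ i
    | right i => simpa using hW₂ i
  · dsimp only
    rw [Fin.sum_univ_add, hV₁, hV₂]
    simp

/-- Vector fields tangent to the boundary are combinations of left- and right-invariant ones:
a suitable combination of left-invariant fields has the same ball component on the boundary. -/
theorem mem_smoothSpan_left_right (hV : IsSmoothVectorField (productModel 𝕜) V)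
    (h0 : ∀ x, ‖coords x.2.1‖ = 1 → ⟪coords x.2.1, ballDeriv x (V x)⟫ = 0) :
    V ∈ smoothSpan (productModel 𝕜)
      (leftInvariantLifts 𝓘(ℝ, 𝕜 × 𝕜 × 𝕜) (productModel 𝕜) polarMap ∪
        rightInvariantLifts 𝓘(ℝ, 𝕜 × 𝕜 × 𝕜) (productModel 𝕜) polarMap) := by
  obtain ⟨hz, hq⟩ := hV.contMDiff_components
  have hQ := smoothEntriesOn_traceFree hq
  have hc := contMDiffOn_univ.1 (smoothEntriesOn_leftColumn hQ).firstColumn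
  have hb := contMDiffOn_univ.1 (smoothEntriesOn_leftBall hQ).coords
  obtain ⟨L, hL, hLc⟩ := exists_isSmoothVectorField hc hb fun x => inner_leftColumn x _
  obtain ⟨R, hR, hRc⟩ := exists_isSmoothVectorField (hz.sub hc) (hq.sub hb) fun x => by
    rw [inner_sub_right, inner_columnDeriv, inner_leftColumn, sub_zero]
  have e : V = fun x => L x + R x := by
    funext x
    have h1 := columnDeriv_sum (x := x) ![1, 1] ![L x, R x]
    have h2 := ballDeriv_sum (x := x) ![1, 1] ![L x, R x]
    simp only [Fin.sum_univ_two, Matrix.cons_val_zero, Matrix.cons_val_one, one_smul] at h1 h2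
    apply tangent_ext
    · rw [h1, (hLc x).1, (hRc x).1, add_sub_cancel]
    · rw [h2, (hLc x).2, (hRc x).2, add_sub_cancel]
  rw [e]
  refine add_mem_smoothSpan (smoothSpan_mono Set.subset_union_left ?_)
    (smoothSpan_mono Set.subset_union_right (mem_smoothSpan_right hR fun x hx => ?_))
  · refine mem_smoothSpan_of_components (exists_mem_leftInvariantLifts 𝕜) hQ.contMDiff_entries
      fun x => ?_
    have h2 := slMatrix_entries (trace_traceFree (ballDeriv x (V x)))
    constructor
    · change _ = firstColumn (leftColumn x (slMatrix _))
      rw [h2, (hLc x).1]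
    · change _ = coords (leftBall x (slMatrix _))
      rw [h2, (hLc x).2]
  · rw [(hRc x).2, leftBall_traceFree hx (h0 x hx), coords_traceFree, sub_self]

theorem smoothSpan_left_right_eq :
    smoothSpan (productModel 𝕜)
      (leftInvariantLifts 𝓘(ℝ, 𝕜 × 𝕜 × 𝕜) (productModel 𝕜) polarMap ∪
        rightInvariantLifts 𝓘(ℝ, 𝕜 × 𝕜 × 𝕜) (productModel 𝕜) polarMap) =
      bVectorFields (productModel 𝕜) (boundaryModel 𝕜) (boundaryIncl 𝕜) := by
  ext V
  rw [mem_bVectorFields_iff]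
  refine ⟨fun hV => ⟨isSmoothVectorField_of_mem_smoothSpan ?_ hV, ?_⟩,
    fun hV => mem_smoothSpan_left_right hV.1 hV.2⟩
  · rintro W (⟨v, hW⟩ | ⟨v, hW⟩) <;> exact hW.1
  obtain ⟨n, f, W, hW, hV⟩ := hV
  intro x hx
  rw [hV, ballDeriv_sum, inner_sum]
  refine Finset.sum_eq_zero fun i _ => ?_
  rw [inner_smul_right]
  rcases hW i with ⟨v, hv⟩ | ⟨v, hv⟩
  · rw [(components_of_isLift_left hv x).2, inner_leftBall hx (slMatrix v), mul_zero]
  · rw [(components_of_isLift_right hv x).2, rightBall, coords_smul, hx]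
    simp

end Spans

/-! ### Charts near the boundary -/

section BoundaryCharts

open Module

variable {EX HX X W : Type*} [NormedAddCommGroup EX] [NormedSpace ℝ EX] [TopologicalSpace HX]
  {IX : ModelWithCorners ℝ EX HX} [TopologicalSpace X] [ChartedSpace HX X]
  [NormedAddCommGroup W] [NormedSpace ℝ W] [FiniteDimensional ℝ W]

/-- Mutually inverse smooth maps between open subsets of a manifold and of a finite-dimensional
normed space give a smooth chart with values in a Euclidean space. -/
theorem exists_euclidean_chart {U : Set X} (hU : IsOpen U) {O : Set W} (hO : IsOpen O)
    {f : X → W} {g : W → X} (hf : ContMDiffOn IX 𝓘(ℝ, W) ∞ f U)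
    (hg : ContMDiffOn 𝓘(ℝ, W) IX ∞ g O) (hfU : Set.MapsTo f U O) (hgO : Set.MapsTo g O U)
    (hgf : ∀ x ∈ U, g (f x) = x) (hfg : ∀ w ∈ O, f (g w) = w) {x : X} (hx : x ∈ U) :
    ∃ (n : ℕ) (e : OpenPartialHomeomorph X (EuclideanSpace ℝ (Fin n))), x ∈ e.source ∧
      ContMDiffOn IX (𝓡 n) ∞ e e.source ∧ ContMDiffOn (𝓡 n) IX ∞ e.symm e.target := by
  let A : W ≃L[ℝ] EuclideanSpace ℝ (Fin (finrank ℝ W)) := toEuclidean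
  have h1 : ContMDiffOn IX (𝓡 (finrank ℝ W)) ∞ (fun x => A (f x)) U :=
    A.contDiff.contMDiff.comp_contMDiffOn hf
  have h2 : ContMDiffOn (𝓡 (finrank ℝ W)) IX ∞ (fun w => g (A.symm w)) (A.symm ⁻¹' O) :=
    hg.comp A.symm.contDiff.contMDiff.contMDiffOn fun w hw => hw
  exact ⟨finrank ℝ W,
    { toFun := fun x => A (f x)
      invFun := fun w => g (A.symm w)
      source := U
      target := A.symm ⁻¹' O
      map_source' := fun x hx => by simpa using hfU hx
      map_target' := fun w hw => hgO hw
      left_inv' := fun x hx => by simpa using hgf x hx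
      right_inv' := fun w hw => by simp [hfg _ hw]
      open_source := hU
      open_target := hO.preimage A.symm.continuous
      continuousOn_toFun := h1.continuousOn
      continuousOn_invFun := h2.continuousOn }, hx, h1, h2⟩

variable (W) in
theorem exists_equiv_euclidean_succ :
    ∃ A : (ℝ × W) ≃L[ℝ] EuclideanSpace ℝ (Fin (finrank ℝ W + 1)), ∀ p, A p 0 = p.1 :=
  ⟨(((ContinuousLinearEquiv.refl ℝ ℝ).prodCongr ((toEuclidean (E := W)).trans
    (EuclideanSpace.equiv (Fin (finrank ℝ W)) ℝ))).trans
    (Fin.consEquivL ℝ (fun _ : Fin (finrank ℝ W + 1) => ℝ))).trans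
    (EuclideanSpace.equiv (Fin (finrank ℝ W + 1)) ℝ).symm, fun _ => rfl⟩

/-- Mutually inverse smooth maps between an open subset of a manifold and a relatively open subset
of a half-space give a smooth chart with values in a Euclidean half-space. -/
theorem exists_halfSpace_chart {U : Set X} (hU : IsOpen U) {O : Set (ℝ × W)} (hO : IsOpen O)
    {f : X → ℝ × W} {g : ℝ × W → X} (hf : ContMDiffOn IX 𝓘(ℝ, ℝ × W) ∞ f U)
    (hg : ContMDiffOn 𝓘(ℝ, ℝ × W) IX ∞ g (O ∩ {p | 0 ≤ p.1}))
    (hfU : Set.MapsTo f U (O ∩ {p | 0 ≤ p.1})) (hgO : Set.MapsTo g (O ∩ {p | 0 ≤ p.1}) U)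
    (hgf : ∀ x ∈ U, g (f x) = x) (hfg : ∀ w ∈ O ∩ {p | 0 ≤ p.1}, f (g w) = w) {x : X}
    (hx : x ∈ U) :
    ∃ (n : ℕ) (e : OpenPartialHomeomorph X (EuclideanHalfSpace (n + 1))), x ∈ e.source ∧
      ContMDiffOn IX (𝓡∂ (n + 1)) ∞ e e.source ∧
      ContMDiffOn (𝓡∂ (n + 1)) IX ∞ e.symm e.target := by
  obtain ⟨A, hA⟩ := exists_equiv_euclidean_succ W
  let J := 𝓡∂ (finrank ℝ W + 1)
  have hJr : Set.range J = {y | 0 ≤ y 0} := range_euclideanHalfSpace _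
  have hJ : ∀ y : EuclideanHalfSpace (finrank ℝ W + 1), 0 ≤ (A.symm (J y)).1 := by
    intro y
    rw [← hA, A.apply_symm_apply]
    exact y.2
  have hJ' : ∀ p : ℝ × W, 0 ≤ p.1 → J (J.symm (A p)) = A p := by
    intro p hp
    refine J.right_inv ?_
    rw [hJr]
    exact hp.trans_eq (hA p).symm
  have h1 : ContMDiffOn IX J ∞ (fun x => J.symm (A (f x))) U := by
    refine J.contMDiffOn_symm.comp (A.contDiff.contMDiff.comp_contMDiffOn hf) fun x hx => ?_
    rw [hJr]
    exact (hfU hx).2.trans_eq (hA (f x)).symm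
  have h2 : ContMDiffOn J IX ∞ (fun y => g (A.symm (J y))) ((fun y => A.symm (J y)) ⁻¹' O) :=
    hg.comp (A.symm.contDiff.contMDiff.comp J.contMDiff).contMDiffOn fun y hy => ⟨hy, hJ y⟩
  exact ⟨finrank ℝ W,
    { toFun := fun x => J.symm (A (f x))
      invFun := fun y => g (A.symm (J y))
      source := U
      target := (fun y => A.symm (J y)) ⁻¹' O
      map_source' := fun x hx => by
        change A.symm (J (J.symm (A (f x)))) ∈ O
        rw [hJ' _ (hfU hx).2, A.symm_apply_apply]
        exact (hfU hx).1
      map_target' := fun y hy => hgO ⟨hy, hJ y⟩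
      left_inv' := fun x hx => by
        rw [hJ' _ (hfU hx).2, A.symm_apply_apply, hgf x hx]
      right_inv' := fun y hy => by
        rw [hfg _ ⟨hy, hJ y⟩, A.apply_symm_apply, J.left_inv]
      open_source := hU
      open_target := hO.preimage (A.symm.continuous.comp J.continuous)
      continuousOn_toFun := h1.continuousOn
      continuousOn_invFun := h2.continuousOn }, hx, h1, h2⟩

end BoundaryCharts

/-! ### The compactification -/

section ProductBoundary

open Matrix SpecialUnitary TraceOneBall Module Metric

variable {𝕜 : Type*} [RCLike 𝕜]

/-- In the interior, charts of `K` and the linear coordinates of the ball form a chart. -/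
theorem exists_interior_chart {x : specialUnitaryGroup (Fin 2) 𝕜 × TraceOneBall 𝕜}
    (hx : ‖coords x.2.1‖ < 1) :
    ∃ (n : ℕ) (e : OpenPartialHomeomorph (specialUnitaryGroup (Fin 2) 𝕜 × TraceOneBall 𝕜)
      (EuclideanSpace ℝ (Fin n))), x ∈ e.source ∧
      ContMDiffOn (productModel 𝕜) (𝓡 n) ∞ e e.source ∧
      ContMDiffOn (𝓡 n) (productModel 𝕜) ∞ e.symm e.target := by
  let c := chartAt (EuclideanSpace ℝ (Fin (2 * finrank ℝ 𝕜 - 1))) x.1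
  have hc : ContMDiffOn (𝓡 (2 * finrank ℝ 𝕜 - 1)) (𝓡 (2 * finrank ℝ 𝕜 - 1)) ∞ c c.source :=
    contMDiffOn_chart
  have hc' : ContMDiffOn (𝓡 (2 * finrank ℝ 𝕜 - 1)) (𝓡 (2 * finrank ℝ 𝕜 - 1)) ∞ c.symm c.target :=
    contMDiffOn_chart_symm
  have hm := (model 𝕜).contMDiffOn_symm (n := ∞)
  rw [range_model] at hm
  refine exists_euclidean_chart
    (W := EuclideanSpace ℝ (Fin (2 * finrank ℝ 𝕜 - 1)) × WithLp 2 (ℝ × 𝕜))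
    (U := c.source ×ˢ {b : TraceOneBall 𝕜 | ‖coords b.1‖ < 1}) (O := c.target ×ˢ {p | ‖p‖ < 1})
    (f := fun x => (c x.1, coords x.2.1)) (g := fun w => (c.symm w.1, (model 𝕜).symm w.2))
    (c.open_source.prod (isOpen_lt (continuous_coords.comp continuous_subtype_val).norm
      continuous_const)) (c.open_target.prod (isOpen_lt continuous_norm continuous_const))
    ?_ ?_ ?_ ?_ ?_ ?_ ⟨mem_chart_source _ x.1, hx⟩
  · exact (hc.comp contMDiffOn_fst fun x hx => hx.1).prodMk_space contMDiff_ball_coords.contMDiffOn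
  · exact (hc'.comp (contDiff_fst (𝕜 := ℝ)).contMDiff.contMDiffOn fun x hx => hx.1).prodMk
      (hm.comp (contDiff_snd (𝕜 := ℝ)).contMDiff.contMDiffOn fun w hw => by
        have h : ‖w.2‖ < 1 := hw.2
        simpa using h.le)
  · exact fun y hy => ⟨c.map_source hy.1, hy.2⟩
  · intro w hw
    have h : ‖w.2‖ < 1 := hw.2
    refine ⟨c.map_target hw.1, ?_⟩
    change ‖coords ((model 𝕜).symm w.2).1‖ < 1
    rwa [coords_model_symm h.le]
  · exact fun y hy => Prod.ext (c.left_inv hy.1) (model_symm_coords y.2)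
  · intro w hw
    have h : ‖w.2‖ < 1 := hw.2
    exact Prod.ext (c.right_inv hw.1) (coords_model_symm h.le)

/-- Near the boundary, `(k, (1 - u) s)` with `s` on the sphere has the coordinates `u` and those
of `(k, s)` in a chart of `K × ∂B`. -/
theorem exists_boundary_chart (m : specialUnitaryGroup (Fin 2) 𝕜 × TraceOneSphere 𝕜) :
    ∃ (n : ℕ) (e : OpenPartialHomeomorph (specialUnitaryGroup (Fin 2) 𝕜 × TraceOneBall 𝕜)
      (EuclideanHalfSpace (n + 1))), boundaryIncl 𝕜 m ∈ e.source ∧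
      ContMDiffOn (productModel 𝕜) (𝓡∂ (n + 1)) ∞ e e.source ∧
      ContMDiffOn (𝓡∂ (n + 1)) (productModel 𝕜) ∞ e.symm e.target := by
  let Φ := TraceOneSphere.diffeomorphSphere 𝕜
  let ρ := radialProjection Φ m.2
  have hΦ : ∀ s, ‖(Φ s : WithLp 2 (ℝ × 𝕜))‖ = 1 := fun s => mem_sphere_zero_iff_norm.1 (Φ s).2
  let c := chartAt (EuclideanSpace ℝ (Fin (2 * finrank ℝ 𝕜 - 1))) m.1
  have hc : ContMDiffOn (𝓡 (2 * finrank ℝ 𝕜 - 1)) (𝓡 (2 * finrank ℝ 𝕜 - 1)) ∞ c c.source :=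
    contMDiffOn_chart
  have hc' : ContMDiffOn (𝓡 (2 * finrank ℝ 𝕜 - 1)) (𝓡 (2 * finrank ℝ 𝕜 - 1)) ∞ c.symm c.target :=
    contMDiffOn_chart_symm
  let d := chartAt (EuclideanSpace ℝ (Fin (finrank ℝ 𝕜))) m.2
  have hd : ContMDiffOn (𝓡 (finrank ℝ 𝕜)) (𝓡 (finrank ℝ 𝕜)) ∞ d d.source := contMDiffOn_chart
  have hd' : ContMDiffOn (𝓡 (finrank ℝ 𝕜)) (𝓡 (finrank ℝ 𝕜)) ∞ d.symm d.target :=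
    contMDiffOn_chart_symm
  have hm := (model 𝕜).contMDiffOn_symm (n := ∞)
  rw [range_model] at hm
  have hρ : ContMDiffOn 𝓘(ℝ, WithLp 2 (ℝ × 𝕜)) (𝓡 (finrank ℝ 𝕜)) ∞ ρ {a | a ≠ 0} :=
    contMDiffOn_radialProjection Φ m.2
  have hD : IsOpen ({a : WithLp 2 (ℝ × 𝕜) | a ≠ 0} ∩ ρ ⁻¹' d.source) :=
    hρ.continuousOn.isOpen_inter_preimage isOpen_ne d.open_source
  have hnorm : ∀ (u : ℝ) (s : TraceOneSphere 𝕜), 0 ≤ u → u < 1 →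
      ‖(1 - u) • (Φ s : WithLp 2 (ℝ × 𝕜))‖ = 1 - u := by
    intro u s _ h1
    rw [norm_smul, hΦ, mul_one, Real.norm_of_nonneg (by linarith)]
  have hinv : ∀ a : WithLp 2 (ℝ × 𝕜), a ≠ 0 → ‖a‖ • (Φ (ρ a) : WithLp 2 (ℝ × 𝕜)) = a := by
    intro a ha
    rw [coe_radialProjection Φ m.2 ha, smul_smul, mul_inv_cancel₀ (norm_ne_zero_iff.2 ha), one_smul]
  refine exists_halfSpace_chart
    (W := EuclideanSpace ℝ (Fin (2 * finrank ℝ 𝕜 - 1)) × EuclideanSpace ℝ (Fin (finrank ℝ 𝕜)))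
    (U := c.source ×ˢ {b : TraceOneBall 𝕜 | coords b.1 ∈ ({a : WithLp 2 (ℝ × 𝕜) | a ≠ 0} ∩ ρ ⁻¹' d.source)})
    (O := Set.Iio (1 : ℝ) ×ˢ (c.target ×ˢ d.target))
    (f := fun x => (1 - ‖coords x.2.1‖, (c x.1, d (ρ (coords x.2.1)))))
    (g := fun w => (c.symm w.2.1,
      (model 𝕜).symm ((1 - w.1) • (Φ (d.symm w.2.2) : WithLp 2 (ℝ × 𝕜)))))
    (c.open_source.prod (hD.preimage (continuous_coords.comp continuous_subtype_val)))
    (isOpen_Iio.prod (c.open_target.prod d.open_target)) ?_ ?_ ?_ ?_ ?_ ?_ ?_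
  · refine ContMDiffOn.prodMk_space ?_ (ContMDiffOn.prodMk_space
      (hc.comp contMDiffOn_fst fun x hx => hx.1) ?_)
    · have h1 : ContDiffOn ℝ ∞ (fun a : WithLp 2 (ℝ × 𝕜) => 1 - ‖a‖) {a | a ≠ 0} :=
        fun a ha => (contDiffAt_const.sub (contDiffAt_id.norm ℝ ha)).contDiffWithinAt
      exact h1.contMDiffOn.comp contMDiff_ball_coords.contMDiffOn fun x hx => hx.2.1
    · have h1 := hρ.comp contMDiff_ball_coords.contMDiffOn
        (s := c.source ×ˢ {b : TraceOneBall 𝕜 |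
          coords b.1 ∈ ({a : WithLp 2 (ℝ × 𝕜) | a ≠ 0} ∩ ρ ⁻¹' d.source)}) fun x hx => hx.2.1
      exact hd.comp h1 fun x hx => hx.2.2
  · have h1 : ContMDiffOn 𝓘(ℝ, ℝ × EuclideanSpace ℝ (Fin (2 * finrank ℝ 𝕜 - 1)) ×
        EuclideanSpace ℝ (Fin (finrank ℝ 𝕜))) (𝓡 (finrank ℝ 𝕜)) ∞
        (fun w => d.symm w.2.2) (Set.Iio (1 : ℝ) ×ˢ (c.target ×ˢ d.target) ∩ {p | 0 ≤ p.1}) :=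
      hd'.comp ((contDiff_snd (𝕜 := ℝ)).comp (contDiff_snd (𝕜 := ℝ))).contMDiff.contMDiffOn
        fun w hw => hw.1.2.2
    have h2 := (contMDiff_sphere_coe_comp Φ).comp_contMDiffOn h1
    have h3 : ContDiff ℝ ∞ (fun w : ℝ × EuclideanSpace ℝ (Fin (2 * finrank ℝ 𝕜 - 1)) ×
        EuclideanSpace ℝ (Fin (finrank ℝ 𝕜)) => 1 - w.1) := by fun_prop
    refine (hc'.comp ((contDiff_fst (𝕜 := ℝ)).comp (contDiff_snd (𝕜 := ℝ))).contMDiff.contMDiffOn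
        fun w hw => hw.1.2.1).prodMk (hm.comp (h3.contMDiff.contMDiffOn.smul h2) fun w hw => ?_)
    have h4 := hnorm w.1 (d.symm w.2.2) hw.2 hw.1.1
    have h5 : 0 ≤ w.1 := hw.2
    change (1 - w.1) • (Φ (d.symm w.2.2) : WithLp 2 (ℝ × 𝕜)) ∈ closedBall 0 1
    rw [mem_closedBall_zero_iff, h4]
    linarith
  · intro x hx
    have h1 := norm_coords_le x.2
    have h2 : 0 < ‖coords x.2.1‖ := norm_pos_iff.2 hx.2.1
    refine ⟨⟨?_, c.map_source hx.1, d.map_source hx.2.2⟩, ?_⟩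
    · change 1 - ‖coords x.2.1‖ < 1
      linarith
    · change 0 ≤ 1 - ‖coords x.2.1‖
      linarith
  · intro w hw
    have hu : 0 ≤ w.1 := hw.2
    have hu' : w.1 < 1 := hw.1.1
    have h4 := hnorm w.1 (d.symm w.2.2) hu hu'
    have h5 : ρ ((1 - w.1) • (Φ (d.symm w.2.2) : WithLp 2 (ℝ × 𝕜))) = d.symm w.2.2 :=
      radialProjection_smul Φ m.2 _ (by linarith)
    refine ⟨c.map_target hw.1.2.1, ?_⟩
    have h6 := coords_model_symm (𝕜 := 𝕜)
      (x := (1 - w.1) • (Φ (d.symm w.2.2) : WithLp 2 (ℝ × 𝕜))) (by rw [h4]; linarith)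
    rw [Set.mem_ofPred_eq, h6]
    refine ⟨norm_ne_zero_iff.1 (by rw [h4]; linarith), ?_⟩
    rw [Set.mem_preimage, h5]
    exact d.map_target hw.1.2.2
  · intro x hx
    refine Prod.ext (c.left_inv hx.1) ?_
    change (model 𝕜).symm ((1 - (1 - ‖coords x.2.1‖)) •
      (Φ (d.symm (d (ρ (coords x.2.1)))) : WithLp 2 (ℝ × 𝕜))) = x.2
    rw [d.left_inv hx.2.2, sub_sub_cancel, hinv _ hx.2.1, model_symm_coords]
  · intro w hw
    have hu : 0 ≤ w.1 := hw.2
    have hu' : w.1 < 1 := hw.1.1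
    have h4 := hnorm w.1 (d.symm w.2.2) hu hu'
    have h5 : ρ ((1 - w.1) • (Φ (d.symm w.2.2) : WithLp 2 (ℝ × 𝕜))) = d.symm w.2.2 :=
      radialProjection_smul Φ m.2 _ (by linarith)
    have h6 := coords_model_symm (𝕜 := 𝕜)
      (x := (1 - w.1) • (Φ (d.symm w.2.2) : WithLp 2 (ℝ × 𝕜))) (by rw [h4]; linarith)
    simp only [h6, h4, h5, c.right_inv hw.1.2.1, d.right_inv hw.1.2.2, sub_sub_cancel]
  · have h1 : ρ (coords (boundaryIncl 𝕜 m).2.1) = m.2 := by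
      have := radialProjection_smul Φ m.2 m.2 one_pos
      rwa [one_smul] at this
    refine ⟨mem_chart_source _ m.1, ?_, ?_⟩
    · refine norm_ne_zero_iff.1 ?_
      rw [show ‖coords (boundaryIncl 𝕜 m).2.1‖ = 1 from hΦ m.2]
      exact one_ne_zero
    · rw [Set.mem_preimage, h1]
      exact mem_chart_source _ m.2

theorem isManifoldWithBoundary_product :
    IsManifoldWithBoundary (productModel 𝕜)
      (X := specialUnitaryGroup (Fin 2) 𝕜 × TraceOneBall 𝕜) := by
  intro x
  rcases (norm_coords_le x.2).lt_or_eq with hx | hx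
  · exact Or.inl (exists_interior_chart hx)
  · rw [← mem_boundary_product_iff, ← range_boundaryIncl] at hx
    obtain ⟨m, rfl⟩ := hx
    exact Or.inr (exists_boundary_chart m)

theorem isCompactification_polarMap :
    IsCompactification 𝓘(ℝ, 𝕜 × 𝕜 × 𝕜) (productModel 𝕜) (polarMap (𝕜 := 𝕜)) where
  compactSpace := inferInstance
  t2Space := inferInstance
  isManifold := inferInstance
  isManifoldWithBoundary := isManifoldWithBoundary_product
  boundaryless := inferInstance
  contMDiff := contMDiff_polarMap
  range_eq := range_polarMap
  exists_inverse := ⟨polarInverse, polarInverse_polarMap, contMDiffOn_polarInverse⟩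

theorem isEmbedding_boundaryIncl : Topology.IsEmbedding (boundaryIncl 𝕜) := by
  refine Topology.IsEmbedding.id.prodMap ?_
  refine Topology.IsEmbedding.of_comp ?_ continuous_subtype_val ?_
  · exact continuous_subtype_val.subtype_mk _
  · exact Topology.IsEmbedding.subtypeVal

variable (𝕜) in
/-- The projection `K × ∂B → ∂B` as a trivial bundle with fibre `K`. -/
def boundaryTrivialization :
    Bundle.Trivialization (specialUnitaryGroup (Fin 2) 𝕜)
      (Prod.snd : specialUnitaryGroup (Fin 2) 𝕜 × TraceOneSphere 𝕜 → TraceOneSphere 𝕜) where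
  toOpenPartialHomeomorph := (Homeomorph.prodComm _ _).toOpenPartialHomeomorph
  baseSet := Set.univ
  open_baseSet := isOpen_univ
  source_eq := rfl
  target_eq := Set.univ_prod_univ.symm
  proj_toFun _ _ := rfl

theorem isBoundaryFibration_boundaryIncl :
    IsBoundaryFibration (productModel 𝕜) (boundaryModel 𝕜) (𝓡 (finrank ℝ 𝕜))
      (𝓡 (2 * finrank ℝ 𝕜 - 1)) (specialUnitaryGroup (Fin 2) 𝕜) (boundaryIncl 𝕜)
      (Prod.snd : specialUnitaryGroup (Fin 2) 𝕜 × TraceOneSphere 𝕜 → TraceOneSphere 𝕜) where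
  boundaryless_total := inferInstance
  boundaryless_base := inferInstance
  boundaryless_fibre := inferInstance
  contMDiff_incl := contMDiff_boundaryIncl
  isEmbedding_incl := isEmbedding_boundaryIncl
  immersion_incl := injective_mfderiv_boundaryIncl
  range_incl := range_boundaryIncl
  t2_base := inferInstance
  t2_fibre := inferInstance
  compact_fibre := inferInstance
  locally_trivial := fun _ => ⟨boundaryTrivialization 𝕜, trivial,
    (contMDiff_snd.prodMk contMDiff_fst).contMDiffOn,
    (contMDiff_snd.prodMk contMDiff_fst).contMDiffOn⟩

end ProductBoundary

theorem mainTheorem1 (𝕜 : Type*) [RCLike 𝕜] :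
    ∃ ι : Matrix.SpecialLinearGroup (Fin 2) 𝕜 →
        Matrix.specialUnitaryGroup (Fin 2) 𝕜 × TraceOneBall 𝕜,
      (∀ g : Matrix.SpecialLinearGroup (Fin 2) 𝕜, ∃ a : Matrix (Fin 2) (Fin 2) 𝕜,
        a.PosDef ∧ a * a = (g : Matrix (Fin 2) (Fin 2) 𝕜).conjTranspose * g ∧
        (g : Matrix (Fin 2) (Fin 2) 𝕜) = (ι g).1 * a ∧
        ((ι g).2 : Matrix (Fin 2) (Fin 2) 𝕜) = a.trace⁻¹ • a) ∧
      IsHDCompactification 𝓘(ℝ, 𝕜 × 𝕜 × 𝕜)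
        ((𝓡 (2 * Module.finrank ℝ 𝕜 - 1)).prod (TraceOneBall.model 𝕜))
        ((𝓡 (2 * Module.finrank ℝ 𝕜 - 1)).prod (𝓡 (Module.finrank ℝ 𝕜)))
        (𝓡 (Module.finrank ℝ 𝕜))
        (𝓡 (2 * Module.finrank ℝ 𝕜 - 1))
        (Matrix.specialUnitaryGroup (Fin 2) 𝕜)
        ι
        (Prod.map id TraceOneSphere.incl :
          Matrix.specialUnitaryGroup (Fin 2) 𝕜 × TraceOneSphere 𝕜 →
            Matrix.specialUnitaryGroup (Fin 2) 𝕜 × TraceOneBall 𝕜)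
        (Prod.snd : Matrix.specialUnitaryGroup (Fin 2) 𝕜 × TraceOneSphere 𝕜 →
          TraceOneSphere 𝕜) := by
  exact ⟨polarMap, polarMap_spec,
    { isCompactification := isCompactification_polarMap
      isBoundaryFibration := isBoundaryFibration_boundaryIncl
      inversion := ⟨polarInversionDiffeomorph, polarInversion_polarMap⟩
      right_lift := exists_isLift_right
      left_lift := exists_isLift_left
      right_span := smoothSpan_right_eq
      left_right_span := smoothSpan_left_right_eq }⟩
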